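/- Let $\alpha\ge 0$ and let $(a_k)_{k\ge1}$, $(b_k)_{k\ge1}$ be two independent centered stationary Gaussian processes with the same correlation function $\mathbb E[a_ka_l]=\mathbb E[b_kb_l]=\cos((k-l)\alpha)$. For $n\ge 1$ put $$f_n(t)=\frac1{\sqrt n}\sum_{k=1}^n \bigl(a_k\cos(kt)+b_k\sin(kt)\bigr),\qquad t\in\mathbb R,$$ and let $\mathcal N(f_n,[0,2\pi])$ be the number of distinct zeros of $f_n$ in $[0,2\pi]$. For $x\in(0,\pi)$ put $$\ell^\alpha(x)=\frac1{4\pi^2}\int_{[0,2\pi]^2}\sqrt{1+|g_x^\alpha(s,u)|^2}\,ds\,du,$$ $$g_x^\alpha(s,u)=\frac{\sin(x)\sin\left(\frac{s-\alpha}2\right)\sin\left(\frac{s+\alpha}2\right)}{\sin^2\left(\frac{u-x}2\right)\sin^2\left(\frac{s+\alpha}2\right)+\sin^2\left(\frac{u+x}2\right)\sin^2\left(\frac{s-\alpha}2\right)}.$$ Suppose that $\alpha\in\pi\mathbb Q$, and let $S\subset[0,\pi)$ be the (finite) set of values of $n\alpha \bmod \pi$, $n\ge1$. Then $\mathcal N(f_n,[0,2\pi])$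 is an integrable random variable for every $n\ge 1$, the integral defining $\ell^\alpha(x)$ is finite for every $x\in S\setminus\{0\}$, and for all $x\in S\setminus\{0\}$ $$\lim_{n\to\infty}\left|\frac{\mathbb E[\mathcal N(f_n,[0,2\pi])]}{n}-\ell^\alpha(x)\right|\mathbf 1_{n\alpha\equiv x \bmod \pi}=0 .$$ In particular, if $S\setminus\{0\}\neq\emptyset$ (that is, if $\alpha\notin\pi\mathbb Z$), then $\frac1n\mathbb E[\mathcal N(f_n,[0,2\pi])]$ does not converge as $n\to\infty$. -/

import Mathlib

open MeasureTheory ProbabilityTheory Filter Topology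
open scoped ENNReal

noncomputable section

namespace RandomTrig

/-- `a` and `b` are two independent, stationary, centered Gaussian processes, indexed by the
positive integers, with the same correlation function `ρ(k) = cos (k α)`. -/
structure IsCosineCorrelatedPair {Ω : Type*} [MeasurableSpace Ω] (P : Measure Ω) (α : ℝ)
    (a b : ℕ+ → Ω → ℝ) : Prop where
  gaussian_left : IsGaussianProcess a P
  gaussian_right : IsGaussianProcess b P
  centered_left : ∀ k, ∫ ω, a k ω ∂P = 0
  centered_right : ∀ k, ∫ ω, b k ω ∂P = 0
  correlation_left : ∀ k l : ℕ+,
    ∫ ω, a k ω * a l ω ∂P = Real.cos ((((k : ℕ) : ℝ) - ((l : ℕ) : ℝ)) * α)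
  correlation_right : ∀ k l : ℕ+,
    ∫ ω, b k ω * b l ω ∂P = Real.cos ((((k : ℕ) : ℝ) - ((l : ℕ) : ℝ)) * α)
  indep : IndepFun (fun ω k => a k ω) (fun ω k => b k ω) P

/-- The random trigonometric polynomial
`f_n(t) = n^{-1/2} ∑_{k=1}^n (a_k cos (k t) + b_k sin (k t))`.
The summation index `i` runs over `0, …, n - 1`, and `k = i + 1`. -/
def trigPoly {Ω : Type*} (a b : ℕ+ → Ω → ℝ) (n : ℕ) (ω : Ω) (t : ℝ) : ℝ :=
  1 / Real.sqrt n * ∑ i ∈ Finset.range n,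
    (a i.succPNat ω * Real.cos (((i + 1 : ℕ) : ℝ) * t) +
      b i.succPNat ω * Real.sin (((i + 1 : ℕ) : ℝ) * t))

/-- The number (possibly `∞`) of distinct zeros of `f` in `[0, 2π]`. -/
def numZeros (f : ℝ → ℝ) : ℕ∞ :=
  {t ∈ Set.Icc 0 (2 * Real.pi) | f t = 0}.encard

/-- The expectation of the number of zeros of `f_n` in `[0, 2π]`, as an extended nonnegative
number. -/
def expectedZeros {Ω : Type*} [MeasurableSpace Ω] (P : Measure Ω) (a b : ℕ+ → Ω → ℝ)
    (n : ℕ) : ℝ≥0∞ :=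
  ∫⁻ ω, ((numZeros (trigPoly a b n ω) : ℕ∞) : ℝ≥0∞) ∂P

/-- The function `g_x^α(s, u)`. -/
def g (α x s u : ℝ) : ℝ :=
  Real.sin x * Real.sin ((s - α) / 2) * Real.sin ((s + α) / 2) /
    (Real.sin ((u - x) / 2) ^ 2 * Real.sin ((s + α) / 2) ^ 2 +
      Real.sin ((u + x) / 2) ^ 2 * Real.sin ((s - α) / 2) ^ 2)

/-- The square `[0, 2π]²`. -/
def square : Set (ℝ × ℝ) :=
  Set.Icc 0 (2 * Real.pi) ×ˢ Set.Icc 0 (2 * Real.pi)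

/-- The integrand `√(1 + |g_x^α(s, u)|²)` as a function of `p = (s, u)`. -/
def integrand (α x : ℝ) (p : ℝ × ℝ) : ℝ :=
  Real.sqrt (1 + |g α x p.1 p.2| ^ 2)

/-- `ℓ^α(x) = (4π²)⁻¹ ∫_{[0,2π]²} √(1 + |g_x^α(s, u)|²) ds du`. -/
def ell (α x : ℝ) : ℝ :=
  1 / (4 * Real.pi ^ 2) * ∫ p in square, integrand α x p

/-- The representative of `y` modulo `π` in `[0, π)`. -/
def modPi (y : ℝ) : ℝ := toIcoMod Real.pi_pos 0 y

/-- The set `S` of the values of `n α mod π`, for `n ≥ 1`. -/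
def residues (α : ℝ) : Set ℝ := {x | ∃ n : ℕ, 1 ≤ n ∧ modPi (n * α) = x}

end RandomTrig

end

noncomputable section

namespace RandomTrig

open scoped NNReal

/-! The correlation `cos (k α)` has rank two. When `sin α ≠ 0`, each sequence is therefore
determined by its first two terms, and `f_n` is a constant times a linear form in four independent
standard Gaussians (`exists_gaussian_decomposition`). Grouping the terms by the frequencies `t + α`
and `t - α` turns the coefficient vector into two planar vectors of signed lengths `D_±(t) = sin (n
(t ± α) / 2) / sin ((t ± α) / 2)`, both turning at speed `(n + 1) / 2`.

By Kac-Rice (`lintegral_encard_zeros`), the expected number of zeros is `1 / π` times the length of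
the curve traced by the normalized coefficient vector on the unit sphere. The squared speed is the
square of `(n + 1) / 2` plus the square of the derivative of `arctan (D_- / D_+)`, and that
derivative is `n / 2` times `rotation` (`lintegral_encard_clearedPoly`). The formula counts all
zeros when `n α ∉ π ℤ`, since then the coefficient vector never vanishes.

For the limit, `[0, 2π]` is cut into `n` cells. A point is described by its macroscopic position `s`
and its phase `u` in the cell, and `integral_cellPoint` rewrites the length exactly as an integral
over the square of `(s, u)`. If `n α ≡ x` modulo `π`, the square of `rotation` tends to that of `g α
x s u`. The convergence is dominated, because `|rotation|` is at most a constant times `1 / √(|cos x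
- cos u| |cos α - cos s|)`, which is integrable (`mul_rotation_sq_mul_le`,
`tendsto_integral_rotation_cellPoint`).

For the divergence, `|g|` is a Poisson kernel in `u` and has mean `1` over the square. Hence `√(1 +
g²) < 1 + |g|` gives `ℓ < 2` (`ell_lt_two`). Along the `n` with `n α ∈ 2π ℤ`, both `D_±` vanish at
the points `2πj / n` with at most two exceptions. These `n - 2` deterministic zeros add to at least
`n + 1` expected random ones, so the ratio is at least `2 - 1 / n`. -/

/-! ### The area formula on the line -/

/-- The cardinality of a countable disjoint union is the sum of the cardinalities. -/
theorem encard_iUnion_eq_tsum {β : Type*} {s : ℕ → Set β} (hs : Pairwise (Function.onFun Disjoint s)) :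
    ((⋃ n, s n).encard : ℝ≥0∞) = ∑' n, ((s n).encard : ℝ≥0∞) := by
  let _ : MeasurableSpace β := ⊤
  have h := measure_iUnion (μ := (Measure.count : Measure β)) hs (fun _ => trivial)
  simpa [Measure.count_apply, MeasurableSpace.measurableSet_top] using h

theorem injOn_of_approximatesLinearOn {f : ℝ → ℝ} {A : ℝ →L[ℝ] ℝ} {s : Set ℝ} {c : ℝ≥0}
    (h : ApproximatesLinearOn f A s c) (hc : (c : ℝ) < |A 1|) : Set.InjOn f s := by
  intro x hx y hy hxy
  have h1 := h x hx y hy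
  have h2 : A (x - y) = (x - y) * A 1 := by
    have := A.map_smul (x - y) (1 : ℝ)
    simpa using this
  rw [hxy, sub_self, zero_sub, norm_neg, h2, norm_mul, Real.norm_eq_abs, Real.norm_eq_abs] at h1
  by_contra hne
  have : 0 < |x - y| := abs_pos.2 (sub_ne_zero.2 hne)
  nlinarith

/-- The area formula on the line, for functions that need not be injective. -/
theorem lintegral_encard_fiber_mul {S : Set ℝ} (hS : MeasurableSet S) {f f' : ℝ → ℝ}
    (hf : ∀ x ∈ S, HasDerivAt f (f' x) x) (hf' : Measurable f')
    {g : ℝ → ℝ≥0∞} (hg : Measurable g) :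
    ∫⁻ y, ((S ∩ f ⁻¹' {y}).encard : ℝ≥0∞) * g y
      = ∫⁻ x in S, ENNReal.ofReal |f' x| * g (f x) := by
  set S₀ := S ∩ {x | f' x = 0} with hS₀
  set S₁ := S ∩ {x | f' x ≠ 0} with hS₁
  have hS₁m : MeasurableSet S₁ := hS.inter (hf' (measurableSet_singleton 0).compl)
  have hS₀m : MeasurableSet S₀ := hS.inter (hf' (measurableSet_singleton 0))
  -- Critical values form a null set, so only the fibres over the other values matter.
  have hnull : volume (f '' S₀) = 0 := by
    refine addHaar_image_eq_zero_of_det_fderivWithin_eq_zero volume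
      (f' := fun x => ContinuousLinearMap.toSpanSingleton ℝ (f' x))
      (fun x hx => ((hf x hx.1).hasDerivWithinAt).hasFDerivWithinAt) ?_
    intro x hx
    have : f' x = 0 := hx.2
    simp [this]
  obtain ⟨t, A, htd, htm, hcov, happ, hA⟩ := exists_partition_approximatesLinearOn_of_hasFDerivWithinAt
    f S₁ (fun x => ContinuousLinearMap.toSpanSingleton ℝ (f' x))
    (fun x hx => ((hf x hx.1).hasDerivWithinAt).hasFDerivWithinAt)
    -- An error of half the slope forces injectivity on each piece. The value `1` only meets the
    -- positivity requirement: on `S₁` the slopes are nonzero.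
    (fun A => if A 1 = 0 then 1 else ‖A 1‖₊ / 2)
    (by intro A; split_ifs with h <;> simp [h])
  have hinj : ∀ n, Set.InjOn f (S₁ ∩ t n) := by
    intro n
    rcases Set.eq_empty_or_nonempty S₁ with he | hne
    · simp [he]
    obtain ⟨y, hy, hAy⟩ := hA hne n
    have hA1 : A n 1 ≠ 0 := by
      rw [hAy]; simpa using hy.2
    have h := happ n
    rw [if_neg hA1] at h
    refine injOn_of_approximatesLinearOn h ?_
    have : 0 < |A n 1| := abs_pos.2 hA1
    simp only [NNReal.coe_div, coe_nnnorm, Real.norm_eq_abs, NNReal.coe_ofNat]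
    linarith
  have hderiv : ∀ n, ∀ x ∈ S₁ ∩ t n, HasDerivWithinAt f (f' x) (S₁ ∩ t n) x :=
    fun n x hx => (hf x hx.1.1).hasDerivWithinAt
  have himg : ∀ n, MeasurableSet (f '' (S₁ ∩ t n)) := fun n =>
    measurable_image_of_fderivWithin (hS₁m.inter (htm n))
      (fun x hx => (hderiv n x hx).hasFDerivWithinAt) (hinj n)
  have hS₁U : S₁ = ⋃ n, S₁ ∩ t n := by
    rw [← Set.inter_iUnion, Set.inter_eq_left.2 hcov]
  have hdisj : Pairwise (Function.onFun Disjoint fun n => S₁ ∩ t n) := fun i j hij =>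
    (htd hij).mono Set.inter_subset_right Set.inter_subset_right
  have hae : ∀ᵐ y, ((S ∩ f ⁻¹' {y}).encard : ℝ≥0∞) * g y
      = ∑' n, (f '' (S₁ ∩ t n)).indicator g y := by
    have : ∀ᵐ y, y ∉ f '' S₀ := compl_mem_ae_iff.2 hnull
    filter_upwards [this] with y hy
    have h1 : S ∩ f ⁻¹' {y} = ⋃ n, (S₁ ∩ t n) ∩ f ⁻¹' {y} := by
      rw [← Set.iUnion_inter, ← hS₁U]
      ext x
      constructor
      · rintro ⟨hx, hxy⟩
        refine ⟨⟨hx, fun h0 => hy ⟨x, ⟨hx, h0⟩, hxy⟩⟩, hxy⟩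
      · rintro ⟨hx, hxy⟩
        exact ⟨hx.1, hxy⟩
    rw [h1, encard_iUnion_eq_tsum (fun i j hij =>
      (hdisj hij).mono Set.inter_subset_left Set.inter_subset_left), ← ENNReal.tsum_mul_right]
    congr 1
    ext n
    by_cases hyn : y ∈ f '' (S₁ ∩ t n)
    · rw [Set.indicator_of_mem hyn]
      obtain ⟨x, hx, hxy⟩ := hyn
      have : (S₁ ∩ t n) ∩ f ⁻¹' {y} = {x} := by
        ext z
        constructor
        · rintro ⟨hz, hzy⟩
          exact hinj n hz hx (by rw [hxy]; exact hzy)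
        · rintro rfl
          exact ⟨hx, hxy⟩
      rw [this]
      simp
    · rw [Set.indicator_of_notMem hyn]
      have : (S₁ ∩ t n) ∩ f ⁻¹' {y} = ∅ := by
        ext z
        simp only [Set.mem_inter_iff, Set.mem_preimage, Set.mem_singleton_iff,
          Set.mem_empty_iff_false, iff_false]
        rintro ⟨hz, hzy⟩
        exact hyn ⟨z, hz, hzy⟩
      rw [this]
      simp
  rw [lintegral_congr_ae hae, lintegral_tsum (fun n => (hg.indicator (himg n)).aemeasurable)]
  have hterm : ∀ n, ∫⁻ y, (f '' (S₁ ∩ t n)).indicator g y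
      = ∫⁻ x in S₁ ∩ t n, ENNReal.ofReal |f' x| * g (f x) := fun n => by
    rw [lintegral_indicator (himg n)]
    exact lintegral_image_eq_lintegral_abs_deriv_mul (hS₁m.inter (htm n)) (hderiv n) (hinj n) g
  simp_rw [hterm]
  rw [← lintegral_iUnion (fun n => hS₁m.inter (htm n)) hdisj, ← hS₁U]
  have hSU : S = S₀ ∪ S₁ := by
    ext x; simp only [hS₀, hS₁, Set.mem_union, Set.mem_inter_iff, Set.mem_ofPred_eq]; tauto
  have hd : Disjoint S₀ S₁ := by
    rw [Set.disjoint_left]; rintro x hx hx'; exact hx'.2 hx.2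
  conv_rhs => rw [hSU, lintegral_union hS₁m hd]
  rw [setLIntegral_congr_fun hS₀m (g := fun _ => 0)
    (fun x hx => by have : f' x = 0 := hx.2; simp [this])]
  simp

/-! ### Measurability of the number of zeros -/

/-- Whether a continuous function has a zero in a compact interval depends measurably on
parameters. -/
theorem measurableSet_exists_zero_Icc {Y : Type*} [MeasurableSpace Y] {f : Y → ℝ → ℝ}
    (hm : ∀ t, Measurable fun y => f y t) (hc : ∀ y, Continuous (f y)) (a b : ℝ) :
    MeasurableSet {y | ∃ t ∈ Set.Icc a b, f y t = 0} := by
  obtain ⟨D, hDs, hDc, hDd⟩ :=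
    (TopologicalSpace.IsSeparable.of_separableSpace (Set.Icc a b)).exists_countable_dense_subset
  -- By compactness `|f y|` attains its minimum, so a zero exists as soon as the infimum over a
  -- countable dense set is `0`.
  have key : {y | ∃ t ∈ Set.Icc a b, f y t = 0}
      = ⋂ k : ℕ, ⋃ t ∈ D, {y | |f y t| < 1 / ((k : ℝ) + 1)} := by
    ext y
    simp only [Set.mem_ofPred_eq, Set.mem_iInter, Set.mem_iUnion, exists_prop]
    constructor
    · rintro ⟨t, ht, h0⟩ k
      have hcont : ContinuousAt (fun s => |f y s|) t := ((hc y).abs).continuousAt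
      have hlt : |f y t| < 1 / ((k : ℝ) + 1) := by
        rw [h0, abs_zero]; positivity
      have hev := hcont.eventually (gt_mem_nhds hlt)
      obtain ⟨s, hs, hsD⟩ := (mem_closure_iff_nhds.1 (hDd ht)) _ hev
      exact ⟨s, hsD, hs⟩
    · intro h
      rcases Set.eq_empty_or_nonempty (Set.Icc a b) with he | hne
      · obtain ⟨t, htD, -⟩ := h 0
        have := hDs htD
        rw [he] at this
        exact absurd this (Set.notMem_empty _)
      obtain ⟨t, ht, hmin⟩ := (isCompact_Icc (a := a) (b := b)).exists_isMinOn hne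
        ((hc y).abs.continuousOn)
      refine ⟨t, ht, ?_⟩
      by_contra hne0
      obtain ⟨k, hk⟩ := exists_nat_one_div_lt (abs_pos.2 hne0)
      obtain ⟨s, hs, hlt⟩ := h k
      have := hmin (hDs hs)
      simp only [Set.mem_ofPred_eq] at this
      linarith
  rw [key]
  exact MeasurableSet.iInter fun k => MeasurableSet.biUnion hDc fun t _ =>
    measurableSet_lt (hm t).abs measurable_const

theorem measurableSet_exists_zero_inter_Ico {Y : Type*} [MeasurableSpace Y] {f : Y → ℝ → ℝ}
    (hm : ∀ t, Measurable fun y => f y t) (hc : ∀ y, Continuous (f y)) (a b c d : ℝ) :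
    MeasurableSet {y | ∃ t ∈ Set.Icc a b ∩ Set.Ico c d, f y t = 0} := by
  have key : {y | ∃ t ∈ Set.Icc a b ∩ Set.Ico c d, f y t = 0}
      = ⋃ k : ℕ, {y | ∃ t ∈ Set.Icc (max a c) (min b (d - 1 / ((k : ℝ) + 1))), f y t = 0} := by
    ext y
    simp only [Set.mem_ofPred_eq, Set.mem_iUnion, Set.mem_inter_iff, Set.mem_Icc, Set.mem_Ico,
      max_le_iff, le_min_iff]
    constructor
    · rintro ⟨t, ⟨⟨h1, h2⟩, h3, h4⟩, h0⟩
      obtain ⟨k, hk⟩ := exists_nat_one_div_lt (sub_pos.2 h4)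
      exact ⟨k, t, ⟨⟨h1, h3⟩, h2, by linarith⟩, h0⟩
    · rintro ⟨k, t, ⟨⟨h1, h3⟩, h2, h4⟩, h0⟩
      have : 0 < 1 / ((k : ℝ) + 1) := by positivity
      exact ⟨t, ⟨⟨h1, h2⟩, h3, by linarith⟩, h0⟩
  rw [key]
  exact MeasurableSet.iUnion fun k => measurableSet_exists_zero_Icc hm hc _ _

/-- A finite set of reals is separated by a sufficiently fine grid. -/
theorem exists_injOn_floor_mul (F : Finset ℝ) :
    ∃ m : ℕ, Set.InjOn (fun t : ℝ => ⌊((m : ℝ) + 1) * t⌋) F := by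
  have hpair : ∀ p : ℝ × ℝ, ∃ m : ℕ, p.1 ≠ p.2 → 1 < m * |p.1 - p.2| := by
    intro p
    by_cases h : p.1 = p.2
    · exact ⟨0, fun h' => absurd h h'⟩
    · have hpos : 0 < |p.1 - p.2| := abs_pos.2 (sub_ne_zero.2 h)
      obtain ⟨m, hm⟩ := exists_nat_gt (1 / |p.1 - p.2|)
      exact ⟨m, fun _ => (div_lt_iff₀ hpos).1 hm⟩
  choose m hm using hpair
  refine ⟨(F ×ˢ F).sup m, fun x hx y hy hxy => ?_⟩
  by_contra hne
  have h1 := hm (x, y) hne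
  have h2 : m (x, y) ≤ (F ×ˢ F).sup m :=
    Finset.le_sup (Finset.mk_mem_product (Finset.mem_coe.1 hx) (Finset.mem_coe.1 hy))
  have h2' : (m (x, y) : ℝ) ≤ ((F ×ˢ F).sup m : ℕ) := by exact_mod_cast h2
  have h3 := Int.abs_sub_lt_one_of_floor_eq_floor hxy
  rw [← mul_sub, abs_mul, abs_of_nonneg (by positivity)] at h3
  have := abs_nonneg (x - y)
  simp only at h1
  nlinarith

/-- The number of elements of a set of reals is the supremum of the numbers of cells of
equidistant grids which it meets. -/
theorem encard_eq_iSup_encard_floor (Z : Set ℝ) :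
    Z.encard = ⨆ m : ℕ, ((fun t : ℝ => ⌊((m : ℝ) + 1) * t⌋) '' Z).encard := by
  refine le_antisymm ?_ (iSup_le fun m => Set.encard_image_le _ _)
  refine ENat.forall_natCast_le_iff_le.1 fun k hk => ?_
  obtain ⟨F, hFZ, hF⟩ := Set.exists_subset_encard_eq hk
  have hFfin : F.Finite := Set.finite_of_encard_eq_coe hF
  obtain ⟨m, hm⟩ := exists_injOn_floor_mul hFfin.toFinset
  rw [hFfin.coe_toFinset] at hm
  refine le_trans ?_ (le_iSup _ m)
  rw [← hF, ← hm.encard_image]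
  exact Set.encard_le_encard (Set.image_mono hFZ)

/-- The count is the supremum over `m` of the number of cells of mesh `1 / (m + 1)` that contain a
zero, and each such event is measurable. Half-open cells make each point belong to exactly one cell.
-/
theorem measurable_numZeros {Y : Type*} [MeasurableSpace Y] {f : Y → ℝ → ℝ}
    (hm : ∀ t, Measurable fun y => f y t) (hc : ∀ y, Continuous (f y)) :
    Measurable fun y => ((numZeros (f y) : ℕ∞) : ℝ≥0∞) := by
  have h : ∀ y, ((numZeros (f y) : ℕ∞) : ℝ≥0∞) = ⨆ m : ℕ, ∑' j : ℤ,
      {y | ∃ t ∈ Set.Icc 0 (2 * Real.pi) ∩ Set.Ico ((j : ℝ) / ((m : ℝ) + 1))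
        (((j : ℝ) + 1) / ((m : ℝ) + 1)), f y t = 0}.indicator (fun _ => (1 : ℝ≥0∞)) y := by
    intro y
    rw [numZeros, encard_eq_iSup_encard_floor, ENat.toENNReal_iSup]
    congr 1
    ext m
    rw [← ENNReal.tsum_set_one, tsum_subtype _ (fun _ => (1 : ℝ≥0∞))]
    congr 1
    ext j
    have hpos : (0 : ℝ) < (m : ℝ) + 1 := by positivity
    have : (j ∈ (fun t : ℝ => ⌊((m : ℝ) + 1) * t⌋) '' {t ∈ Set.Icc 0 (2 * Real.pi) | f y t = 0})
        ↔ y ∈ {y | ∃ t ∈ Set.Icc 0 (2 * Real.pi) ∩ Set.Ico ((j : ℝ) / ((m : ℝ) + 1))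
        (((j : ℝ) + 1) / ((m : ℝ) + 1)), f y t = 0} := by
      simp only [Set.mem_image, Set.mem_ofPred_eq, Set.mem_inter_iff, Set.mem_Ico, Int.floor_eq_iff,
        div_le_iff₀ hpos, lt_div_iff₀ hpos]
      constructor
      · rintro ⟨t, ⟨h1, h2⟩, h3, h4⟩
        exact ⟨t, ⟨h1, by linarith, by linarith⟩, h2⟩
      · rintro ⟨t, ⟨h1, h3, h4⟩, h2⟩
        exact ⟨t, ⟨h1, h2⟩, by linarith, by linarith⟩
    by_cases hj : j ∈ (fun t : ℝ => ⌊((m : ℝ) + 1) * t⌋) ''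
        {t ∈ Set.Icc 0 (2 * Real.pi) | f y t = 0}
    · rw [Set.indicator_of_mem hj, Set.indicator_of_mem (this.1 hj)]
    · rw [Set.indicator_of_notMem hj, Set.indicator_of_notMem (fun h => hj (this.2 h))]
  simp_rw [h]
  refine Measurable.iSup fun m => Measurable.tsum fun j => ?_
  exact measurable_const.indicator (measurableSet_exists_zero_inter_Ico hm hc _ _ _ _)

/-! ### Gaussian integrals -/

open scoped NNReal

/-- The first absolute moment of a centered Gaussian variable. -/
theorem lintegral_abs_gaussianReal (s : ℝ) (hs : 0 ≤ s) (v : ℝ≥0) (hv : (v : ℝ) = s ^ 2) :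
    ∫⁻ x, ENNReal.ofReal |x| ∂(gaussianReal 0 v) = ENNReal.ofReal (s * Real.sqrt (2 / Real.pi)) := by
  have h1 : ∫⁻ x, ENNReal.ofReal |x| ∂(gaussianReal 0 1)
      = ENNReal.ofReal (Real.sqrt (2 / Real.pi)) := by
    have h0 := ofReal_integral_eq_lintegral_ofReal
      ((IsGaussian.integrable_id (μ := gaussianReal 0 1)).abs) (ae_of_all _ fun x => abs_nonneg _)
    simp only [id] at h0
    rw [← h0]
    congr 1
    rw [integral_gaussianReal_eq_integral_smul one_ne_zero]
    have h2 : ∀ x : ℝ, gaussianPDFReal 0 1 x • |x|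
        = (fun y : ℝ => (Real.sqrt (2 * Real.pi))⁻¹ * (y ^ (1 : ℝ) * Real.exp (-(1 / 2) * y ^ (2 : ℝ))))
          |x| := by
      intro x
      simp only [gaussianPDFReal, smul_eq_mul, Real.rpow_one, NNReal.coe_one, mul_one, sub_zero,
        Real.rpow_two, sq_abs]
      rw [show -x ^ 2 / 2 = -(1 / 2) * x ^ 2 by ring]
      ring
    simp_rw [h2]
    rw [integral_comp_abs (f := fun y : ℝ => (Real.sqrt (2 * Real.pi))⁻¹ *
      (y ^ (1 : ℝ) * Real.exp (-(1 / 2) * y ^ (2 : ℝ)))), integral_const_mul,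
      integral_rpow_mul_exp_neg_mul_rpow (by norm_num) (by norm_num) (by norm_num)]
    have hpi := Real.pi_pos
    norm_num
    have e1 : Real.sqrt Real.pi ^ 2 = Real.pi := Real.sq_sqrt hpi.le
    have e2 : Real.sqrt 2 ^ 2 = 2 := Real.sq_sqrt (by norm_num)
    have p1 : 0 < Real.sqrt Real.pi := Real.sqrt_pos.2 hpi
    have p2 : 0 < Real.sqrt 2 := Real.sqrt_pos.2 (by norm_num)
    field_simp
    nlinarith
  have h3 : gaussianReal 0 v = (gaussianReal 0 1).map (fun x => s * x) := by
    rw [gaussianReal_map_const_mul]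
    congr 1
    · simp
    · ext; simp [hv]
  rw [h3, lintegral_map (by fun_prop) (by fun_prop)]
  simp_rw [abs_mul, abs_of_nonneg hs, ENNReal.ofReal_mul hs]
  rw [lintegral_const_mul _ (by fun_prop), h1]

/-- Tilting the standard Gaussian measure by a Gaussian density yields a Gaussian measure. -/
theorem lintegral_gaussianPDFReal_mul {σ : ℝ} {H : ℝ → ℝ≥0∞} (hH : Measurable H) :
    ∫⁻ x, ENNReal.ofReal (gaussianPDFReal 0 1 (σ * x)) * H x ∂(gaussianReal 0 1)
      = ENNReal.ofReal ((Real.sqrt (2 * Real.pi) * Real.sqrt (1 + σ ^ 2))⁻¹) *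
        ∫⁻ x, H x ∂(gaussianReal 0 (Real.toNNReal (1 + σ ^ 2)⁻¹)) := by
  have hpos : 0 < 1 + σ ^ 2 := by positivity
  have hm : Measurable fun x => ENNReal.ofReal (gaussianPDFReal 0 1 (σ * x)) * H x := by
    have := measurable_gaussianPDFReal 0 1
    fun_prop
  have hv : Real.toNNReal (1 + σ ^ 2)⁻¹ ≠ 0 := by
    simpa using hpos
  have hvc : ((Real.toNNReal (1 + σ ^ 2)⁻¹ : ℝ≥0) : ℝ) = (1 + σ ^ 2)⁻¹ :=
    Real.coe_toNNReal _ (by positivity)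
  rw [gaussianReal_of_var_ne_zero 0 one_ne_zero, gaussianReal_of_var_ne_zero 0 hv,
    lintegral_withDensity_eq_lintegral_mul _ (measurable_gaussianPDF 0 1)
      hm,
    lintegral_withDensity_eq_lintegral_mul _ (measurable_gaussianPDF 0 _) hH,
    ← lintegral_const_mul _ ((measurable_gaussianPDF 0 _).mul hH)]
  congr 1
  ext x
  simp only [Pi.mul_apply, gaussianPDF]
  rw [← mul_assoc, ← mul_assoc, ← ENNReal.ofReal_mul (gaussianPDFReal_nonneg _ _ _),
    ← ENNReal.ofReal_mul (by positivity)]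
  congr 2
  simp only [gaussianPDFReal, hvc, NNReal.coe_one, mul_one, sub_zero]
  have e : Real.sqrt (2 * Real.pi * (1 + σ ^ 2)⁻¹)
      = Real.sqrt (2 * Real.pi) / Real.sqrt (1 + σ ^ 2) := by
    rw [← div_eq_mul_inv, Real.sqrt_div (by positivity)]
  rw [e]
  have hx : Real.exp (-x ^ 2 / (2 * (1 + σ ^ 2)⁻¹)) = Real.exp (-x ^ 2 / 2) * Real.exp (-(σ * x) ^ 2 / 2) := by
    rw [← Real.exp_add]
    congr 1
    field_simp
    ring
  rw [hx]
  have hq : 0 < Real.sqrt (1 + σ ^ 2) := Real.sqrt_pos.2 hpos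
  have hp : 0 < Real.sqrt (2 * Real.pi) := Real.sqrt_pos.2 (by positivity)
  field_simp

section Pair

variable {E : Type*} [NormedAddCommGroup E] [InnerProductSpace ℝ E] [FiniteDimensional ℝ E]
  [MeasurableSpace E] [BorelSpace E]

theorem map_inner_stdGaussian (y : E) :
    (stdGaussian E).map (fun z => inner ℝ y z) = gaussianReal 0 (‖y‖₊ ^ 2) := by
  have h : HasGaussianLaw (fun z : E => innerSL ℝ y z) (stdGaussian E) :=
    (IsGaussian.hasGaussianLaw_id (μ := stdGaussian E)).map_fun (innerSL ℝ y)
  have h2 := h.map_eq_gaussianReal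
  have h3 : Var[fun z : E => innerSL ℝ y z; stdGaussian E] = ‖y‖ ^ 2 := by
    have := variance_dual_stdGaussian (E := E) (innerSL ℝ y)
    simpa using this
  rw [integral_strongDual_stdGaussian, h3] at h2
  rw [show (fun z => inner ℝ y z) = fun z : E => innerSL ℝ y z from rfl, h2]
  congr 1
  ext
  simp

/-- Orthogonality means zero covariance, which for a jointly Gaussian pair means independence. -/
theorem map_inner_pair_stdGaussian {y w : E} (h : inner ℝ y w = 0) :
    (stdGaussian E).map (fun z => (inner ℝ y z, inner ℝ w z))
      = (gaussianReal 0 (‖y‖₊ ^ 2)).prod (gaussianReal 0 (‖w‖₊ ^ 2)) := by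
  have hg : HasGaussianLaw (fun z : E => (inner ℝ y z, inner ℝ w z)) (stdGaussian E) :=
    (IsGaussian.hasGaussianLaw_id (μ := stdGaussian E)).map_fun ((innerSL ℝ y).prod (innerSL ℝ w))
  have hc : cov[fun z : E => inner ℝ y z, fun z => inner ℝ w z; stdGaussian E] = 0 := by
    rw [← covarianceBilin_apply_eq_cov (IsGaussian.memLp_two_id), covarianceBilin_stdGaussian]
    exact h
  have hi := hg.indepFun_of_covariance_eq_zero hc
  rw [indepFun_iff_map_prod_eq_prod_map_map (by fun_prop) (by fun_prop)] at hi
  rw [hi, map_inner_stdGaussian, map_inner_stdGaussian]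

/-- The Gaussian integral which turns the Kac-Rice formula into the speed of a curve on the
sphere. -/
theorem lintegral_gaussianPDFReal_inner_mul_abs_inner (y w : E) :
    ∫⁻ z, ENNReal.ofReal (gaussianPDFReal 0 1 (inner ℝ y z)) * ENNReal.ofReal |inner ℝ w z|
        ∂(stdGaussian E)
      = ENNReal.ofReal (Real.pi⁻¹ * (Real.sqrt (‖w‖ ^ 2 * (1 + ‖y‖ ^ 2) - inner ℝ y w ^ 2)
          / (1 + ‖y‖ ^ 2))) := by
  set σ := ‖y‖ with hσ
  set r : ℝ := inner ℝ y w with hr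
  -- Regression coefficient of `⟪w, z⟫` on `⟪y, z⟫`; the residual `⟪w', z⟫` is independent of `⟪y,
  -- z⟫`. If `y = 0`, division by zero gives `c = 0`, which is the right value.
  set c : ℝ := r / σ ^ 2 with hc
  set w' := w - c • y with hw'
  have hcr : c * σ ^ 2 = r := by
    rw [hc]
    by_cases h0 : σ = 0
    · have : y = 0 := norm_eq_zero.1 h0
      simp [hr, this, h0]
    · field_simp
  have horth : inner ℝ y w' = 0 := by
    rw [hw', inner_sub_right, inner_smul_right, real_inner_self_eq_norm_sq, ← hr, ← hσ, hcr, sub_self]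
  have hw'n : ‖w'‖ ^ 2 = ‖w‖ ^ 2 - c ^ 2 * σ ^ 2 := by
    have : w = c • y + w' := by rw [hw']; abel
    have h1 : ‖w‖ ^ 2 = ‖c • y‖ ^ 2 + ‖w'‖ ^ 2 := by
      conv_lhs => rw [this]
      have h0 : inner ℝ (c • y) w' = 0 := by rw [inner_smul_left, horth]; simp
      have := norm_add_sq_eq_norm_sq_add_norm_sq_of_inner_eq_zero (c • y) w' h0
      nlinarith
    rw [h1, norm_smul, mul_pow, Real.norm_eq_abs, sq_abs]
    ring
  have hsplit : ∀ z : E, inner ℝ w z = c * inner ℝ y z + inner ℝ w' z := by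
    intro z
    rw [hw', inner_sub_left, inner_smul_left]; simp
  have hpair := map_inner_pair_stdGaussian horth
  have hscale : gaussianReal 0 (‖y‖₊ ^ 2) = (gaussianReal 0 1).map (fun x => σ * x) := by
    rw [gaussianReal_map_const_mul]
    congr 1
    · simp
    · ext; simp [hσ]
  have hmeasF : Measurable fun p : ℝ × ℝ => ENNReal.ofReal (gaussianPDFReal 0 1 p.1) *
      ENNReal.ofReal |c * p.1 + p.2| := by
    have := measurable_gaussianPDFReal 0 1
    fun_prop
  set κ := 1 + σ ^ 2 with hκ
  have hκpos : 0 < κ := by positivity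
  have hcalc : ∫⁻ z, ENNReal.ofReal (gaussianPDFReal 0 1 (inner ℝ y z)) *
        ENNReal.ofReal |inner ℝ w z| ∂(stdGaussian E)
      = ENNReal.ofReal ((Real.sqrt (2 * Real.pi) * Real.sqrt κ)⁻¹) *
        ∫⁻ u, ENNReal.ofReal |u| ∂(gaussianReal 0 (Real.toNNReal ((c * σ) ^ 2) * Real.toNNReal κ⁻¹
          + ‖w'‖₊ ^ 2)) := by
    calc ∫⁻ z, ENNReal.ofReal (gaussianPDFReal 0 1 (inner ℝ y z)) *
        ENNReal.ofReal |inner ℝ w z| ∂(stdGaussian E)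
        = ∫⁻ p, ENNReal.ofReal (gaussianPDFReal 0 1 p.1) * ENNReal.ofReal |c * p.1 + p.2|
          ∂((stdGaussian E).map (fun z => (inner ℝ y z, inner ℝ w' z))) := by
          rw [lintegral_map hmeasF (by fun_prop)]
          simp_rw [hsplit]
      _ = ∫⁻ x, ∫⁻ v, ENNReal.ofReal (gaussianPDFReal 0 1 x) * ENNReal.ofReal |c * x + v|
            ∂(gaussianReal 0 (‖w'‖₊ ^ 2)) ∂(gaussianReal 0 (‖y‖₊ ^ 2)) := by
          rw [hpair, lintegral_prod _ hmeasF.aemeasurable]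
      _ = ∫⁻ x, ENNReal.ofReal (gaussianPDFReal 0 1 (σ * x)) *
            ∫⁻ v, ENNReal.ofReal |c * σ * x + v| ∂(gaussianReal 0 (‖w'‖₊ ^ 2))
            ∂(gaussianReal 0 1) := by
          rw [hscale, lintegral_map hmeasF.lintegral_prod_right' (by fun_prop)]
          congr 1
          ext x
          rw [← lintegral_const_mul _ (by fun_prop)]
          simp_rw [mul_assoc]
      _ = ENNReal.ofReal ((Real.sqrt (2 * Real.pi) * Real.sqrt κ)⁻¹) *
            ∫⁻ x, ∫⁻ v, ENNReal.ofReal |c * σ * x + v| ∂(gaussianReal 0 (‖w'‖₊ ^ 2))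
              ∂(gaussianReal 0 (Real.toNNReal κ⁻¹)) := by
          have hm : Measurable fun p : ℝ × ℝ => ENNReal.ofReal |c * σ * p.1 + p.2| := by fun_prop
          exact lintegral_gaussianPDFReal_mul hm.lintegral_prod_right'
      _ = _ := by
          congr 1
          have hm : Measurable fun p : ℝ × ℝ => ENNReal.ofReal |p.1 + p.2| := by fun_prop
          have e1 : gaussianReal 0 (Real.toNNReal ((c * σ) ^ 2) * Real.toNNReal κ⁻¹)
              = (gaussianReal 0 (Real.toNNReal κ⁻¹)).map (fun x => c * σ * x) := by
            rw [gaussianReal_map_const_mul]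
            congr 1
            · simp
            · ext
              simp [Real.coe_toNNReal _ (sq_nonneg (c * σ))]
          have e2 := gaussianReal_conv_gaussianReal (m₁ := 0) (m₂ := 0)
            (v₁ := Real.toNNReal ((c * σ) ^ 2) * Real.toNNReal κ⁻¹) (v₂ := ‖w'‖₊ ^ 2)
          rw [add_zero] at e2
          rw [← e2, Measure.lintegral_conv (by fun_prop), e1,
            lintegral_map hm.lintegral_prod_right' (by fun_prop)]
  -- The Gaussian weight shrinks the variance of `⟪y, z⟫ / σ` from `1` to `1 / κ`. This is the
  -- resulting variance of `⟪w, z⟫`, whose mean absolute value is then explicit.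
  have hG : (c * σ) ^ 2 * κ⁻¹ + ‖w'‖ ^ 2 = (‖w‖ ^ 2 * κ - r ^ 2) / κ := by
    rw [hw'n, ← hcr]
    field_simp
    rw [hκ]
    ring
  have hGnn : 0 ≤ (‖w‖ ^ 2 * κ - r ^ 2) / κ := by rw [← hG]; positivity
  have hGnn' : 0 ≤ ‖w‖ ^ 2 * κ - r ^ 2 := by
    have := mul_nonneg hGnn hκpos.le
    rwa [div_mul_cancel₀ _ hκpos.ne'] at this
  rw [hcalc, lintegral_abs_gaussianReal (Real.sqrt ((‖w‖ ^ 2 * κ - r ^ 2) / κ)) (Real.sqrt_nonneg _) _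
    (by
      rw [Real.sq_sqrt hGnn, ← hG]
      push_cast
      rw [Real.coe_toNNReal _ (by positivity), Real.coe_toNNReal _ (by positivity)]), ← ENNReal.ofReal_mul (by positivity)]
  congr 1
  rw [Real.sqrt_div hGnn', Real.sqrt_div (by norm_num), Real.sqrt_mul (by norm_num)]
  have hpi := Real.pi_pos
  have e1 : Real.sqrt Real.pi ^ 2 = Real.pi := Real.sq_sqrt hpi.le
  have e3 : Real.sqrt κ ^ 2 = κ := Real.sq_sqrt hκpos.le
  have p1 : 0 < Real.sqrt Real.pi := Real.sqrt_pos.2 hpi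
  have p2 : 0 < Real.sqrt 2 := Real.sqrt_pos.2 (by norm_num)
  have p3 : 0 < Real.sqrt κ := Real.sqrt_pos.2 hκpos
  field_simp
  rw [e1, e3]
  field_simp

end Pair

/-! ### The Kac-Rice formula and the speed of the curve -/

/-- **Kac-Rice formula**, for a Gaussian combination of smooth functions, the first of which is
constant. -/
theorem lintegral_encard_zeros {ι : Type*} [Fintype ι] {S : Set ℝ} (hS : MeasurableSet S)
    {y w : ℝ → ι → ℝ} (hy : ∀ i, ∀ t ∈ S, HasDerivAt (fun s => y s i) (w t i) t)
    (hym : ∀ i, Measurable fun t => y t i) (hwm : ∀ i, Measurable fun t => w t i) :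
    ∫⁻ z, ∫⁻ u, (({t ∈ S | u + ∑ i, z i * y t i = 0}.encard : ℕ∞) : ℝ≥0∞) ∂(gaussianReal 0 1)
        ∂(Measure.pi fun _ : ι => gaussianReal 0 1)
      = ∫⁻ t in S, ENNReal.ofReal (Real.pi⁻¹ *
          (Real.sqrt ((∑ i, w t i ^ 2) * (1 + ∑ i, y t i ^ 2) - (∑ i, y t i * w t i) ^ 2)
            / (1 + ∑ i, y t i ^ 2))) := by
  have hpdf := measurable_gaussianPDFReal 0 1
  -- For fixed `z`, the zeros are the fibre over `u` of `t ↦ -∑ z i * y t i`. The area formula,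
  -- weighted by the Gaussian density of `u`, counts them without any nondegeneracy condition.
  have hin : ∀ z : ι → ℝ,
      ∫⁻ u, (({t ∈ S | u + ∑ i, z i * y t i = 0}.encard : ℕ∞) : ℝ≥0∞) ∂(gaussianReal 0 1)
      = ∫⁻ t in S, ENNReal.ofReal (gaussianPDFReal 0 1 (∑ i, z i * y t i))
          * ENNReal.ofReal |∑ i, z i * w t i| := by
    intro z
    rw [gaussianReal_of_var_ne_zero 0 one_ne_zero,
      lintegral_withDensity_eq_lintegral_mul_non_measurable _ (measurable_gaussianPDF 0 1)
        (ae_of_all _ fun x => gaussianPDF_lt_top)]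
    have h := lintegral_encard_fiber_mul hS (f := fun t => -∑ i, z i * y t i)
      (f' := fun t => -∑ i, z i * w t i)
      (fun t ht => (HasDerivAt.fun_sum fun i _ => (hy i t ht).const_mul (z i)).neg)
      (by fun_prop) (measurable_gaussianPDF 0 1)
    have e1 : ∀ u, (gaussianPDF 0 1 * fun u =>
        (({t ∈ S | u + ∑ i, z i * y t i = 0}.encard : ℕ∞) : ℝ≥0∞)) u
        = ((S ∩ (fun t => -∑ i, z i * y t i) ⁻¹' {u}).encard : ℝ≥0∞) * gaussianPDF 0 1 u := by
      intro u
      rw [Pi.mul_apply, mul_comm]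
      congr 3
      ext t
      simp only [Set.mem_ofPred_eq, Set.mem_inter_iff, Set.mem_preimage, Set.mem_singleton_iff]
      refine and_congr_right fun _ => ?_
      constructor <;> intro h <;> linarith
    simp_rw [e1]
    rw [h]
    refine lintegral_congr fun t => ?_
    rw [mul_comm, abs_neg]
    congr 1
    simp [gaussianPDF, gaussianPDFReal]
  simp_rw [hin]
  -- After Tonelli, the integral over `z` at fixed `t` is a two-dimensional Gaussian computation.
  rw [lintegral_lintegral_swap]
  · refine lintegral_congr fun t => ?_
    have h := lintegral_gaussianPDFReal_inner_mul_abs_inner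
      (WithLp.toLp 2 (y t) : EuclideanSpace ℝ ι) (WithLp.toLp 2 (w t))
    rw [← map_pi_eq_stdGaussian, lintegral_map (by fun_prop) (by fun_prop)] at h
    simp only [EuclideanSpace.norm_sq_eq, PiLp.inner_apply, Real.norm_eq_abs, sq_abs] at h
    simp only [RCLike.inner_apply, conj_trivial] at h
    rw [h]
    simp_rw [mul_comm (w t _) (y t _)]
  · have : Measurable fun p : (ι → ℝ) × ℝ => ENNReal.ofReal (gaussianPDFReal 0 1
        (∑ i, p.1 i * y p.2 i)) * ENNReal.ofReal |∑ i, p.1 i * w p.2 i| := by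
      have h1 : ∀ i, Measurable fun p : (ι → ℝ) × ℝ => y p.2 i := fun i => (hym i).comp measurable_snd
      have h2 : ∀ i, Measurable fun p : (ι → ℝ) × ℝ => w p.2 i := fun i => (hwm i).comp measurable_snd
      fun_prop
    exact this.aemeasurable

/-- The speed on the sphere of a curve whose two complex coordinates have moduli `1` and `h` up to
a common factor, and phases rotating at speed `m`. -/
theorem sqrt_gram_div_eq {c s C S h h' m : ℝ} (hc : c ≠ 0) (hcs : c ^ 2 + s ^ 2 = 1)
    (hCS : C ^ 2 + S ^ 2 = 1) (y w : Fin 3 → ℝ)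
    (hy : y = ![s / c, h * C / c, h * S / c])
    (hw : w = ![m / c ^ 2, (h' * C - h * (m * S)) / c + h * C * (m * s) / c ^ 2,
      (h' * S + h * (m * C)) / c + h * S * (m * s) / c ^ 2]) :
    Real.sqrt ((∑ i, w i ^ 2) * (1 + ∑ i, y i ^ 2) - (∑ i, y i * w i) ^ 2) / (1 + ∑ i, y i ^ 2)
      = Real.sqrt (m ^ 2 + (h' / (1 + h ^ 2)) ^ 2) := by
  have h1 : 1 + ∑ i, y i ^ 2 = (1 + h ^ 2) / c ^ 2 := by
    simp only [hy, Fin.sum_univ_three, Matrix.cons_val_zero, Matrix.cons_val_one, Matrix.cons_val]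
    field_simp
    linear_combination hcs + h ^ 2 * hCS
  have h2 : ∑ i, w i ^ 2 = (m ^ 2 + h ^ 2 * m ^ 2 + h' ^ 2 * c ^ 2 + 2 * h' * h * m * s * c) / c ^ 4 := by
    simp only [hw, Fin.sum_univ_three, Matrix.cons_val_zero, Matrix.cons_val_one, Matrix.cons_val]
    field_simp
    linear_combination (h ^ 2 * m ^ 2 * (C ^ 2 + S ^ 2)) * hcs
      + (h ^ 2 * m ^ 2 + h' ^ 2 * c ^ 2 + 2 * h' * h * m * s * c) * hCS
  have h3 : ∑ i, y i * w i = (s * m + h * h' * c + h ^ 2 * m * s) / c ^ 3 := by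
    simp only [hy, hw, Fin.sum_univ_three, Matrix.cons_val_zero, Matrix.cons_val_one, Matrix.cons_val]
    field_simp
    linear_combination (h * h' * c + h ^ 2 * m * s) * hCS
  have hh : 0 < 1 + h ^ 2 := by positivity
  -- The vector `(1, y)` is `(c, s, h C, h S) / c`, and the ratio at stake does not depend on the
  -- normalization. On the unit sphere, the common rotation of speed `m` is orthogonal to the motion
  -- of `arctan h`.
  have h4 : (∑ i, w i ^ 2) * (1 + ∑ i, y i ^ 2) - (∑ i, y i * w i) ^ 2
      = (m ^ 2 + (h' / (1 + h ^ 2)) ^ 2) * ((1 + h ^ 2) / c ^ 2) ^ 2 := by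
    rw [h1, h2, h3]
    field_simp
    linear_combination (- m ^ 2 * (1 + h ^ 2) ^ 2) * hcs
  rw [h4, h1, Real.sqrt_mul (by positivity), Real.sqrt_sq (by positivity), mul_div_assoc, div_self,
    mul_one]
  positivity

/-! ### The zeros at regular points -/

theorem countable_sin_affine_eq_zero {a : ℝ} (ha : a ≠ 0) (b : ℝ) :
    {t : ℝ | Real.sin (a * t + b) = 0}.Countable := by
  have h : {t : ℝ | Real.sin (a * t + b) = 0} ⊆ Set.range fun k : ℤ => ((k : ℝ) * Real.pi - b) / a := by
    intro t ht
    obtain ⟨k, hk⟩ := Real.sin_eq_zero_iff.1 ht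
    refine ⟨k, ?_⟩
    simp only [hk]
    field_simp
    ring
  exact (Set.countable_range _).mono h

/-- The rate of rotation, divided by `n / 2`, of the vector of the two Dirichlet kernels
`sin (n (t ± α) / 2) / sin ((t ± α) / 2)`. -/
def rotation (n : ℕ) (α t : ℝ) : ℝ :=
  (Real.sin (n * α) * Real.sin ((t + α) / 2) * Real.sin ((t - α) / 2)
      - 1 / n * Real.sin α * Real.sin (n * ((t + α) / 2)) * Real.sin (n * ((t - α) / 2)))
    / (Real.sin (n * ((t + α) / 2)) ^ 2 * Real.sin ((t - α) / 2) ^ 2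
      + Real.sin (n * ((t - α) / 2)) ^ 2 * Real.sin ((t + α) / 2) ^ 2)

/-- The speed of the curve on the sphere which governs the zeros of `f_n`. -/
def speed (n : ℕ) (α t : ℝ) : ℝ :=
  Real.sqrt ((((n : ℝ) + 1) / 2) ^ 2 + ((n : ℝ) / 2 * rotation n α t) ^ 2)

/-- The sum `f_n`, multiplied by `sin ((t + α) / 2) * sin ((t - α) / 2)` and normalized, as a
function of four independent standard Gaussian variables. -/
def clearedPoly (n : ℕ) (α : ℝ) (U : Fin 4 → ℝ) (t : ℝ) : ℝ :=
  Real.sin (n * ((t + α) / 2)) * Real.sin ((t - α) / 2) *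
      (U 0 * Real.cos (((n : ℝ) + 1) / 2 * (t + α) - α)
        + U 1 * Real.sin (((n : ℝ) + 1) / 2 * (t + α) - α))
    + Real.sin (n * ((t - α) / 2)) * Real.sin ((t + α) / 2) *
      (U 2 * Real.cos (((n : ℝ) + 1) / 2 * (t - α) + α)
        + U 3 * Real.sin (((n : ℝ) + 1) / 2 * (t - α) + α))

/-- The points of `[0, 2π]` at which none of the relevant trigonometric factors vanishes. -/
def regularPoints (n : ℕ) (α : ℝ) : Set ℝ :=
  {t ∈ Set.Icc 0 (2 * Real.pi) | Real.sin ((t + α) / 2) ≠ 0 ∧ Real.sin ((t - α) / 2) ≠ 0 ∧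
    Real.sin (n * ((t + α) / 2)) ≠ 0 ∧ Real.cos (((n : ℝ) + 1) / 2 * (t + α) - α) ≠ 0}

theorem measurableSet_regularPoints (n : ℕ) (α : ℝ) : MeasurableSet (regularPoints n α) := by
  have h : ∀ f : ℝ → ℝ, Continuous f → MeasurableSet {t | f t ≠ 0} := fun f hf =>
    (isOpen_ne_fun hf continuous_const).measurableSet
  exact measurableSet_Icc.inter ((h _ (by fun_prop)).inter ((h _ (by fun_prop)).inter
    ((h _ (by fun_prop)).inter (h _ (by fun_prop)))))

theorem countable_diff_regularPoints {n : ℕ} (hn : 1 ≤ n) (α : ℝ) :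
    (Set.Icc 0 (2 * Real.pi) \ regularPoints n α).Countable := by
  have hn0 : (n : ℝ) ≠ 0 := by positivity
  refine Set.Countable.mono ?_ ((countable_sin_affine_eq_zero (a := 1 / 2) (by norm_num) (α / 2)).union
    ((countable_sin_affine_eq_zero (a := 1 / 2) (by norm_num) (-α / 2)).union
    ((countable_sin_affine_eq_zero (a := (n : ℝ) / 2) (by positivity) (n * α / 2)).union
    (countable_sin_affine_eq_zero (a := ((n : ℝ) + 1) / 2) (by positivity)
      (((n : ℝ) + 1) / 2 * α - α + Real.pi / 2)))))
  rintro t ⟨ht, hr⟩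
  simp only [regularPoints, Set.mem_ofPred_eq, not_and_or, not_not] at hr
  simp only [Set.mem_union, Set.mem_ofPred_eq]
  rcases hr with hr | hr | hr | hr | hr
  · exact absurd ht hr
  · left; rw [← hr]; congr 1; ring
  · right; left; rw [← hr]; congr 1; ring
  · right; right; left; rw [← hr]; congr 1; ring
  · right; right; right
    rw [show ((n : ℝ) + 1) / 2 * t + (((n : ℝ) + 1) / 2 * α - α + Real.pi / 2)
      = ((n : ℝ) + 1) / 2 * (t + α) - α + Real.pi / 2 by ring, Real.sin_add_pi_div_two, hr]

theorem lintegral_regularPoints {n : ℕ} (hn : 1 ≤ n) (α : ℝ) (F : ℝ → ℝ≥0∞) :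
    ∫⁻ t in regularPoints n α, F t = ∫⁻ t in Set.Icc 0 (2 * Real.pi), F t := by
  refine setLIntegral_congr ?_
  have hsub : regularPoints n α ⊆ Set.Icc 0 (2 * Real.pi) := fun t ht => ht.1
  refine (ae_le_set.2 ?_).antisymm (ae_le_set.2 ?_)
  · rw [Set.sdiff_eq_empty.2 hsub, measure_empty]
  · exact (countable_diff_regularPoints hn α).measure_zero volume

theorem hasDerivAt_sin_affine {L : ℝ → ℝ} (a : ℝ) (hL : ∀ s, L s = a * s + L 0) (t : ℝ) :
    HasDerivAt (fun s => Real.sin (L s)) (a * Real.cos (L t)) t := by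
  have h : HasDerivAt L a t := by
    rw [funext hL]
    simpa using ((hasDerivAt_id t).const_mul a).add_const (L 0)
  rw [mul_comm]
  exact h.sin

theorem hasDerivAt_cos_affine {L : ℝ → ℝ} (a : ℝ) (hL : ∀ s, L s = a * s + L 0) (t : ℝ) :
    HasDerivAt (fun s => Real.cos (L s)) (-(a * Real.sin (L t))) t := by
  have h : HasDerivAt L a t := by
    rw [funext hL]
    simpa using ((hasDerivAt_id t).const_mul a).add_const (L 0)
  convert h.cos using 1
  ring

/-- Dividing by the coefficient of `U 0`, nonzero at regular points, leaves the form `u + ∑ z i * y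
t i` required by `lintegral_encard_zeros`. The speed comes from `sqrt_gram_div_eq` with `m = (n + 1)
/ 2` and `h` the quotient of the two Dirichlet kernels. Nothing is assumed on `n α`, so the identity
also serves when `n α ∈ 2π ℤ`. -/
theorem lintegral_encard_clearedPoly {n : ℕ} (hn : 1 ≤ n) (α : ℝ) :
    ∫⁻ z, ∫⁻ u, (({t ∈ regularPoints n α | clearedPoly n α (Fin.cons u z) t = 0}.encard : ℕ∞) : ℝ≥0∞)
        ∂(gaussianReal 0 1) ∂(Measure.pi fun _ : Fin 3 => gaussianReal 0 1)
      = ∫⁻ t in Set.Icc 0 (2 * Real.pi), ENNReal.ofReal (Real.pi⁻¹ * speed n α t) := by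
  have hn0 : (n : ℝ) ≠ 0 := by positivity
  set m : ℝ := ((n : ℝ) + 1) / 2 with hm
  set c : ℝ → ℝ := fun t => Real.cos (m * (t + α) - α) with hc
  set s : ℝ → ℝ := fun t => Real.sin (m * (t + α) - α) with hs
  set C : ℝ → ℝ := fun t => Real.cos (m * (t - α) + α) with hC
  set D : ℝ → ℝ := fun t => Real.sin (m * (t - α) + α) with hD
  set sp : ℝ → ℝ := fun t => Real.sin (n * ((t + α) / 2)) with hsp
  set sm : ℝ → ℝ := fun t => Real.sin (n * ((t - α) / 2)) with hsm
  set cp : ℝ → ℝ := fun t => Real.cos (n * ((t + α) / 2)) with hcp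
  set cm : ℝ → ℝ := fun t => Real.cos (n * ((t - α) / 2)) with hcm
  set σp : ℝ → ℝ := fun t => Real.sin ((t + α) / 2) with hσp
  set σm : ℝ → ℝ := fun t => Real.sin ((t - α) / 2) with hσm
  set κp : ℝ → ℝ := fun t => Real.cos ((t + α) / 2) with hκp
  set κm : ℝ → ℝ := fun t => Real.cos ((t - α) / 2) with hκm
  set h : ℝ → ℝ := fun t => sm t * σp t / (sp t * σm t) with hh
  set h' : ℝ → ℝ := fun t => ((n / 2 * cm t * σp t + sm t * (1 / 2 * κp t)) * (sp t * σm t)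
    - sm t * σp t * (n / 2 * cp t * σm t + sp t * (1 / 2 * κm t))) / (sp t * σm t) ^ 2 with hh'
  set y : ℝ → Fin 3 → ℝ := fun t => ![s t / c t, h t * C t / c t, h t * D t / c t] with hy
  set w : ℝ → Fin 3 → ℝ := fun t => ![m / c t ^ 2,
    (h' t * C t - h t * (m * D t)) / c t + h t * C t * (m * s t) / c t ^ 2,
    (h' t * D t + h t * (m * C t)) / c t + h t * D t * (m * s t) / c t ^ 2] with hw
  have dc : ∀ t, HasDerivAt c (-(m * s t)) t := fun t =>
    hasDerivAt_cos_affine (L := fun s => m * (s + α) - α) m (fun s => by ring) t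
  have ds : ∀ t, HasDerivAt s (m * c t) t := fun t =>
    hasDerivAt_sin_affine (L := fun s => m * (s + α) - α) m (fun s => by ring) t
  have dC : ∀ t, HasDerivAt C (-(m * D t)) t := fun t =>
    hasDerivAt_cos_affine (L := fun s => m * (s - α) + α) m (fun s => by ring) t
  have dD : ∀ t, HasDerivAt D (m * C t) t := fun t =>
    hasDerivAt_sin_affine (L := fun s => m * (s - α) + α) m (fun s => by ring) t
  have dsp : ∀ t, HasDerivAt sp (n / 2 * cp t) t := fun t =>
    hasDerivAt_sin_affine (L := fun s => n * ((s + α) / 2)) (n / 2) (fun s => by ring) t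
  have dsm : ∀ t, HasDerivAt sm (n / 2 * cm t) t := fun t =>
    hasDerivAt_sin_affine (L := fun s => n * ((s - α) / 2)) (n / 2) (fun s => by ring) t
  have dσp : ∀ t, HasDerivAt σp (1 / 2 * κp t) t := fun t =>
    hasDerivAt_sin_affine (L := fun s => (s + α) / 2) (1 / 2) (fun s => by ring) t
  have dσm : ∀ t, HasDerivAt σm (1 / 2 * κm t) t := fun t =>
    hasDerivAt_sin_affine (L := fun s => (s - α) / 2) (1 / 2) (fun s => by ring) t
  have mc : Measurable c := by fun_prop
  have ms : Measurable s := by fun_prop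
  have mC : Measurable C := by fun_prop
  have mD : Measurable D := by fun_prop
  have mh : Measurable h := by fun_prop
  have mh' : Measurable h' := by fun_prop
  have key := lintegral_encard_zeros (measurableSet_regularPoints n α) (y := y) (w := w)
    (by
      intro i t ht
      obtain ⟨-, -, hσ, hp, hct⟩ := ht
      have hσ' : σm t ≠ 0 := hσ
      have hp' : sp t ≠ 0 := hp
      have hct' : c t ≠ 0 := hct
      have dh : HasDerivAt h (h' t) t :=
        ((dsm t).mul (dσp t)).div ((dsp t).mul (dσm t)) (mul_ne_zero hp' hσ')
      have hcs : c t ^ 2 + s t ^ 2 = 1 := Real.cos_sq_add_sin_sq _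
      fin_cases i
      · refine ((ds t).div (dc t) hct').congr_deriv ?_
        change _ = m / c t ^ 2
        field_simp
        linear_combination m * hcs
      · refine ((dh.mul (dC t)).div (dc t) hct').congr_deriv ?_
        change _ = (h' t * C t - h t * (m * D t)) / c t + h t * C t * (m * s t) / c t ^ 2
        simp only [Pi.mul_apply]
        field_simp
        ring
      · refine ((dh.mul (dD t)).div (dc t) hct').congr_deriv ?_
        change _ = (h' t * D t + h t * (m * C t)) / c t + h t * D t * (m * s t) / c t ^ 2
        simp only [Pi.mul_apply]
        field_simp
        ring)
    (by
      intro i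
      fin_cases i
      · exact ms.div mc
      · exact (mh.mul mC).div mc
      · exact (mh.mul mD).div mc)
    (by
      intro i
      fin_cases i
      · exact measurable_const.div (mc.pow_const 2)
      · exact (((mh'.mul mC).sub (mh.mul (mD.const_mul m))).div mc).add
          (((mh.mul mC).mul (ms.const_mul m)).div (mc.pow_const 2))
      · exact (((mh'.mul mD).add (mh.mul (mC.const_mul m))).div mc).add
          (((mh.mul mD).mul (ms.const_mul m)).div (mc.pow_const 2)))
  rw [← lintegral_regularPoints hn]
  have hset : ∀ z : Fin 3 → ℝ, ∀ u : ℝ,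
      {t ∈ regularPoints n α | clearedPoly n α (Fin.cons u z) t = 0}
      = {t ∈ regularPoints n α | u + ∑ i, z i * y t i = 0} := by
    intro z u
    ext t
    simp only [Set.mem_ofPred_eq]
    refine and_congr_right fun ht => ?_
    obtain ⟨-, -, hσ, hp, hct⟩ := ht
    have hσ' : σm t ≠ 0 := hσ
    have hp' : sp t ≠ 0 := hp
    have hct' : c t ≠ 0 := hct
    have hcl : clearedPoly n α (Fin.cons u z) t
        = sp t * σm t * (u * c t + z 0 * s t) + sm t * σp t * (z 1 * C t + z 2 * D t) := rfl
    have e : clearedPoly n α (Fin.cons u z) t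
        = sp t * σm t * c t * (u + ∑ i, z i * y t i) := by
      rw [hcl]
      simp only [hy, hh, Fin.sum_univ_three, Matrix.cons_val_zero, Matrix.cons_val_one,
        Matrix.cons_val]
      field_simp
      ring
    rw [e]
    simp [hσ', hp', hct']
  simp_rw [hset]
  rw [key]
  refine setLIntegral_congr_fun (measurableSet_regularPoints n α) fun t ht => ?_
  obtain ⟨-, -, hσ, hp, hct⟩ := ht
  have hσ' : σm t ≠ 0 := hσ
  have hp' : sp t ≠ 0 := hp
  have hct' : c t ≠ 0 := hct
  rw [sqrt_gram_div_eq hct' (Real.cos_sq_add_sin_sq _ : c t ^ 2 + s t ^ 2 = 1)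
    (Real.cos_sq_add_sin_sq _ : C t ^ 2 + D t ^ 2 = 1) (y t) (w t) rfl rfl, speed]
  congr 5
  -- What remains is `h' / (1 + h ^ 2) = n / 2 * rotation n α t`. In the numerator of `h'`, the two
  -- phase differences collapse to `sin (n α)` and `sin α`.
  have e1 : sp t * cm t - sm t * cp t = Real.sin (n * α) := by
    have : n * α = n * ((t + α) / 2) - n * ((t - α) / 2) := by ring
    rw [this, Real.sin_sub]
    simp only [hsp, hcm, hsm, hcp]
    ring
  have e2 : σp t * κm t - κp t * σm t = Real.sin α := by
    have : Real.sin α = Real.sin ((t + α) / 2 - (t - α) / 2) := by congr 1; ring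
    rw [this, Real.sin_sub]
  have hden : sp t ^ 2 * σm t ^ 2 + sm t ^ 2 * σp t ^ 2 ≠ 0 := by
    have : 0 < (sp t * σm t) ^ 2 := by positivity
    nlinarith [sq_nonneg (sm t * σp t)]
  have hq : rotation n α t = ((sp t * cm t - sm t * cp t) * σp t * σm t
      - 1 / n * (σp t * κm t - κp t * σm t) * sp t * sm t)
        / (sp t ^ 2 * σm t ^ 2 + sm t ^ 2 * σp t ^ 2) := by
    rw [e1, e2, rotation]
  have hh2 : 1 + h t ^ 2 = (sp t ^ 2 * σm t ^ 2 + sm t ^ 2 * σp t ^ 2) / (sp t * σm t) ^ 2 := by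
    simp only [hh]
    field_simp
  rw [hq, hh2]
  simp only [hh']
  field_simp
  ring

/-! ### Dirichlet kernels and the four-variable Gaussian model -/

/-- Twice each product is a difference of sines at consecutive half-integer multiples of `θ`, so the
sum telescopes. -/
theorem sin_half_mul_sum_cos (n : ℕ) (θ β : ℝ) :
    Real.sin (θ / 2) * ∑ i ∈ Finset.range n, Real.cos (((i + 1 : ℕ) : ℝ) * θ + β)
      = Real.cos (((n : ℝ) + 1) / 2 * θ + β) * Real.sin (n * (θ / 2)) := by
  have h : 2 * (Real.sin (θ / 2) * ∑ i ∈ Finset.range n, Real.cos (((i + 1 : ℕ) : ℝ) * θ + β))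
      = Real.sin (n * θ + θ / 2 + β) - Real.sin (θ / 2 + β) := by
    induction n with
    | zero => simp
    | succ n ih =>
      rw [Finset.sum_range_succ, mul_add, mul_add, ih]
      have e1 : ((n + 1 : ℕ) : ℝ) * θ + θ / 2 + β = (((n + 1 : ℕ) : ℝ) * θ + β) + θ / 2 := by ring
      have e2 : (n : ℝ) * θ + θ / 2 + β = (((n + 1 : ℕ) : ℝ) * θ + β) - θ / 2 := by push_cast; ring
      rw [e1, e2, Real.sin_sub (((n + 1 : ℕ) : ℝ) * θ + β), Real.sin_add (((n + 1 : ℕ) : ℝ) * θ + β)]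
      ring
  have e1 : (n : ℝ) * θ + θ / 2 + β = (((n : ℝ) + 1) / 2 * θ + β) + n * (θ / 2) := by ring
  have e2 : θ / 2 + β = (((n : ℝ) + 1) / 2 * θ + β) - n * (θ / 2) := by ring
  rw [e1, e2, Real.sin_add, Real.sin_sub] at h
  linarith

theorem sin_half_mul_sum_sin (n : ℕ) (θ β : ℝ) :
    Real.sin (θ / 2) * ∑ i ∈ Finset.range n, Real.sin (((i + 1 : ℕ) : ℝ) * θ + β)
      = Real.sin (((n : ℝ) + 1) / 2 * θ + β) * Real.sin (n * (θ / 2)) := by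
  have h := sin_half_mul_sum_cos n θ (β - Real.pi / 2)
  have e : ∀ x : ℝ, Real.cos (x + (β - Real.pi / 2)) = Real.sin (x + β) := fun x => by
    rw [← add_sub_assoc, Real.cos_sub_pi_div_two]
  simpa only [e] using h

/-- The coefficient functions of `f_n` with respect to four independent standard Gaussian
variables, up to a constant factor. -/
def coeff (n : ℕ) (α t : ℝ) : Fin 4 → ℝ :=
  ![∑ i ∈ Finset.range n, Real.cos (((i + 1 : ℕ) : ℝ) * (t + α) + -α),
    ∑ i ∈ Finset.range n, Real.sin (((i + 1 : ℕ) : ℝ) * (t + α) + -α),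
    ∑ i ∈ Finset.range n, Real.cos (((i + 1 : ℕ) : ℝ) * (t - α) + α),
    ∑ i ∈ Finset.range n, Real.sin (((i + 1 : ℕ) : ℝ) * (t - α) + α)]

/-- The sum `f_n`, up to a constant factor, as a function of four independent standard Gaussian
variables. -/
def gaussianPoly (n : ℕ) (α : ℝ) (U : Fin 4 → ℝ) (t : ℝ) : ℝ :=
  ∑ i, U i * coeff n α t i

theorem continuous_coeff (n : ℕ) (α : ℝ) : Continuous (coeff n α) := by
  refine continuous_pi fun i => ?_
  fin_cases i <;> simp only [coeff, Fin.zero_eta, Fin.mk_one, Fin.reduceFinMk, Matrix.cons_val,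
    Matrix.cons_val_zero, Matrix.cons_val_one] <;> fun_prop

theorem continuous_gaussianPoly (n : ℕ) (α : ℝ) (U : Fin 4 → ℝ) :
    Continuous (gaussianPoly n α U) := by
  have h := continuous_coeff n α
  have h' : ∀ i, Continuous fun t => coeff n α t i := fun i => (continuous_apply i).comp h
  unfold gaussianPoly
  fun_prop

theorem measurable_gaussianPoly (n : ℕ) (α t : ℝ) : Measurable fun U => gaussianPoly n α U t := by
  unfold gaussianPoly
  fun_prop

theorem measurable_numZeros_gaussianPoly (n : ℕ) (α : ℝ) :
    Measurable fun U => ((numZeros (gaussianPoly n α U) : ℕ∞) : ℝ≥0∞) :=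
  measurable_numZeros (measurable_gaussianPoly n α) (continuous_gaussianPoly n α)

theorem sin_mul_coeff (n : ℕ) (α t : ℝ) :
    Real.sin ((t + α) / 2) * coeff n α t 0
        = Real.cos (((n : ℝ) + 1) / 2 * (t + α) - α) * Real.sin (n * ((t + α) / 2)) ∧
    Real.sin ((t + α) / 2) * coeff n α t 1
        = Real.sin (((n : ℝ) + 1) / 2 * (t + α) - α) * Real.sin (n * ((t + α) / 2)) ∧
    Real.sin ((t - α) / 2) * coeff n α t 2
        = Real.cos (((n : ℝ) + 1) / 2 * (t - α) + α) * Real.sin (n * ((t - α) / 2)) ∧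
    Real.sin ((t - α) / 2) * coeff n α t 3
        = Real.sin (((n : ℝ) + 1) / 2 * (t - α) + α) * Real.sin (n * ((t - α) / 2)) :=
  ⟨sin_half_mul_sum_cos n (t + α) (-α), sin_half_mul_sum_sin n (t + α) (-α),
    sin_half_mul_sum_cos n (t - α) α, sin_half_mul_sum_sin n (t - α) α⟩

theorem clearedPoly_eq (n : ℕ) (α : ℝ) (U : Fin 4 → ℝ) (t : ℝ) :
    clearedPoly n α U t
      = Real.sin ((t + α) / 2) * Real.sin ((t - α) / 2) * gaussianPoly n α U t := by
  obtain ⟨h0, h1, h2, h3⟩ := sin_mul_coeff n α t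
  simp only [clearedPoly, gaussianPoly, Fin.sum_univ_four]
  linear_combination (-Real.sin ((t - α) / 2) * U 0) * h0 - (Real.sin ((t - α) / 2) * U 1) * h1
    - (Real.sin ((t + α) / 2) * U 2) * h2 - (Real.sin ((t + α) / 2) * U 3) * h3

theorem sin_natCast_mul_eq (n : ℕ) (α t : ℝ) :
    Real.sin (n * α) = Real.sin (n * ((t + α) / 2)) * Real.cos (n * ((t - α) / 2))
      - Real.cos (n * ((t + α) / 2)) * Real.sin (n * ((t - α) / 2)) := by
  rw [← Real.sin_sub]
  congr 1
  ring

/-- A common zero of the four coefficients forces both `sin (n (t ± α) / 2)` to vanish, and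
subtracting the angles gives `sin (n α) = 0`. Hence no point is a deterministic zero when `n α ∉ π
ℤ`. -/
theorem coeff_ne_zero {n : ℕ} {α : ℝ} (h : Real.sin (n * α) ≠ 0) (t : ℝ) : coeff n α t ≠ 0 := by
  intro h0
  obtain ⟨h1, h2, h3, h4⟩ := sin_mul_coeff n α t
  simp only [h0, Pi.zero_apply, mul_zero] at h1 h2 h3 h4
  have hp : Real.sin (n * ((t + α) / 2)) = 0 := by
    by_contra hne
    have a1 := (mul_eq_zero.1 h1.symm).resolve_right hne
    have a2 := (mul_eq_zero.1 h2.symm).resolve_right hne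
    have := Real.cos_sq_add_sin_sq (((n : ℝ) + 1) / 2 * (t + α) - α)
    rw [a1, a2] at this
    norm_num at this
  have hm : Real.sin (n * ((t - α) / 2)) = 0 := by
    by_contra hne
    have a1 := (mul_eq_zero.1 h3.symm).resolve_right hne
    have a2 := (mul_eq_zero.1 h4.symm).resolve_right hne
    have := Real.cos_sq_add_sin_sq (((n : ℝ) + 1) / 2 * (t - α) + α)
    rw [a1, a2] at this
    norm_num at this
  apply h
  rw [sin_natCast_mul_eq n α t, hp, hm]
  ring

/-- A nonzero linear form of independent standard Gaussian variables does not vanish. -/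
theorem ae_sum_mul_ne_zero {ι : Type*} [Fintype ι] {v : ι → ℝ} (hv : v ≠ 0) :
    ∀ᵐ U ∂(Measure.pi fun _ : ι => gaussianReal 0 1), ∑ i, U i * v i ≠ 0 := by
  have h := map_inner_stdGaussian (WithLp.toLp 2 v : EuclideanSpace ℝ ι)
  rw [← map_pi_eq_stdGaussian, Measure.map_map (by fun_prop) (by fun_prop)] at h
  have hn : ‖(WithLp.toLp 2 v : EuclideanSpace ℝ ι)‖₊ ^ 2 ≠ 0 := by
    simpa using hv
  have := nullSingletonClass_gaussianReal (μ := 0) hn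
  have h0 : (gaussianReal 0 (‖(WithLp.toLp 2 v : EuclideanSpace ℝ ι)‖₊ ^ 2)) {0} = 0 :=
    measure_singleton 0
  rw [← h, Measure.map_apply (by fun_prop) (measurableSet_singleton 0)] at h0
  refine (measure_eq_zero_iff_ae_notMem.1 h0).mono fun U hU h2 => hU ?_
  simp only [Function.comp_apply, Set.mem_preimage, PiLp.inner_apply, RCLike.inner_apply,
    conj_trivial, Set.mem_singleton_iff]
  exact h2

theorem measurePreserving_cons :
    MeasurePreserving (fun p : (Fin 3 → ℝ) × ℝ => (Fin.cons p.2 p.1 : Fin 4 → ℝ))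
      ((Measure.pi fun _ : Fin 3 => gaussianReal 0 1).prod (gaussianReal 0 1))
      (Measure.pi fun _ : Fin 4 => gaussianReal 0 1) := by
  have h := ((measurePreserving_piFinSuccAbove (n := 3) (fun _ : Fin 4 => gaussianReal 0 1) 0).symm).comp
    (Measure.measurePreserving_swap (μ := Measure.pi fun _ : Fin 3 => gaussianReal 0 1)
      (ν := gaussianReal 0 1))
  convert h using 1
  ext p : 1
  simp [MeasurableEquiv.piFinSuccAbove, Fin.insertNthEquiv]

theorem lintegral_pi_fin_four {F : (Fin 4 → ℝ) → ℝ≥0∞} (hF : Measurable F) :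
    ∫⁻ U, F U ∂(Measure.pi fun _ : Fin 4 => gaussianReal 0 1)
      = ∫⁻ z, ∫⁻ u, F (Fin.cons u z) ∂(gaussianReal 0 1)
          ∂(Measure.pi fun _ : Fin 3 => gaussianReal 0 1) := by
  rw [← measurePreserving_cons.lintegral_comp hF]
  exact lintegral_prod _ (hF.comp measurePreserving_cons.measurable).aemeasurable

/-- The second term is the one that distinguishes residue classes: almost surely zero if `n α ∉ π
ℤ`, and at least `n - 2` if `n α ∈ 2π ℤ`. -/
theorem numZeros_gaussianPoly_eq (n : ℕ) (α : ℝ) (U : Fin 4 → ℝ) :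
    ((numZeros (gaussianPoly n α U) : ℕ∞) : ℝ≥0∞)
      = (({t ∈ regularPoints n α | clearedPoly n α U t = 0}.encard : ℕ∞) : ℝ≥0∞)
        + (({t ∈ Set.Icc 0 (2 * Real.pi) \ regularPoints n α | gaussianPoly n α U t = 0}.encard : ℕ∞)
          : ℝ≥0∞) := by
  rw [← ENat.toENNReal_add, ← Set.encard_union_eq]
  · rw [numZeros]
    congr 2
    ext t
    simp only [Set.mem_ofPred_eq, Set.mem_union, Set.mem_sdiff]
    have hreg : t ∈ regularPoints n α → t ∈ Set.Icc 0 (2 * Real.pi) ∧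
        (clearedPoly n α U t = 0 ↔ gaussianPoly n α U t = 0) := by
      intro ht
      refine ⟨ht.1, ?_⟩
      rw [clearedPoly_eq]
      simp [ht.2.1, ht.2.2.1]
    by_cases ht : t ∈ regularPoints n α
    · obtain ⟨h1, h2⟩ := hreg ht
      tauto
    · tauto
  · rw [Set.disjoint_left]
    rintro t ⟨h1, -⟩ ⟨⟨-, h2⟩, -⟩
    exact h2 h1

/-- The exceptional points are countable, and each one is almost surely not a zero, so almost surely
none of them is. -/
theorem lintegral_numZeros_gaussianPoly {n : ℕ} (hn : 1 ≤ n) {α : ℝ} (h : Real.sin (n * α) ≠ 0) :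
    ∫⁻ U, ((numZeros (gaussianPoly n α U) : ℕ∞) : ℝ≥0∞) ∂(Measure.pi fun _ : Fin 4 => gaussianReal 0 1)
      = ∫⁻ t in Set.Icc 0 (2 * Real.pi), ENNReal.ofReal (Real.pi⁻¹ * speed n α t) := by
  rw [← lintegral_encard_clearedPoly hn, lintegral_pi_fin_four (measurable_numZeros_gaussianPoly n α)]
  have hae : ∀ᵐ U ∂(Measure.pi fun _ : Fin 4 => gaussianReal 0 1),
      ∀ t ∈ Set.Icc 0 (2 * Real.pi) \ regularPoints n α, gaussianPoly n α U t ≠ 0 :=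
    (ae_ball_iff (countable_diff_regularPoints hn α)).2 fun t _ =>
      ae_sum_mul_ne_zero (coeff_ne_zero h t)
  have hae2 := Measure.ae_ae_of_ae_prod (measurePreserving_cons.quasiMeasurePreserving.ae hae)
  refine lintegral_congr_ae (hae2.mono fun z hz => lintegral_congr_ae (hz.mono fun u hu => ?_))
  simp only at hu ⊢
  rw [numZeros_gaussianPoly_eq]
  have : {t ∈ Set.Icc 0 (2 * Real.pi) \ regularPoints n α | gaussianPoly n α (Fin.cons u z) t = 0} = ∅ := by
    ext t
    simp only [Set.mem_ofPred_eq, Set.mem_empty_iff_false, iff_false, not_and]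
    exact fun ht => hu t ht
  rw [this]
  simp

/-! ### Reduction of `f_n` to four independent Gaussians -/

variable {Ω : Type*} [MeasurableSpace Ω] {P : Measure Ω}

/-- A sequence with correlation function `cos (k α)` has rank two. -/
theorem ae_eq_of_cos_correlation {X : ℕ → Ω → ℝ} {α : ℝ} (hL : ∀ i, MemLp (X i) 2 P)
    (hX : ∀ i j : ℕ, ∫ ω, X i ω * X j ω ∂P = Real.cos (((i : ℝ) - j) * α)) :
    ∀ᵐ ω ∂P, ∀ i : ℕ, Real.sin α * X i ω
      = X 0 ω * (Real.sin α * Real.cos (i * α) - Real.cos α * Real.sin (i * α))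
        + X 1 ω * Real.sin (i * α) := by
  refine ae_all_iff.2 fun i => ?_
  have hint : ∀ i j, Integrable (fun ω => X i ω * X j ω) P := fun i j => (hL i).integrable_mul (hL j)
  set s := Real.sin α with hs
  set c := Real.cos α with hc
  set S := Real.sin (i * α) with hS
  set C := Real.cos (i * α) with hC
  set p := s * C - c * S with hp
  have hexp : ∀ ω, (s * X i ω - (X 0 ω * p + X 1 ω * S)) ^ 2
      = ∑ r : Fin 6, ![s ^ 2, p ^ 2, S ^ 2, -(2 * s * p), -(2 * s * S), 2 * p * S] r *
        (X (![i, 0, 1, i, i, 0] r) ω * X (![i, 0, 1, 0, 1, 1] r) ω) := fun ω => by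
    simp only [Fin.sum_univ_six, Matrix.cons_val, Matrix.cons_val_zero, Matrix.cons_val_one]
    ring
  have hI : ∀ k i j, Integrable (fun ω => k * (X i ω * X j ω)) P := fun k i j => (hint i j).const_mul k
  have hsum : Integrable (fun ω => (s * X i ω - (X 0 ω * p + X 1 ω * S)) ^ 2) P := by
    simp_rw [hexp]
    exact integrable_finsetSum _ fun r _ => hI _ _ _
  -- Vanishing of the second moment of the residual is the linear dependence. Keeping the factor
  -- `sin α` avoids any division.
  have h0 : ∫ ω, (s * X i ω - (X 0 ω * p + X 1 ω * S)) ^ 2 ∂P = 0 := by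
    simp_rw [hexp]
    rw [integral_finsetSum _ fun r _ => hI _ _ _]
    simp only [Fin.sum_univ_six, Matrix.cons_val, Matrix.cons_val_zero, Matrix.cons_val_one]
    simp only [integral_const_mul, hX]
    have e1 : ((i : ℝ) - (1 : ℕ)) * α = i * α - α := by push_cast; ring
    have e2 : ((0 : ℕ) - (1 : ℕ) : ℝ) * α = -α := by push_cast; ring
    have e3 : ((i : ℝ) - (0 : ℕ)) * α = i * α := by push_cast; ring
    rw [e1, e2, e3, Real.cos_sub, Real.cos_neg]
    simp only [sub_self, zero_mul, Real.cos_zero]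
    rw [← hC, ← hS, ← hs, ← hc, hp]
    have h1 : s ^ 2 + c ^ 2 = 1 := Real.sin_sq_add_cos_sq α
    have h2 : S ^ 2 + C ^ 2 = 1 := Real.sin_sq_add_cos_sq (i * α)
    linear_combination (-S ^ 2) * h1 - (s ^ 2) * h2
  have h1 := (integral_eq_zero_iff_of_nonneg (fun ω => sq_nonneg _) hsum).1 h0
  filter_upwards [h1] with ω hω
  have : s * X i ω - (X 0 ω * p + X 1 ω * S) = 0 := by
    simpa using hω
  linarith

/-- The coefficients of four independent standard Gaussian variables in terms of the first two
elements of each of two sequences with correlation function `cos (k α)`. -/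
def decorrelation (α : ℝ) : Fin 4 → Fin 4 → ℝ :=
  ![![1 / Real.sqrt 2, 0, 1 / Real.sqrt 2 * (Real.cos α / Real.sin α), -(1 / Real.sqrt 2 / Real.sin α)],
    ![-(1 / Real.sqrt 2 * (Real.cos α / Real.sin α)), 1 / Real.sqrt 2 / Real.sin α, 1 / Real.sqrt 2, 0],
    ![1 / Real.sqrt 2, 0, -(1 / Real.sqrt 2 * (Real.cos α / Real.sin α)), 1 / Real.sqrt 2 / Real.sin α],
    ![1 / Real.sqrt 2 * (Real.cos α / Real.sin α), -(1 / Real.sqrt 2 / Real.sin α), 1 / Real.sqrt 2, 0]]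

/-- Write `a_{i+1} = A cos (i α) + A' sin (i α)` and `b_{i+1} = B cos (i α) + B' sin (i α)`, with
`A, A', B, B'` orthonormal. The rows are `(A - B') / √2`, `(B + A') / √2`, `(A + B') / √2`, `(B -
A') / √2`, again orthonormal for the covariance `K` of the first two terms of each sequence. -/
theorem decorrelation_spec {α : ℝ} (h : Real.sin α ≠ 0) (K : Fin 4 → Fin 4 → ℝ)
    (hK : K = ![![1, Real.cos α, 0, 0], ![Real.cos α, 1, 0, 0], ![0, 0, 1, Real.cos α],
      ![0, 0, Real.cos α, 1]]) (i j : Fin 4) :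
    ∑ k, ∑ l, decorrelation α i k * (decorrelation α j l * K k l) = if i = j then 1 else 0 := by
  have h2 : Real.sqrt 2 ^ 2 = 2 := Real.sq_sqrt (by norm_num)
  have hne : Real.sqrt 2 ≠ 0 := by positivity
  have hcs := Real.sin_sq_add_cos_sq α
  have hc : Real.cos α ^ 2 = 1 - Real.sin α ^ 2 := by linarith
  subst hK
  fin_cases i <;> fin_cases j <;>
    simp [decorrelation, Fin.sum_univ_four] <;> field_simp <;> (try rw [h2]) <;>
    (try simp only [hc]) <;> ring

/-- The combinations are chosen so that, by the addition formulas, `U 0, U 1` multiply the cosine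
and sine of `k t + (k - 1) α`, and `U 2, U 3` those of `k t - (k - 1) α`. Joint Gaussianity reduces
independence to vanishing covariances. -/
theorem exists_gaussian_decomposition [IsProbabilityMeasure P] {α : ℝ} (h : Real.sin α ≠ 0)
    {a b : ℕ+ → Ω → ℝ} (hab : IsCosineCorrelatedPair P α a b) :
    ∃ U : Ω → Fin 4 → ℝ, AEMeasurable U P ∧
      P.map U = Measure.pi (fun _ : Fin 4 => gaussianReal 0 1) ∧
      ∀ᵐ ω ∂P, ∀ i : ℕ,
        a i.succPNat ω = ((U ω 0 + U ω 2) * Real.cos (i * α) + (U ω 1 - U ω 3) * Real.sin (i * α))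
          / Real.sqrt 2 ∧
        b i.succPNat ω = ((U ω 1 + U ω 3) * Real.cos (i * α) + (U ω 2 - U ω 0) * Real.sin (i * α))
          / Real.sqrt 2 := by
  have hLa : ∀ i : ℕ, MemLp (a i.succPNat) 2 P := fun i =>
    (hab.gaussian_left.hasGaussianLaw_eval _).memLp_two
  have hLb : ∀ i : ℕ, MemLp (b i.succPNat) 2 P := fun i =>
    (hab.gaussian_right.hasGaussianLaw_eval _).memLp_two
  have hcoe : ∀ i j : ℕ, (((i.succPNat : ℕ) : ℝ) - ((j.succPNat : ℕ) : ℝ)) = (i : ℝ) - j := by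
    intro i j; simp [Nat.succPNat_coe]
  have hXa : ∀ i j : ℕ, ∫ ω, a i.succPNat ω * a j.succPNat ω ∂P = Real.cos (((i : ℝ) - j) * α) := by
    intro i j; rw [hab.correlation_left, hcoe]
  have hXb : ∀ i j : ℕ, ∫ ω, b i.succPNat ω * b j.succPNat ω ∂P = Real.cos (((i : ℝ) - j) * α) := by
    intro i j; rw [hab.correlation_right, hcoe]
  set ξ : Fin 4 → Ω → ℝ := ![a (Nat.succPNat 0), a (Nat.succPNat 1), b (Nat.succPNat 0),
    b (Nat.succPNat 1)] with hξ
  have hLξ : ∀ i, MemLp (ξ i) 2 P := by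
    intro i; fin_cases i
    · exact hLa 0
    · exact hLa 1
    · exact hLb 0
    · exact hLb 1
  have hca : ∀ i j : ℕ, cov[a i.succPNat, a j.succPNat; P] = Real.cos (((i : ℝ) - j) * α) := by
    intro i j
    rw [covariance_eq_sub (hLa i) (hLa j), hab.centered_left, zero_mul, sub_zero, ← hXa]
    rfl
  have hcb : ∀ i j : ℕ, cov[b i.succPNat, b j.succPNat; P] = Real.cos (((i : ℝ) - j) * α) := by
    intro i j
    rw [covariance_eq_sub (hLb i) (hLb j), hab.centered_right, zero_mul, sub_zero, ← hXb]
    rfl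
  have hcab : ∀ i j : ℕ, cov[a i.succPNat, b j.succPNat; P] = 0 := by
    intro i j
    have hi : IndepFun (a i.succPNat) (b j.succPNat) P :=
      hab.indep.comp (φ := fun f : ℕ+ → ℝ => f i.succPNat) (ψ := fun f : ℕ+ → ℝ => f j.succPNat)
        (by fun_prop) (by fun_prop)
    exact hi.covariance_eq_zero (hLa i) (hLb j)
  have hcba : ∀ i j : ℕ, cov[b i.succPNat, a j.succPNat; P] = 0 := by
    intro i j; rw [covariance_comm, hcab]
  set K : Fin 4 → Fin 4 → ℝ := ![![1, Real.cos α, 0, 0], ![Real.cos α, 1, 0, 0],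
    ![0, 0, 1, Real.cos α], ![0, 0, Real.cos α, 1]] with hK
  have hcov : ∀ k l, cov[ξ k, ξ l; P] = K k l := by
    intro k l
    fin_cases k <;> fin_cases l <;>
      first
      | (refine (hca 0 0).trans ?_; simp [hK])
      | (refine (hca 0 1).trans ?_; simp [hK])
      | (refine (hca 1 0).trans ?_; simp [hK])
      | (refine (hca 1 1).trans ?_; simp [hK])
      | (refine (hcb 0 0).trans ?_; simp [hK])
      | (refine (hcb 0 1).trans ?_; simp [hK])
      | (refine (hcb 1 0).trans ?_; simp [hK])
      | (refine (hcb 1 1).trans ?_; simp [hK])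
      | exact hcab 0 0
      | exact hcab 0 1
      | exact hcab 1 0
      | exact hcab 1 1
      | exact hcba 0 0
      | exact hcba 0 1
      | exact hcba 1 0
      | exact hcba 1 1
  have hjoint : HasGaussianLaw (fun ω => ((a (Nat.succPNat 0) ω, a (Nat.succPNat 1) ω),
      (b (Nat.succPNat 0) ω, b (Nat.succPNat 1) ω))) P := by
    refine IndepFun.hasGaussianLaw hab.gaussian_left.hasGaussianLaw_prodMk
      hab.gaussian_right.hasGaussianLaw_prodMk ?_
    exact hab.indep.comp (φ := fun f : ℕ+ → ℝ => (f (Nat.succPNat 0), f (Nat.succPNat 1)))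
      (ψ := fun f : ℕ+ → ℝ => (f (Nat.succPNat 0), f (Nat.succPNat 1))) (by fun_prop) (by fun_prop)
  set U : Fin 4 → Ω → ℝ := fun i ω => ∑ k, decorrelation α i k * ξ k ω with hU
  have hUg : HasGaussianLaw (fun ω => (U · ω)) P := by
    let fst₁ := ContinuousLinearMap.fst ℝ (ℝ × ℝ) (ℝ × ℝ)
    let snd₁ := ContinuousLinearMap.snd ℝ (ℝ × ℝ) (ℝ × ℝ)
    let fst₂ := ContinuousLinearMap.fst ℝ ℝ ℝ
    let snd₂ := ContinuousLinearMap.snd ℝ ℝ ℝ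
    have := hjoint.map_fun (ContinuousLinearMap.pi fun i : Fin 4 =>
      decorrelation α i 0 • fst₂.comp fst₁ + decorrelation α i 1 • snd₂.comp fst₁
        + decorrelation α i 2 • fst₂.comp snd₁ + decorrelation α i 3 • snd₂.comp snd₁)
    refine this.congr (ae_of_all _ fun ω => ?_)
    ext i
    simp only [hU, Fin.sum_univ_four]
    rfl
  have hUcov : ∀ i j, cov[U i, U j; P] = if i = j then 1 else 0 := by
    intro i j
    rw [← decorrelation_spec h K hK i j]
    simp only [hU]
    rw [covariance_fun_sum_fun_sum (fun k => (hLξ k).const_mul _) (fun k => (hLξ k).const_mul _)]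
    refine Finset.sum_congr rfl fun k _ => Finset.sum_congr rfl fun l _ => ?_
    rw [covariance_const_mul_left, covariance_const_mul_right, hcov]
  have hUind : iIndepFun U P := hUg.iIndepFun_of_covariance_eq_zero fun i j hij => by
    rw [hUcov, if_neg hij]
  have hUmean : ∀ i, ∫ ω, U i ω ∂P = 0 := by
    intro i
    have hξ0 : ∀ k, ∫ ω, ξ k ω ∂P = 0 := by
      intro k; fin_cases k
      · exact hab.centered_left _
      · exact hab.centered_left _
      · exact hab.centered_right _
      · exact hab.centered_right _
    simp only [hU]
    rw [integral_finsetSum _ fun k _ => ((hLξ k).integrable one_le_two).const_mul _]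
    simp [integral_const_mul, hξ0]
  have hUlaw : ∀ i, P.map (U i) = gaussianReal 0 1 := by
    intro i
    rw [(hUg.eval i).map_eq_gaussianReal, hUmean, ← covariance_self (hUg.eval i).aemeasurable, hUcov]
    simp
  refine ⟨fun ω i => U i ω, hUg.aemeasurable, ?_, ?_⟩
  · rw [(iIndepFun_iff_map_fun_eq_pi_map fun i => (hUg.eval i).aemeasurable).1 hUind]
    simp_rw [hUlaw]
  · filter_upwards [ae_eq_of_cos_correlation hLa hXa, ae_eq_of_cos_correlation hLb hXb] with ω ha hb i
    have ha := ha i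
    have hb := hb i
    have h2 : Real.sqrt 2 ^ 2 = 2 := Real.sq_sqrt (by norm_num)
    have hne : Real.sqrt 2 ≠ 0 := by positivity
    have e : ∀ i, U i ω = decorrelation α i 0 * a (Nat.succPNat 0) ω
        + decorrelation α i 1 * a (Nat.succPNat 1) ω + decorrelation α i 2 * b (Nat.succPNat 0) ω
        + decorrelation α i 3 * b (Nat.succPNat 1) ω := by
      intro i
      simp only [hU, Fin.sum_univ_four]
      rfl
    simp only [e]
    simp only [decorrelation, Matrix.cons_val, Matrix.cons_val_zero, Matrix.cons_val_one]
    constructor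
    · apply mul_left_cancel₀ h
      rw [ha]
      field_simp
      rw [h2]
      ring
    · apply mul_left_cancel₀ h
      rw [hb]
      field_simp
      rw [h2]
      ring

theorem expectedZeros_eq_lintegral [IsProbabilityMeasure P] {α : ℝ} (h : Real.sin α ≠ 0)
    {a b : ℕ+ → Ω → ℝ} (hab : IsCosineCorrelatedPair P α a b) {n : ℕ} (hn : 1 ≤ n) :
    expectedZeros P a b n = ∫⁻ U, ((numZeros (gaussianPoly n α U) : ℕ∞) : ℝ≥0∞)
      ∂(Measure.pi fun _ : Fin 4 => gaussianReal 0 1) := by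
  obtain ⟨U, hU, hmap, hae⟩ := exists_gaussian_decomposition h hab
  rw [← hmap, lintegral_map' (measurable_numZeros_gaussianPoly n α).aemeasurable hU, expectedZeros]
  refine lintegral_congr_ae (hae.mono fun ω hω => ?_)
  have hne : Real.sqrt 2 ≠ 0 := by positivity
  have key : ∀ t, trigPoly a b n ω t = 1 / Real.sqrt n * (1 / Real.sqrt 2) * gaussianPoly n α (U ω) t := by
    intro t
    rw [trigPoly, mul_assoc]
    congr 1
    simp only [gaussianPoly, coeff, Fin.sum_univ_four, Matrix.cons_val, Matrix.cons_val_zero,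
      Matrix.cons_val_one, Finset.mul_sum, ← Finset.sum_add_distrib]
    refine Finset.sum_congr rfl fun i _ => ?_
    rw [(hω i).1, (hω i).2]
    have e1 : ((i + 1 : ℕ) : ℝ) * (t + α) + -α = ((i + 1 : ℕ) : ℝ) * t + i * α := by push_cast; ring
    have e2 : ((i + 1 : ℕ) : ℝ) * (t - α) + α = ((i + 1 : ℕ) : ℝ) * t - i * α := by push_cast; ring
    rw [e1, e2, Real.cos_add, Real.cos_sub, Real.sin_add, Real.sin_sub]
    field_simp
    ring
  have hnz : 1 / Real.sqrt n * (1 / Real.sqrt 2) ≠ 0 := by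
    have : 0 < Real.sqrt n := Real.sqrt_pos.2 (by positivity)
    positivity
  simp only [numZeros, key, mul_eq_zero, hnz, false_or]

/-! ### Integrability of the number of zeros -/

open Polynomial in
/-- The polynomial in `z = e^{it}` to which a trigonometric polynomial without constant term
corresponds. -/
def trigToPoly (n : ℕ) (A B : ℕ → ℝ) : ℂ[X] :=
  ∑ i ∈ Finset.range n, (C (((A i : ℂ) - Complex.I * B i) / 2) * X ^ (n + (i + 1))
    + C (((A i : ℂ) + Complex.I * B i) / 2) * X ^ (n - (i + 1)))

theorem trigToPoly_eval (n : ℕ) (A B : ℕ → ℝ) (t : ℝ) :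
    (trigToPoly n A B).eval (Complex.exp (t * Complex.I)) = Complex.exp (t * Complex.I) ^ n *
      ((∑ i ∈ Finset.range n, (A i * Real.cos (((i + 1 : ℕ) : ℝ) * t)
        + B i * Real.sin (((i + 1 : ℕ) : ℝ) * t)) : ℝ) : ℂ) := by
  rw [trigToPoly, Polynomial.eval_finsetSum, Complex.ofReal_sum, Finset.mul_sum]
  refine Finset.sum_congr rfl fun i hi => ?_
  have hle : i + 1 ≤ n := Finset.mem_range.1 hi
  simp only [Polynomial.eval_add, Polynomial.eval_mul, Polynomial.eval_C, Polynomial.eval_pow,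
    Polynomial.eval_X]
  set z := Complex.exp (t * Complex.I) with hz
  have hz0 : z ≠ 0 := Complex.exp_ne_zero _
  have h1 : z ^ (i + 1) = Complex.cos (((i + 1 : ℕ) : ℝ) * t) + Complex.sin (((i + 1 : ℕ) : ℝ) * t) * Complex.I := by
    rw [hz, ← Complex.exp_nat_mul, ← Complex.exp_mul_I]
    congr 1
    push_cast
    ring
  have h2 : (z ^ (i + 1))⁻¹ = Complex.cos (((i + 1 : ℕ) : ℝ) * t) - Complex.sin (((i + 1 : ℕ) : ℝ) * t) * Complex.I := by
    rw [hz, ← Complex.exp_nat_mul, ← Complex.exp_neg]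
    have := Complex.exp_mul_I (-((((i + 1 : ℕ) : ℝ) : ℂ) * t))
    rw [Complex.cos_neg, Complex.sin_neg] at this
    rw [sub_eq_add_neg, ← neg_mul (Complex.sin _), ← this]
    congr 1
    push_cast
    ring
  have h3 : z ^ (n - (i + 1)) = z ^ n * (z ^ (i + 1))⁻¹ := pow_sub₀ z hz0 hle
  rw [h3, pow_add, h2, h1]
  push_cast
  linear_combination (z ^ n * (-B i) * Complex.sin (((i : ℂ) + 1) * t)) * Complex.I_sq

theorem trigToPoly_ne_zero {n : ℕ} (hn : 1 ≤ n) {A B : ℕ → ℝ} (hA : A 0 ≠ 0) : trigToPoly n A B ≠ 0 := by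
  intro h
  -- Only the first summand reaches degree `n + 1`; the exponents `n - (i + 1)` stay below `n`.
  have hc := congrArg (fun p => Polynomial.coeff p (n + 1)) h
  simp only [trigToPoly, Polynomial.finsetSum_coeff, Polynomial.coeff_add,
    Polynomial.coeff_C_mul_X_pow, Polynomial.coeff_zero] at hc
  have hterm : ∀ i ∈ Finset.range n, ((if n + 1 = n + (i + 1) then ((A i : ℂ) - Complex.I * B i) / 2 else 0)
      + (if n + 1 = n - (i + 1) then ((A i : ℂ) + Complex.I * B i) / 2 else 0))
      = if i = 0 then ((A 0 : ℂ) - Complex.I * B 0) / 2 else 0 := by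
    intro i _
    rw [if_neg (show ¬ n + 1 = n - (i + 1) by omega), add_zero]
    by_cases hi : i = 0
    · simp [hi]
    · rw [if_neg hi, if_neg (by omega)]
  rw [Finset.sum_congr rfl hterm, Finset.sum_ite_eq' (Finset.range n) 0,
    if_pos (Finset.mem_range.2 hn)] at hc
  have := congrArg Complex.re hc
  simp at this
  exact hA this

theorem natDegree_trigToPoly_le (n : ℕ) (A B : ℕ → ℝ) : (trigToPoly n A B).natDegree ≤ 2 * n := by
  refine Polynomial.natDegree_sum_le_of_forall_le _ _ fun i hi => ?_
  have hle : i + 1 ≤ n := Finset.mem_range.1 hi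
  refine (Polynomial.natDegree_add_le _ _).trans (max_le ?_ ?_)
  · exact (Polynomial.natDegree_C_mul_X_pow_le _ _).trans (by omega)
  · exact (Polynomial.natDegree_C_mul_X_pow_le _ _).trans (by omega)

/-- Distinct zeros in `[0, 2π)` give distinct roots `e^{it}` of a nonzero polynomial of degree at
most `2 n`. The extra `1` accounts for the endpoint `2π`, which has the same image as `0`. -/
theorem encard_zeros_trig_le {n : ℕ} (hn : 1 ≤ n) {A B : ℕ → ℝ} (hA : A 0 ≠ 0) :
    {t ∈ Set.Icc 0 (2 * Real.pi) | ∑ i ∈ Finset.range n, (A i * Real.cos (((i + 1 : ℕ) : ℝ) * t)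
        + B i * Real.sin (((i + 1 : ℕ) : ℝ) * t)) = 0}.encard ≤ ((2 * n + 1 : ℕ) : ℕ∞) := by
  have hp0 := trigToPoly_ne_zero hn (B := B) hA
  set f : ℝ → ℝ := fun t => ∑ i ∈ Finset.range n, (A i * Real.cos (((i + 1 : ℕ) : ℝ) * t)
        + B i * Real.sin (((i + 1 : ℕ) : ℝ) * t)) with hf
  have hsub : {t ∈ Set.Icc 0 (2 * Real.pi) | f t = 0}
      ⊆ {t ∈ Set.Ico 0 (2 * Real.pi) | f t = 0} ∪ {2 * Real.pi} := by
    rintro t ⟨ht, h0⟩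
    rcases ht.2.lt_or_eq with h | h
    · exact Or.inl ⟨⟨ht.1, h⟩, h0⟩
    · exact Or.inr h
  have hinj : Set.InjOn (fun t : ℝ => Complex.exp (t * Complex.I))
      {t ∈ Set.Ico 0 (2 * Real.pi) | f t = 0} := by
    rintro x ⟨hx, -⟩ y ⟨hy, -⟩ hxy
    obtain ⟨k, hk⟩ := Complex.exp_eq_exp_iff_exists_int.1 hxy
    have hk' : x = y + k * (2 * Real.pi) := by
      have h1 : (x : ℂ) * Complex.I = ((y + k * (2 * Real.pi) : ℝ) : ℂ) * Complex.I := by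
        rw [hk]; push_cast; ring
      exact_mod_cast mul_right_cancel₀ Complex.I_ne_zero h1
    have hpi := Real.pi_pos
    have h1 : (k : ℝ) < 1 := by
      by_contra h; push Not at h
      nlinarith [hx.2, hy.1]
    have h2 : (-1 : ℝ) < k := by
      by_contra h; push Not at h
      nlinarith [hx.1, hy.2]
    have : k = 0 := by
      have h1' : k < 1 := by exact_mod_cast h1
      have h2' : -1 < k := by exact_mod_cast h2
      omega
    rw [hk', this]; simp
  have himg : (fun t : ℝ => Complex.exp (t * Complex.I)) '' {t ∈ Set.Ico 0 (2 * Real.pi) | f t = 0}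
      ⊆ ((trigToPoly n A B).roots.toFinset : Set ℂ) := by
    rintro _ ⟨t, ⟨-, h0⟩, rfl⟩
    rw [Finset.mem_coe, Multiset.mem_toFinset, Polynomial.mem_roots hp0, Polynomial.IsRoot]
    refine (trigToPoly_eval n A B t).trans ?_
    change _ * ((f t : ℝ) : ℂ) = 0
    rw [h0]; simp
  calc {t ∈ Set.Icc 0 (2 * Real.pi) | f t = 0}.encard
      ≤ {t ∈ Set.Ico 0 (2 * Real.pi) | f t = 0}.encard + ({2 * Real.pi} : Set ℝ).encard :=
        (Set.encard_le_encard hsub).trans (Set.encard_union_le _ _)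
    _ ≤ ((2 * n : ℕ) : ℕ∞) + 1 := by
        refine add_le_add ?_ (by simp)
        rw [← hinj.encard_image]
        refine (Set.encard_le_encard himg).trans ?_
        rw [Set.encard_coe_eq_coe_finsetCard]
        exact_mod_cast (Multiset.toFinset_card_le _).trans
          ((Polynomial.card_roots' _).trans (natDegree_trigToPoly_le n A B))
    _ = ((2 * n + 1 : ℕ) : ℕ∞) := by push_cast; ring

section

variable {Ω : Type*} [MeasurableSpace Ω] {P : Measure Ω}

theorem aemeasurable_numZeros_trigPoly {a b : ℕ+ → Ω → ℝ} (ha : ∀ k, AEMeasurable (a k) P)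
    (hb : ∀ k, AEMeasurable (b k) P) (n : ℕ) :
    AEMeasurable (fun ω => ((numZeros (trigPoly a b n ω) : ℕ∞) : ℝ≥0∞)) P := by
  have h1 : ∀ᵐ ω ∂P, ∀ k, a k ω = (ha k).mk (a k) ω := ae_all_iff.2 fun k => (ha k).ae_eq_mk
  have h2 : ∀ᵐ ω ∂P, ∀ k, b k ω = (hb k).mk (b k) ω := ae_all_iff.2 fun k => (hb k).ae_eq_mk
  have m1 : ∀ k, Measurable ((ha k).mk (a k)) := fun k => (ha k).measurable_mk
  have m2 : ∀ k, Measurable ((hb k).mk (b k)) := fun k => (hb k).measurable_mk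
  refine ⟨fun ω => ((numZeros (trigPoly (fun k => (ha k).mk (a k)) (fun k => (hb k).mk (b k)) n ω) : ℕ∞)
    : ℝ≥0∞), measurable_numZeros (fun t => ?_) (fun ω => ?_), ?_⟩
  · unfold trigPoly
    fun_prop
  · unfold trigPoly
    fun_prop
  · filter_upwards [h1, h2] with ω hω1 hω2
    have : trigPoly a b n ω = trigPoly (fun k => (ha k).mk (a k)) (fun k => (hb k).mk (b k)) n ω := by
      ext t
      simp only [trigPoly, hω1, hω2]
    rw [this]

/-- The first coefficient `a_1` is a standard Gaussian, hence almost surely nonzero, and the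
deterministic bound `2 n + 1` applies. This covers every `α`, including `sin α = 0`. -/
theorem expectedZeros_ne_top [IsProbabilityMeasure P] {α : ℝ} {a b : ℕ+ → Ω → ℝ}
    (hab : IsCosineCorrelatedPair P α a b) {n : ℕ} (hn : 1 ≤ n) : expectedZeros P a b n ≠ ∞ := by
  have hg := hab.gaussian_left.hasGaussianLaw_eval (Nat.succPNat 0)
  have hvar : Var[a (Nat.succPNat 0); P] = 1 := by
    rw [← covariance_self hg.aemeasurable, covariance_eq_sub hg.memLp_two hg.memLp_two,
      hab.centered_left]
    have := hab.correlation_left (Nat.succPNat 0) (Nat.succPNat 0)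
    simp only [sub_self, zero_mul, Real.cos_zero] at this
    simpa using this
  have hlaw := hg.map_eq_gaussianReal
  rw [hab.centered_left, hvar, Real.toNNReal_one] at hlaw
  have hne : ∀ᵐ ω ∂P, a (Nat.succPNat 0) ω ≠ 0 := by
    have := nullSingletonClass_gaussianReal (μ := 0) (v := 1) one_ne_zero
    have h0 : (gaussianReal 0 1) {0} = 0 := measure_singleton 0
    rw [← hlaw, Measure.map_apply_of_aemeasurable hg.aemeasurable (measurableSet_singleton 0)] at h0
    exact measure_eq_zero_iff_ae_notMem.1 h0
  refine ne_top_of_le_ne_top (b := ((2 * n + 1 : ℕ) : ℝ≥0∞)) (ENNReal.natCast_ne_top _) ?_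
  calc expectedZeros P a b n ≤ ∫⁻ _, ((2 * n + 1 : ℕ) : ℝ≥0∞) ∂P := by
        refine lintegral_mono_ae (hne.mono fun ω hω => ?_)
        have h := encard_zeros_trig_le hn (A := fun i => a i.succPNat ω) (B := fun i => b i.succPNat ω) hω
        have hs : 1 / Real.sqrt n ≠ 0 := by
          have : 0 < Real.sqrt n := Real.sqrt_pos.2 (by positivity)
          positivity
        have e : numZeros (trigPoly a b n ω) ≤ ((2 * n + 1 : ℕ) : ℕ∞) := by
          refine le_trans (le_of_eq ?_) h
          simp only [numZeros, trigPoly, mul_eq_zero, hs, false_or]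
        have e2 := ENat.toENNReal_le.2 e
        simpa using e2
    _ = ((2 * n + 1 : ℕ) : ℝ≥0∞) := by simp

end

/-! ### Deterministic zeros when `n α` is a multiple of `2π` -/

theorem cos_eq_cos_of_mem_Icc {t c : ℝ} (ht : t ∈ Set.Icc 0 (2 * Real.pi)) (h : Real.cos t = c) :
    t = Real.arccos c ∨ t = 2 * Real.pi - Real.arccos c := by
  rcases le_total t Real.pi with hle | hle
  · left; rw [← h, Real.arccos_cos ht.1 hle]
  · right
    have : Real.cos (2 * Real.pi - t) = c := by rw [Real.cos_two_pi_sub, h]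
    rw [← this, Real.arccos_cos (by linarith [ht.2]) (by linarith)]
    ring

/-- If `n α` is a multiple of `2π`, then `f_n` has at least `n - 2` deterministic zeros. -/
theorem le_encard_deterministic_zeros {n : ℕ} (hn : 1 ≤ n) {α : ℝ} {k : ℤ}
    (hk : n * α = 2 * Real.pi * k) (U : Fin 4 → ℝ) :
    ((n - 2 : ℕ) : ℕ∞) ≤
      {t ∈ Set.Icc 0 (2 * Real.pi) \ regularPoints n α | gaussianPoly n α U t = 0}.encard := by
  have hn0 : (0 : ℝ) < n := by positivity
  have hpi := Real.pi_pos
  -- At these points `n (t ± α) / 2` are both multiples of `π`, so `clearedPoly` vanishes for every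
  -- `U`.
  set T : ℕ → ℝ := fun j => 2 * Real.pi * j / n with hT
  have hTinj : Function.Injective T := by
    intro i j hij
    simp only [hT] at hij
    field_simp at hij
    exact_mod_cast hij
  have hTmem : ∀ j ∈ Finset.range n, T j ∈ Set.Icc 0 (2 * Real.pi) := by
    intro j hj
    have hj' : (j : ℝ) ≤ n := by exact_mod_cast (Finset.mem_range.1 hj).le
    refine ⟨by positivity, ?_⟩
    rw [hT, div_le_iff₀ hn0]
    gcongr
  -- The factor `sin ((t + α) / 2) * sin ((t - α) / 2)` between `clearedPoly` and `gaussianPoly`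
  -- vanishes exactly when `cos t = cos α`. That discards at most two points.
  set J := (Finset.range n).filter fun j => Real.cos (T j) ≠ Real.cos α with hJ
  set J' := (Finset.range n).filter fun j => ¬ Real.cos (T j) ≠ Real.cos α with hJ'
  have hcard : J.card + J'.card = n := by
    rw [hJ, hJ', Finset.card_filter_add_card_filter_not, Finset.card_range]
  have hJ'card : J'.card ≤ 2 := by
    rw [← Finset.card_image_of_injective J' hTinj]
    refine (Finset.card_le_card (t := {Real.arccos (Real.cos α), 2 * Real.pi - Real.arccos (Real.cos α)})
      ?_).trans Finset.card_le_two
    intro t ht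
    obtain ⟨j, hj, rfl⟩ := Finset.mem_image.1 ht
    obtain ⟨hj1, hj2⟩ := Finset.mem_filter.1 hj
    rw [not_not] at hj2
    rcases cos_eq_cos_of_mem_Icc (hTmem j hj1) hj2 with h | h
    · rw [Finset.mem_insert]; exact Or.inl h
    · rw [Finset.mem_insert, Finset.mem_singleton]; exact Or.inr h
  have hsub : ((J.image T : Finset ℝ) : Set ℝ) ⊆
      {t ∈ Set.Icc 0 (2 * Real.pi) \ regularPoints n α | gaussianPoly n α U t = 0} := by
    intro t ht
    obtain ⟨j, hj, rfl⟩ := Finset.mem_image.1 (Finset.mem_coe.1 ht)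
    obtain ⟨hj1, hj2⟩ := Finset.mem_filter.1 hj
    have hp : Real.sin (n * ((T j + α) / 2)) = 0 := by
      have : n * ((T j + α) / 2) = ((j + k : ℤ) : ℝ) * Real.pi := by
        rw [show n * ((T j + α) / 2) = (n * T j + n * α) / 2 by ring, hk, hT]
        push_cast
        field_simp
      rw [this, Real.sin_int_mul_pi]
    have hm : Real.sin (n * ((T j - α) / 2)) = 0 := by
      have : n * ((T j - α) / 2) = ((j - k : ℤ) : ℝ) * Real.pi := by
        rw [show n * ((T j - α) / 2) = (n * T j - n * α) / 2 by ring, hk, hT]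
        push_cast
        field_simp
      rw [this, Real.sin_int_mul_pi]
    refine ⟨⟨hTmem j hj1, fun h => h.2.2.2.1 hp⟩, ?_⟩
    have hσ : Real.sin ((T j + α) / 2) * Real.sin ((T j - α) / 2) ≠ 0 := by
      have h := Real.cos_sub_cos (T j) α
      intro h0
      apply hj2
      rw [mul_assoc, h0, mul_zero] at h
      linarith
    have hcl : clearedPoly n α U (T j) = 0 := by
      rw [clearedPoly, hp, hm]; ring
    rw [clearedPoly_eq] at hcl
    exact (mul_eq_zero.1 hcl).resolve_left hσ
  calc ((n - 2 : ℕ) : ℕ∞) ≤ ((J.image T).card : ℕ∞) := by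
        rw [Finset.card_image_of_injective J hTinj]
        exact_mod_cast (by omega : n - 2 ≤ J.card)
    _ = ((J.image T : Finset ℝ) : Set ℝ).encard := (Set.encard_coe_eq_coe_finsetCard _).symm
    _ ≤ _ := Set.encard_le_encard hsub

/-- The rotation term is dropped: the speed is at least `(n + 1) / 2`, over an interval of length
`2π`. -/
theorem le_lintegral_speed {n : ℕ} (α : ℝ) :
    ((n + 1 : ℕ) : ℝ≥0∞) ≤ ∫⁻ t in Set.Icc 0 (2 * Real.pi), ENNReal.ofReal (Real.pi⁻¹ * speed n α t) := by
  have hpi := Real.pi_pos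
  calc ((n + 1 : ℕ) : ℝ≥0∞)
      = ∫⁻ _ in Set.Icc 0 (2 * Real.pi), ENNReal.ofReal (Real.pi⁻¹ * (((n : ℝ) + 1) / 2)) := by
        rw [setLIntegral_const, Real.volume_Icc, ← ENNReal.ofReal_mul (by positivity),
          ← ENNReal.ofReal_natCast]
        congr 1
        push_cast
        field_simp
        ring
    _ ≤ _ := by
        refine lintegral_mono fun t => ENNReal.ofReal_le_ofReal ?_
        refine mul_le_mul_of_nonneg_left ?_ (by positivity)
        refine Real.le_sqrt_of_sq_le ?_
        nlinarith [sq_nonneg ((n : ℝ) / 2 * rotation n α t)]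

theorem le_lintegral_numZeros_of_mul_eq {n : ℕ} (hn : 1 ≤ n) {α : ℝ} {k : ℤ}
    (hk : n * α = 2 * Real.pi * k) :
    ((n + 1 + (n - 2) : ℕ) : ℝ≥0∞) ≤ ∫⁻ U, ((numZeros (gaussianPoly n α U) : ℕ∞) : ℝ≥0∞)
      ∂(Measure.pi fun _ : Fin 4 => gaussianReal 0 1) := by
  rw [lintegral_pi_fin_four (measurable_numZeros_gaussianPoly n α)]
  calc ((n + 1 + (n - 2) : ℕ) : ℝ≥0∞) ≤ ∫⁻ z, ∫⁻ u,
        ((({t ∈ regularPoints n α | clearedPoly n α (Fin.cons u z) t = 0}.encard : ℕ∞) : ℝ≥0∞)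
          + ((n - 2 : ℕ) : ℝ≥0∞))
        ∂(gaussianReal 0 1) ∂(Measure.pi fun _ : Fin 3 => gaussianReal 0 1) := by
        simp_rw [lintegral_add_right _ measurable_const]
        rw [lintegral_encard_clearedPoly hn]
        simp only [lintegral_const, measure_univ, mul_one]
        rw [Nat.cast_add]
        gcongr
        exact le_lintegral_speed α
    _ ≤ _ := by
        refine lintegral_mono fun z => lintegral_mono fun u => ?_
        simp only
        rw [numZeros_gaussianPoly_eq]
        gcongr
        have := ENat.toENNReal_le.2 (le_encard_deterministic_zeros hn hk (Fin.cons u z))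
        simpa using this

/-! ### Bounds on the rotation -/

theorem abs_sin_natCast_mul_le (n : ℕ) (φ : ℝ) : |Real.sin (n * φ)| ≤ n * |Real.sin φ| := by
  induction n with
  | zero => simp
  | succ n ih =>
    have e : ((n + 1 : ℕ) : ℝ) * φ = n * φ + φ := by push_cast; ring
    rw [e, Real.sin_add]
    have h1 : |Real.sin (n * φ) * Real.cos φ| ≤ |Real.sin (n * φ)| := by
      rw [abs_mul]; exact mul_le_of_le_one_right (abs_nonneg _) (Real.abs_cos_le_one _)
    have h2 : |Real.cos (n * φ) * Real.sin φ| ≤ |Real.sin φ| := by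
      rw [abs_mul]; exact mul_le_of_le_one_left (abs_nonneg _) (Real.abs_cos_le_one _)
    have h3 := abs_add_le (Real.sin (n * φ) * Real.cos φ) (Real.cos (n * φ) * Real.sin φ)
    push_cast
    linarith

/-- A bound on the derivative of the Dirichlet kernel. -/
theorem abs_natCast_mul_cos_mul_sin_sub_le (n : ℕ) (φ : ℝ) :
    |n * Real.cos (n * φ) * Real.sin φ - Real.sin (n * φ) * Real.cos φ| ≤ n ^ 2 * Real.sin φ ^ 2 := by
  induction n with
  | zero => simp
  | succ n ih =>
    have e : ((n + 1 : ℕ) : ℝ) * φ = n * φ + φ := by push_cast; ring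
    have hrec : ((n + 1 : ℕ) : ℝ) * Real.cos (((n + 1 : ℕ) : ℝ) * φ) * Real.sin φ
        - Real.sin (((n + 1 : ℕ) : ℝ) * φ) * Real.cos φ
        = Real.cos φ * (n * Real.cos (n * φ) * Real.sin φ - Real.sin (n * φ) * Real.cos φ)
          - ((n : ℝ) + 1) * Real.sin (n * φ) * Real.sin φ ^ 2 := by
      rw [e, Real.sin_add, Real.cos_add]
      push_cast
      ring
    rw [hrec]
    have h1 : |Real.cos φ * (n * Real.cos (n * φ) * Real.sin φ - Real.sin (n * φ) * Real.cos φ)|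
        ≤ n ^ 2 * Real.sin φ ^ 2 := by
      rw [abs_mul]
      exact (mul_le_of_le_one_left (abs_nonneg _) (Real.abs_cos_le_one _)).trans ih
    have h2 : |((n : ℝ) + 1) * Real.sin (n * φ) * Real.sin φ ^ 2| ≤ ((n : ℝ) + 1) * Real.sin φ ^ 2 := by
      rw [abs_mul, abs_mul, abs_of_nonneg (sq_nonneg (Real.sin φ)),
        abs_of_nonneg (by positivity : (0 : ℝ) ≤ (n : ℝ) + 1)]
      refine mul_le_mul_of_nonneg_right ?_ (sq_nonneg _)
      exact mul_le_of_le_one_right (by positivity) (Real.abs_sin_le_one _)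
    have h3 := abs_sub (Real.cos φ * (n * Real.cos (n * φ) * Real.sin φ - Real.sin (n * φ) * Real.cos φ))
      (((n : ℝ) + 1) * Real.sin (n * φ) * Real.sin φ ^ 2)
    push_cast
    nlinarith [sq_nonneg (Real.sin φ), Nat.cast_nonneg (α := ℝ) n]

/-- The denominator of `rotation`. -/
def rotationDenom (n : ℕ) (α t : ℝ) : ℝ :=
  Real.sin (n * ((t + α) / 2)) ^ 2 * Real.sin ((t - α) / 2) ^ 2
      + Real.sin (n * ((t - α) / 2)) ^ 2 * Real.sin ((t + α) / 2) ^ 2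

/-- The numerator of `rotation`. -/
def rotationNum (n : ℕ) (α t : ℝ) : ℝ :=
  Real.sin (n * α) * Real.sin ((t + α) / 2) * Real.sin ((t - α) / 2)
      - 1 / n * Real.sin α * Real.sin (n * ((t + α) / 2)) * Real.sin (n * ((t - α) / 2))

theorem rotation_eq_div (n : ℕ) (α t : ℝ) :
    rotation n α t = rotationNum n α t / rotationDenom n α t := rfl

theorem rotationDenom_nonneg (n : ℕ) (α t : ℝ) : 0 ≤ rotationDenom n α t := by
  unfold rotationDenom; positivity

theorem abs_rotation_mul_denom_le (n : ℕ) (α t : ℝ) :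
    |rotation n α t| * rotationDenom n α t ≤ |rotationNum n α t| := by
  rw [rotation_eq_div, abs_div, abs_of_nonneg (rotationDenom_nonneg n α t)]
  rcases eq_or_ne (rotationDenom n α t) 0 with h | h
  · rw [h, mul_zero]; exact abs_nonneg _
  · rw [div_mul_cancel₀ _ h]

/-- In the term with `1 / n`, `|sin α| ≤ |sin ((t + α) / 2)| + |sin ((t - α) / 2)|` supplies one
small factor, and `|sin (n φ)| ≤ n |sin φ|` supplies the other while cancelling `1 / n`. -/
theorem abs_rotationNum_le {n : ℕ} (hn : 1 ≤ n) (α t : ℝ) :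
    |rotationNum n α t| ≤ 3 * (|Real.sin ((t + α) / 2)| * |Real.sin ((t - α) / 2)|) := by
  have hn0 : (0 : ℝ) < n := by positivity
  set p := |Real.sin ((t + α) / 2)| with hp
  set m := |Real.sin ((t - α) / 2)| with hm
  have hP := abs_sin_natCast_mul_le n ((t + α) / 2)
  have hM := abs_sin_natCast_mul_le n ((t - α) / 2)
  have hP1 := Real.abs_sin_le_one (n * ((t + α) / 2))
  have hM1 := Real.abs_sin_le_one (n * ((t - α) / 2))
  rw [← hp] at hP
  rw [← hm] at hM
  set Q := |Real.sin (n * ((t + α) / 2))| with hQ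
  set M := |Real.sin (n * ((t - α) / 2))| with hM'
  have hp0 : 0 ≤ p := abs_nonneg _
  have hm0 : 0 ≤ m := abs_nonneg _
  have hQ0 : 0 ≤ Q := abs_nonneg _
  have hM0 : 0 ≤ M := abs_nonneg _
  have hsα : |Real.sin α| ≤ p + m := by
    have e : Real.sin α = Real.sin ((t + α) / 2) * Real.cos ((t - α) / 2)
        - Real.cos ((t + α) / 2) * Real.sin ((t - α) / 2) := by
      rw [← Real.sin_sub]; congr 1; ring
    rw [e]
    refine (abs_sub _ _).trans (add_le_add ?_ ?_)
    · rw [abs_mul]; exact mul_le_of_le_one_right (abs_nonneg _) (Real.abs_cos_le_one _)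
    · rw [abs_mul]; exact mul_le_of_le_one_left (abs_nonneg _) (Real.abs_cos_le_one _)
  have h1 : |Real.sin (n * α) * Real.sin ((t + α) / 2) * Real.sin ((t - α) / 2)| ≤ p * m := by
    rw [abs_mul, abs_mul, mul_assoc]
    exact mul_le_of_le_one_left (by positivity) (Real.abs_sin_le_one _)
  have h2 : |1 / (n : ℝ) * Real.sin α * Real.sin (n * ((t + α) / 2)) * Real.sin (n * ((t - α) / 2))|
      ≤ 2 * (p * m) := by
    rw [abs_mul, abs_mul, abs_mul, abs_of_nonneg (by positivity : (0 : ℝ) ≤ 1 / n), ← hQ, ← hM']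
    have e1 : 1 / (n : ℝ) * |Real.sin α| * Q * M ≤ 1 / (n : ℝ) * ((p + m) * Q * M) := by
      rw [mul_assoc, mul_assoc, mul_assoc]
      gcongr
    have e2 : p * Q * M ≤ n * (p * m) := by
      calc p * Q * M ≤ p * 1 * (n * m) := by gcongr
        _ = n * (p * m) := by ring
    have e3 : m * Q * M ≤ n * (p * m) := by
      calc m * Q * M ≤ m * (n * p) * 1 := by gcongr
        _ = n * (p * m) := by ring
    calc 1 / (n : ℝ) * |Real.sin α| * Q * M ≤ 1 / (n : ℝ) * ((p + m) * Q * M) := e1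
      _ ≤ 1 / (n : ℝ) * (n * (p * m) + n * (p * m)) := by
          gcongr
          linarith
      _ = 2 * (p * m) := by field_simp; ring
  unfold rotationNum
  refine (abs_sub _ _).trans ?_
  linarith

/-- This sharper bound serves near `t = ±α`. There `n` times the numerator is a combination of the
quantities `n cos (n φ) sin φ - sin (n φ) cos φ`, which are of second order in `sin φ`. -/
theorem abs_rotationNum_le' {n : ℕ} (hn : 1 ≤ n) (α t : ℝ) :
    |rotationNum n α t| ≤ n * ((|Real.sin ((t + α) / 2)| * |Real.sin ((t - α) / 2)|) *
      (|Real.sin (n * ((t + α) / 2))| * |Real.sin ((t - α) / 2)|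
        + |Real.sin (n * ((t - α) / 2))| * |Real.sin ((t + α) / 2)|)) := by
  have hn0 : (0 : ℝ) < n := by positivity
  have hP := abs_natCast_mul_cos_mul_sin_sub_le n ((t + α) / 2)
  have hM := abs_natCast_mul_cos_mul_sin_sub_le n ((t - α) / 2)
  set sp := Real.sin (n * ((t + α) / 2)) with hsp
  set sm := Real.sin (n * ((t - α) / 2)) with hsm
  set σp := Real.sin ((t + α) / 2) with hσp
  set σm := Real.sin ((t - α) / 2) with hσm
  set Ep := n * Real.cos (n * ((t + α) / 2)) * σp - sp * Real.cos ((t + α) / 2) with hEp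
  set Em := n * Real.cos (n * ((t - α) / 2)) * σm - sm * Real.cos ((t - α) / 2) with hEm
  have hid : n * rotationNum n α t = sp * σp * Em - sm * σm * Ep := by
    have e : Real.sin α = σp * Real.cos ((t - α) / 2) - Real.cos ((t + α) / 2) * σm := by
      rw [hσp, hσm, ← Real.sin_sub]; congr 1; ring
    rw [rotationNum, sin_natCast_mul_eq n α t, e, hEp, hEm]
    simp only [← hsp, ← hsm, ← hσp, ← hσm]
    field_simp
    ring
  have hb : n * |rotationNum n α t| ≤ n * (n * ((|σp| * |σm|) * (|sp| * |σm| + |sm| * |σp|))) := by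
    have h1 : (n : ℝ) * |rotationNum n α t| = |n * rotationNum n α t| := by
      rw [abs_mul, abs_of_pos hn0]
    rw [h1, hid]
    refine (abs_sub _ _).trans ?_
    rw [abs_mul, abs_mul, abs_mul, abs_mul]
    have e1 : |sp| * |σp| * |Em| ≤ |sp| * |σp| * (n ^ 2 * |σm| ^ 2) := by
      rw [sq_abs]; gcongr
    have e2 : |sm| * |σm| * |Ep| ≤ |sm| * |σm| * (n ^ 2 * |σp| ^ 2) := by
      rw [sq_abs]; gcongr
    refine (add_le_add e1 e2).trans (le_of_eq ?_)
    ring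
  exact le_of_mul_le_mul_left hb hn0

/-- The sum equals `1 - cos (A - B) cos (A + B)`. For `A, B = n (t ± α) / 2` the difference is `n
α`, so the lower bound is uniform in `t`. -/
theorem sin_sq_add_sin_sq_ge (A B : ℝ) :
    1 - |Real.cos (A - B)| ≤ Real.sin A ^ 2 + Real.sin B ^ 2 := by
  have h : Real.sin A ^ 2 + Real.sin B ^ 2 = 1 - Real.cos (A - B) * Real.cos (A + B) := by
    rw [Real.cos_sub, Real.cos_add]
    have h1 := Real.sin_sq_add_cos_sq A
    have h2 := Real.sin_sq_add_cos_sq B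
    linear_combination (Real.cos B ^ 2) * h1 + (1 - Real.sin A ^ 2) * h2
  rw [h]
  have h3 : Real.cos (A - B) * Real.cos (A + B) ≤ |Real.cos (A - B)| := by
    refine (le_abs_self _).trans ?_
    rw [abs_mul]
    exact mul_le_of_le_one_right (abs_nonneg _) (Real.abs_cos_le_one _)
  linarith

/-- The modulus of a difference of two cosines as a product of sines. -/
theorem abs_cos_sub_cos_eq (x y : ℝ) :
    |Real.cos x - Real.cos y| = 2 * (|Real.sin ((y + x) / 2)| * |Real.sin ((y - x) / 2)|) := by
  rw [Real.cos_sub_cos, abs_mul, abs_mul, abs_neg, abs_two, add_comm x y, mul_assoc,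
    ← abs_neg (Real.sin ((x - y) / 2)), ← Real.sin_neg]
  congr 4
  ring_nf

theorem mul_sq_le_weighted {c p m a b : ℝ} (hp : |p| ≤ 1) (hm : |m| ≤ 1) (hab : c ≤ a ^ 2 + b ^ 2) :
    c * (|p| * |m|) ^ 2 ≤ a ^ 2 * m ^ 2 + b ^ 2 * p ^ 2 := by
  have hp2 : p ^ 2 ≤ 1 := by rw [← sq_abs]; exact pow_le_one₀ (abs_nonneg _) hp
  have hm2 : m ^ 2 ≤ 1 := by rw [← sq_abs]; exact pow_le_one₀ (abs_nonneg _) hm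
  rw [mul_pow, sq_abs, sq_abs]
  have h1 : a ^ 2 * (p ^ 2 * m ^ 2) ≤ a ^ 2 * m ^ 2 := by
    have : p ^ 2 * m ^ 2 ≤ m ^ 2 := mul_le_of_le_one_left (sq_nonneg _) hp2
    gcongr
  have h2 : b ^ 2 * (p ^ 2 * m ^ 2) ≤ b ^ 2 * p ^ 2 := by
    have : p ^ 2 * m ^ 2 ≤ p ^ 2 := mul_le_of_le_one_right (sq_nonneg _) hm2
    gcongr
  have h3 : c * (p ^ 2 * m ^ 2) ≤ (a ^ 2 + b ^ 2) * (p ^ 2 * m ^ 2) := by gcongr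
  linarith

section Bounds

variable {n : ℕ} {α t c : ℝ}

/-- The arithmetic-geometric inequality for the two terms of the denominator produces `2 |sin (n (t
+ α) / 2) sin (n (t - α) / 2)|`, which is the cosine difference. -/
theorem abs_rotation_mul_cos_sub_cos_le (hn : 1 ≤ n) :
    |rotation n α t| * |Real.cos (n * α) - Real.cos (n * t)| ≤ 3 := by
  have h1 := (abs_rotation_mul_denom_le n α t).trans (abs_rotationNum_le hn α t)
  have e : |Real.cos (n * α) - Real.cos (n * t)|
      = 2 * (|Real.sin (n * ((t + α) / 2))| * |Real.sin (n * ((t - α) / 2))|) := by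
    rw [abs_cos_sub_cos_eq]
    congr 4 <;> ring_nf
  rw [e]
  set p := |Real.sin ((t + α) / 2)| with hp
  set m := |Real.sin ((t - α) / 2)| with hm
  set Q := |Real.sin (n * ((t + α) / 2))| with hQ
  set M := |Real.sin (n * ((t - α) / 2))| with hM
  have hD : rotationDenom n α t = (Q * m) ^ 2 + (M * p) ^ 2 := by
    rw [rotationDenom, hp, hm, hQ, hM]
    simp only [mul_pow, sq_abs]
  have hpm0 : 0 ≤ p * m := by positivity
  rcases hpm0.eq_or_lt with h0 | h0
  · have : rotationNum n α t = 0 := by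
      have := abs_rotationNum_le hn α t
      rw [← hp, ← hm, ← h0, mul_zero] at this
      exact abs_eq_zero.1 (le_antisymm this (abs_nonneg _))
    rw [rotation_eq_div, this]
    norm_num
  · have h2 : |rotation n α t| * (2 * (Q * M)) * (p * m) ≤ 3 * (p * m) := by
      refine le_trans ?_ h1
      rw [hD, mul_assoc]
      refine mul_le_mul_of_nonneg_left ?_ (abs_nonneg _)
      nlinarith [sq_nonneg (Q * m - M * p)]
    exact le_of_mul_le_mul_right h2 h0

theorem mul_abs_rotation_mul_le (hn : 1 ≤ n) (hc : c ≤ 1 - |Real.cos (n * α)|) :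
    c * |rotation n α t| * |Real.cos α - Real.cos t| ≤ 6 := by
  have h1 := (abs_rotation_mul_denom_le n α t).trans (abs_rotationNum_le hn α t)
  have hab : c ≤ Real.sin (n * ((t + α) / 2)) ^ 2 + Real.sin (n * ((t - α) / 2)) ^ 2 := by
    refine hc.trans ?_
    have := sin_sq_add_sin_sq_ge (n * ((t + α) / 2)) (n * ((t - α) / 2))
    rwa [show n * ((t + α) / 2) - n * ((t - α) / 2) = n * α by ring] at this
  have hw := mul_sq_le_weighted (Real.abs_sin_le_one ((t + α) / 2)) (Real.abs_sin_le_one ((t - α) / 2)) hab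
  rw [abs_cos_sub_cos_eq α t]
  set p := |Real.sin ((t + α) / 2)| with hp
  set m := |Real.sin ((t - α) / 2)| with hm
  have hpm0 : 0 ≤ p * m := by positivity
  rcases hpm0.eq_or_lt with h0 | h0
  · rw [← h0]; norm_num
  · have h2 : (c * |rotation n α t| * (p * m)) * (p * m) ≤ 3 * (p * m) := by
      refine le_trans ?_ h1
      have := mul_le_mul_of_nonneg_left hw (abs_nonneg (rotation n α t))
      refine le_trans (le_of_eq ?_) this
      ring
    have := le_of_mul_le_mul_right h2 h0
    linarith

/-- A bound of order `n`, uniform in `t`. It absorbs the cost of displacing `t` by `O(1 / n)` in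
`mul_rotation_sq_mul_le`. -/
theorem mul_abs_rotation_le (hn : 1 ≤ n) (hc0 : 0 ≤ c) (hc : c ≤ 1 - |Real.cos (n * α)|) :
    c * |rotation n α t| ≤ 3 / 2 * n := by
  have h1 := (abs_rotation_mul_denom_le n α t).trans (abs_rotationNum_le' hn α t)
  have hab : c ≤ Real.sin (n * ((t + α) / 2)) ^ 2 + Real.sin (n * ((t - α) / 2)) ^ 2 := by
    refine hc.trans ?_
    have := sin_sq_add_sin_sq_ge (n * ((t + α) / 2)) (n * ((t - α) / 2))
    rwa [show n * ((t + α) / 2) - n * ((t - α) / 2) = n * α by ring] at this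
  have hw := mul_sq_le_weighted (Real.abs_sin_le_one ((t + α) / 2)) (Real.abs_sin_le_one ((t - α) / 2)) hab
  have hc1 : c ≤ 1 := hc.trans (by linarith [abs_nonneg (Real.cos (n * α))])
  change _ ≤ rotationDenom n α t at hw
  set p := |Real.sin ((t + α) / 2)| with hp
  set m := |Real.sin ((t - α) / 2)| with hm
  set Q := |Real.sin (n * ((t + α) / 2))| with hQ
  set M := |Real.sin (n * ((t - α) / 2))| with hM
  have hD : rotationDenom n α t = (Q * m) ^ 2 + (M * p) ^ 2 := by
    rw [rotationDenom, hp, hm, hQ, hM]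
    simp only [mul_pow, sq_abs]
  rcases (rotationDenom_nonneg n α t).eq_or_lt with h0 | h0
  · rw [rotation_eq_div, ← h0, div_zero, abs_zero, mul_zero]; positivity
  -- With `D` the denominator, the square of `c p m` is at most `D` (as `c ≤ 1`) and that of `Q m +
  -- M p` at most `2 D`; half their sum gives `3 / 2`.
  · have h2 : c * ((p * m) * (Q * m + M * p)) ≤ 3 / 2 * rotationDenom n α t := by
      have e1 : (Q * m + M * p) ^ 2 ≤ 2 * rotationDenom n α t := by
        rw [hD]; nlinarith [sq_nonneg (Q * m - M * p)]
      have e2 : (c * (p * m)) ^ 2 ≤ rotationDenom n α t := by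
        calc (c * (p * m)) ^ 2 = c * (c * (p * m) ^ 2) := by ring
          _ ≤ 1 * (c * (p * m) ^ 2) := by gcongr
          _ ≤ rotationDenom n α t := by rw [one_mul]; exact hw
      nlinarith [sq_nonneg (c * (p * m) - (Q * m + M * p))]
    have h3 : (c * |rotation n α t|) * rotationDenom n α t ≤ (3 / 2 * n) * rotationDenom n α t := by
      calc (c * |rotation n α t|) * rotationDenom n α t
          = c * (|rotation n α t| * rotationDenom n α t) := by ring
        _ ≤ c * (n * ((p * m) * (Q * m + M * p))) := by gcongr
        _ = n * (c * ((p * m) * (Q * m + M * p))) := by ring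
        _ ≤ n * (3 / 2 * rotationDenom n α t) := by gcongr
        _ = _ := by ring
    exact le_of_mul_le_mul_right h3 h0

/-- A bound on the rotation at `t` in terms of a point `s` at distance `O(1 / n)`. -/
theorem mul_rotation_sq_mul_le (hn : 1 ≤ n) (hc0 : 0 ≤ c) (hc : c ≤ 1 - |Real.cos (n * α)|)
    {s K : ℝ} (hs : |t - s| ≤ K / n) :
    c * rotation n α t ^ 2 *
      (|Real.cos (n * α) - Real.cos (n * t)| * |Real.cos α - Real.cos s|) ≤ 3 * (6 + 3 / 2 * K) := by
  have hn0 : (0 : ℝ) < n := by positivity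
  have h1 := abs_rotation_mul_cos_sub_cos_le (n := n) (α := α) (t := t) hn
  have h2 := mul_abs_rotation_mul_le (t := t) hn hc
  have h3 := mul_abs_rotation_le (t := t) hn hc0 hc
  have h4 : |Real.cos α - Real.cos s| ≤ |Real.cos α - Real.cos t| + K / n := by
    have e : Real.cos α - Real.cos s = (Real.cos α - Real.cos t) + (Real.cos t - Real.cos s) := by ring
    rw [e]
    refine (abs_add_le _ _).trans (add_le_add le_rfl ?_)
    exact (Real.abs_cos_sub_cos_le t s).trans hs
  have hK : 0 ≤ K := by
    have := (abs_nonneg _).trans hs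
    rwa [le_div_iff₀ hn0, zero_mul] at this
  have h5 : c * |rotation n α t| * |Real.cos α - Real.cos s| ≤ 6 + 3 / 2 * K := by
    calc c * |rotation n α t| * |Real.cos α - Real.cos s|
        ≤ c * |rotation n α t| * (|Real.cos α - Real.cos t| + K / n) := by gcongr
      _ = c * |rotation n α t| * |Real.cos α - Real.cos t| + c * |rotation n α t| * (K / n) := by ring
      _ ≤ 6 + 3 / 2 * n * (K / n) := by gcongr
      _ = 6 + 3 / 2 * K := by field_simp
  rw [← sq_abs (rotation n α t)]
  -- One factor `|rotation|` absorbs the fast singularity and the other the slow one. The square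
  -- root of the bound is a product of integrable singularities.
  calc c * |rotation n α t| ^ 2 *
      (|Real.cos (n * α) - Real.cos (n * t)| * |Real.cos α - Real.cos s|)
      = (|rotation n α t| * |Real.cos (n * α) - Real.cos (n * t)|) *
        (c * |rotation n α t| * |Real.cos α - Real.cos s|) := by ring
    _ ≤ 3 * (6 + 3 / 2 * K) := by gcongr

end Bounds

/-! ### The integrable dominating function -/

theorem intervalIntegrable_inv_sqrt_abs (a b : ℝ) :
    IntervalIntegrable (fun u : ℝ => (Real.sqrt |u|)⁻¹) volume a b := by
  have h1 : ∀ c : ℝ, 0 ≤ c → IntervalIntegrable (fun u : ℝ => (Real.sqrt |u|)⁻¹) volume 0 c := by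
    intro c hc
    refine (intervalIntegral.intervalIntegrable_rpow' (r := -(1 / 2)) (by norm_num)).congr ?_
    intro u hu
    rw [Set.uIoc_of_le hc] at hu
    simp only
    rw [abs_of_pos hu.1, Real.rpow_neg hu.1.le, Real.sqrt_eq_rpow]
  have h2 : ∀ c : ℝ, IntervalIntegrable (fun u : ℝ => (Real.sqrt |u|)⁻¹) volume 0 c := by
    intro c
    rcases le_total 0 c with hc | hc
    · exact h1 c hc
    · have := (h1 (-c) (by linarith)).comp_sub_left 0 (by simp)
      simpa using this
  exact (h2 a).symm.trans (h2 b)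

theorem intervalIntegrable_inv_sqrt_abs_sin_half (a b : ℝ) :
    IntervalIntegrable (fun u : ℝ => (Real.sqrt |Real.sin (u / 2)|)⁻¹) volume a b := by
  have hper : Function.Periodic (fun u : ℝ => (Real.sqrt |Real.sin (u / 2)|)⁻¹) (2 * Real.pi) := by
    intro u
    simp only
    rw [show (u + 2 * Real.pi) / 2 = u / 2 + Real.pi by ring, Real.sin_add_pi, abs_neg]
  refine hper.intervalIntegrable Real.two_pi_pos.ne' (t := -Real.pi) ?_ a b
  refine ((intervalIntegrable_inv_sqrt_abs _ _).const_mul (Real.sqrt Real.pi)).mono_fun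
    (by fun_prop) ?_
  refine (ae_restrict_iff' measurableSet_uIoc).2 (ae_of_all _ fun u hu => ?_)
  rw [Set.uIoc_of_le (by linarith [Real.pi_pos])] at hu
  have hpi := Real.pi_pos
  have h1 : |u / 2| ≤ Real.pi / 2 := by
    rw [abs_le]; constructor <;> linarith [hu.1, hu.2]
  have h2 := Real.mul_abs_le_abs_sin h1
  beta_reduce
  rw [Real.norm_of_nonneg (by positivity), Real.norm_of_nonneg (by positivity)]
  rcases eq_or_ne u 0 with rfl | h0
  · simp
  have h3 : |u| / Real.pi ≤ |Real.sin (u / 2)| := by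
    refine le_trans (le_of_eq ?_) h2
    rw [abs_div, abs_two]; field_simp
  have h4 : 0 < |u| / Real.pi := by positivity
  calc (Real.sqrt |Real.sin (u / 2)|)⁻¹ ≤ (Real.sqrt (|u| / Real.pi))⁻¹ := by
        gcongr
    _ = Real.sqrt Real.pi * (Real.sqrt |u|)⁻¹ := by
        rw [Real.sqrt_div (abs_nonneg _), inv_div, div_eq_mul_inv]

/-- Since `|sin x|` is at most the sum of the two half-angle sines, they cannot both be small, and
the two singularities separate. Where one of them vanishes, the left side is `0` by the convention
`0⁻¹ = 0`. -/
theorem inv_sqrt_abs_cos_sub_cos_le {x : ℝ} (hx : Real.sin x ≠ 0) (u : ℝ) :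
    (Real.sqrt |Real.cos x - Real.cos u|)⁻¹ ≤ (Real.sqrt |Real.sin x|)⁻¹ *
      ((Real.sqrt |Real.sin ((u + x) / 2)|)⁻¹ + (Real.sqrt |Real.sin ((u - x) / 2)|)⁻¹) := by
  have hs : |Real.sin x| ≤ |Real.sin ((u + x) / 2)| + |Real.sin ((u - x) / 2)| := by
    have e : Real.sin x = Real.sin ((u + x) / 2) * Real.cos ((u - x) / 2)
        - Real.cos ((u + x) / 2) * Real.sin ((u - x) / 2) := by
      rw [← Real.sin_sub]; congr 1; ring
    rw [e]
    refine (abs_sub _ _).trans (add_le_add ?_ ?_)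
    · rw [abs_mul]; exact mul_le_of_le_one_right (abs_nonneg _) (Real.abs_cos_le_one _)
    · rw [abs_mul]; exact mul_le_of_le_one_left (abs_nonneg _) (Real.abs_cos_le_one _)
  rw [abs_cos_sub_cos_eq]
  set a := |Real.sin ((u + x) / 2)| with ha
  set b := |Real.sin ((u - x) / 2)| with hb
  have ha0 : 0 ≤ a := abs_nonneg _
  have hb0 : 0 ≤ b := abs_nonneg _
  have hS : 0 < Real.sqrt |Real.sin x| := Real.sqrt_pos.2 (abs_pos.2 hx)
  rcases ha0.eq_or_lt with h | h
  · rw [← h]; simp only [zero_mul, mul_zero, Real.sqrt_zero, inv_zero]; positivity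
  rcases hb0.eq_or_lt with h' | h'
  · rw [← h']; simp only [mul_zero, Real.sqrt_zero, inv_zero]; positivity
  have hA : 0 < Real.sqrt a := Real.sqrt_pos.2 h
  have hB : 0 < Real.sqrt b := Real.sqrt_pos.2 h'
  have h1 : Real.sqrt |Real.sin x| ≤ Real.sqrt a + Real.sqrt b := by
    refine Real.sqrt_le_left (by positivity) |>.2 ?_ |>.trans le_rfl
    rw [add_sq, Real.sq_sqrt ha0, Real.sq_sqrt hb0]
    nlinarith [mul_pos hA hB]
  calc (Real.sqrt (2 * (a * b)))⁻¹ ≤ (Real.sqrt (a * b))⁻¹ := by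
        have : 0 < Real.sqrt (a * b) := Real.sqrt_pos.2 (by positivity)
        refine inv_anti₀ this (Real.sqrt_le_sqrt ?_)
        nlinarith [mul_pos h h']
    _ = (Real.sqrt |Real.sin x|)⁻¹ * (Real.sqrt |Real.sin x| * (Real.sqrt a * Real.sqrt b)⁻¹) := by
        rw [Real.sqrt_mul ha0]; field_simp
    _ ≤ (Real.sqrt |Real.sin x|)⁻¹ * ((Real.sqrt a + Real.sqrt b) * (Real.sqrt a * Real.sqrt b)⁻¹) := by
        gcongr
    _ = _ := by field_simp; ring

theorem integrableOn_inv_sqrt_abs_cos_sub_cos {x : ℝ} (hx : Real.sin x ≠ 0) :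
    IntegrableOn (fun u : ℝ => (Real.sqrt |Real.cos x - Real.cos u|)⁻¹)
      (Set.Icc 0 (2 * Real.pi)) := by
  rw [integrableOn_Icc_iff_integrableOn_Ioc,
    ← intervalIntegrable_iff_integrableOn_Ioc_of_le Real.two_pi_pos.le]
  have h : ∀ y : ℝ, IntervalIntegrable (fun u : ℝ => (Real.sqrt |Real.sin ((u + y) / 2)|)⁻¹) volume
      0 (2 * Real.pi) := by
    intro y
    have := (intervalIntegrable_inv_sqrt_abs_sin_half (0 + y) (2 * Real.pi + y)).comp_add_right y
    simpa using this
  have h2 := ((h x).add (h (-x))).const_mul (Real.sqrt |Real.sin x|)⁻¹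
  refine h2.mono_fun (by fun_prop) (ae_of_all _ fun u => ?_)
  beta_reduce
  rw [Real.norm_of_nonneg (by positivity)]
  refine (inv_sqrt_abs_cos_sub_cos_le hx u).trans ((le_of_eq ?_).trans (le_abs_self _))
  simp [sub_eq_add_neg]

/-- An integrable function on the square which dominates all the integrands. -/
def singularWeight (α x : ℝ) (p : ℝ × ℝ) : ℝ :=
  (Real.sqrt |Real.cos α - Real.cos p.1|)⁻¹ * (Real.sqrt |Real.cos x - Real.cos p.2|)⁻¹

theorem volume_restrict_square : (volume : Measure (ℝ × ℝ)).restrict square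
    = (volume.restrict (Set.Icc 0 (2 * Real.pi))).prod (volume.restrict (Set.Icc 0 (2 * Real.pi))) := by
  rw [Measure.prod_restrict, square, Measure.volume_eq_prod]

instance : IsFiniteMeasure ((volume : Measure (ℝ × ℝ)).restrict square) := by
  rw [volume_restrict_square]; infer_instance

theorem integrableOn_singularWeight {α x : ℝ} (hα : Real.sin α ≠ 0) (hx : Real.sin x ≠ 0) :
    IntegrableOn (singularWeight α x) square := by
  rw [IntegrableOn, volume_restrict_square]
  exact (integrableOn_inv_sqrt_abs_cos_sub_cos hα).mul_prod (integrableOn_inv_sqrt_abs_cos_sub_cos hx)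

theorem ae_sin_half_ne_zero (x : ℝ) : ∀ᵐ u : ℝ, Real.sin ((u + x) / 2) ≠ 0 := by
  have h := (countable_sin_affine_eq_zero (a := 1 / 2) (by norm_num) (x / 2)).ae_notMem (volume : Measure ℝ)
  filter_upwards [h] with u hu h0
  refine hu ?_
  rw [← h0]
  congr 1; ring

/-- The points of the plane in general position. -/
theorem ae_square_sin_ne_zero (α x : ℝ) : ∀ᵐ p : ℝ × ℝ ∂(volume.restrict square),
    (Real.sin ((p.1 + α) / 2) ≠ 0 ∧ Real.sin ((p.1 - α) / 2) ≠ 0) ∧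
      Real.sin ((p.2 + x) / 2) ≠ 0 ∧ Real.sin ((p.2 - x) / 2) ≠ 0 := by
  refine ae_restrict_of_ae ?_
  rw [Measure.volume_eq_prod]
  have h1 : ∀ y : ℝ, ∀ᵐ p : ℝ × ℝ ∂(volume.prod volume), Real.sin ((p.1 + y) / 2) ≠ 0 := fun y =>
    Measure.quasiMeasurePreserving_fst.ae (ae_sin_half_ne_zero y)
  have h2 : ∀ y : ℝ, ∀ᵐ p : ℝ × ℝ ∂(volume.prod volume), Real.sin ((p.2 + y) / 2) ≠ 0 := fun y =>
    Measure.quasiMeasurePreserving_snd.ae (ae_sin_half_ne_zero y)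
  filter_upwards [h1 α, h1 (-α), h2 x, h2 (-x)] with p a b c d
  exact ⟨⟨a, by simpa [sub_eq_add_neg] using b⟩, c, by simpa [sub_eq_add_neg] using d⟩

theorem abs_le_mul_singularWeight {α x c C q : ℝ} {p : ℝ × ℝ} (hc : 0 < c)
    (hp : (Real.sin ((p.1 + α) / 2) ≠ 0 ∧ Real.sin ((p.1 - α) / 2) ≠ 0) ∧
      Real.sin ((p.2 + x) / 2) ≠ 0 ∧ Real.sin ((p.2 - x) / 2) ≠ 0)
    (h : c * q ^ 2 * (|Real.cos x - Real.cos p.2| * |Real.cos α - Real.cos p.1|) ≤ C) :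
    |q| ≤ Real.sqrt (C / c) * singularWeight α x p := by
  have h1 : 0 < |Real.cos α - Real.cos p.1| := by
    rw [abs_cos_sub_cos_eq]
    have := abs_pos.2 hp.1.1
    have := abs_pos.2 hp.1.2
    positivity
  have h2 : 0 < |Real.cos x - Real.cos p.2| := by
    rw [abs_cos_sub_cos_eq]
    have := abs_pos.2 hp.2.1
    have := abs_pos.2 hp.2.2
    positivity
  set A := |Real.cos α - Real.cos p.1| with hA
  set B := |Real.cos x - Real.cos p.2| with hB
  have e : singularWeight α x p = Real.sqrt (A⁻¹ * B⁻¹) := by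
    rw [Real.sqrt_mul (by positivity), Real.sqrt_inv, Real.sqrt_inv]; rfl
  have hC : 0 ≤ C := le_trans (by positivity) h
  rw [e, ← Real.sqrt_mul (by positivity), ← Real.sqrt_sq_eq_abs]
  refine Real.sqrt_le_sqrt ?_
  rw [div_mul_eq_mul_div, le_div_iff₀ hc, ← mul_inv, ← div_eq_mul_inv, le_div_iff₀ (by positivity)]
  linarith [h]

theorem one_sub_abs_cos_pos {x : ℝ} (hx : Real.sin x ≠ 0) : 0 < 1 - |Real.cos x| := by
  have h1 := Real.sin_sq_add_cos_sq x
  have h2 : 0 < Real.sin x ^ 2 := by positivity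
  have h3 : |Real.cos x| ^ 2 < 1 := by rw [sq_abs]; linarith
  nlinarith [abs_nonneg (Real.cos x)]

/-- The same splitting of the square into two factors as for `rotation`, without the displacement
term. -/
theorem mul_g_sq_mul_le (α x s u : ℝ) :
    (1 - |Real.cos x|) * g α x s u ^ 2 *
      (|Real.cos x - Real.cos u| * |Real.cos α - Real.cos s|) ≤ 2 := by
  have hab : 1 - |Real.cos x| ≤ Real.sin ((u + x) / 2) ^ 2 + Real.sin ((u - x) / 2) ^ 2 := by
    have := sin_sq_add_sin_sq_ge ((u + x) / 2) ((u - x) / 2)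
    rwa [show (u + x) / 2 - (u - x) / 2 = x by ring] at this
  have hw := mul_sq_le_weighted (Real.abs_sin_le_one ((s + α) / 2)) (Real.abs_sin_le_one ((s - α) / 2)) hab
  rw [abs_cos_sub_cos_eq, abs_cos_sub_cos_eq]
  set D := Real.sin ((u + x) / 2) ^ 2 * Real.sin ((s - α) / 2) ^ 2
    + Real.sin ((u - x) / 2) ^ 2 * Real.sin ((s + α) / 2) ^ 2 with hD
  have hg : g α x s u = Real.sin x * Real.sin ((s - α) / 2) * Real.sin ((s + α) / 2) / D := by
    rw [g, hD, add_comm (Real.sin ((u + x) / 2) ^ 2 * _)]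
  set p := |Real.sin ((s + α) / 2)| with hp
  set m := |Real.sin ((s - α) / 2)| with hm
  set a := |Real.sin ((u + x) / 2)| with ha
  set b := |Real.sin ((u - x) / 2)| with hb
  set c := 1 - |Real.cos x| with hc
  have hD' : D = (a * m) ^ 2 + (b * p) ^ 2 := by
    rw [hD, hp, hm, ha, hb]; simp only [mul_pow, sq_abs]
  have hc0 : 0 ≤ c := by rw [hc]; linarith [Real.abs_cos_le_one x]
  have hD0 : 0 ≤ D := by rw [hD']; positivity
  rcases hD0.eq_or_lt with h0 | h0
  · rw [hg, ← h0]; norm_num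
  have hgD : |g α x s u| * D ≤ p * m := by
    rw [hg, abs_div, abs_of_pos h0, div_mul_cancel₀ _ h0.ne', abs_mul, abs_mul, mul_assoc, mul_comm p m]
    exact mul_le_of_le_one_left (by positivity) (Real.abs_sin_le_one _)
  have hpm0 : 0 ≤ p * m := by positivity
  rcases hpm0.eq_or_lt with h1 | h1
  · rw [← h1]; norm_num
  have e1 : |g α x s u| * (2 * (a * b)) ≤ 1 := by
    have : |g α x s u| * (2 * (a * b)) * (p * m) ≤ 1 * (p * m) := by
      rw [one_mul]
      refine le_trans ?_ hgD
      rw [mul_assoc]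
      refine mul_le_mul_of_nonneg_left ?_ (abs_nonneg _)
      rw [hD']
      nlinarith [sq_nonneg (a * m - b * p)]
    exact le_of_mul_le_mul_right this h1
  have e2 : c * |g α x s u| * (p * m) ≤ 1 := by
    have : c * |g α x s u| * (p * m) * (p * m) ≤ 1 * (p * m) := by
      rw [one_mul]
      refine le_trans ?_ hgD
      have := mul_le_mul_of_nonneg_left hw (abs_nonneg (g α x s u))
      refine le_trans (le_of_eq ?_) this
      ring
    exact le_of_mul_le_mul_right this h1
  rw [← sq_abs (g α x s u)]
  calc c * |g α x s u| ^ 2 * (2 * (a * b) * (2 * (p * m)))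
      = 2 * ((|g α x s u| * (2 * (a * b))) * (c * |g α x s u| * (p * m))) := by ring
    _ ≤ 2 * (1 * 1) := by gcongr
    _ = 2 := by norm_num

theorem sqrt_add_sq_le {a b : ℝ} (ha : 0 ≤ a) : Real.sqrt (a ^ 2 + b ^ 2) ≤ a + |b| := by
  rw [Real.sqrt_le_left (by positivity), ← sq_abs b]
  nlinarith [mul_nonneg ha (abs_nonneg b)]

theorem measurable_integrand (α x : ℝ) : Measurable (integrand α x) := by
  unfold integrand g
  fun_prop

theorem integrableOn_integrand {α x : ℝ} (hα : Real.sin α ≠ 0) (hx : Real.sin x ≠ 0) :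
    IntegrableOn (integrand α x) square := by
  have h := ((integrableOn_singularWeight hα hx).const_mul (Real.sqrt (2 / (1 - |Real.cos x|)))).add
    (integrable_const (1 : ℝ))
  refine h.mono' (measurable_integrand α x).aestronglyMeasurable ?_
  filter_upwards [ae_square_sin_ne_zero α x] with p hp
  have h1 := abs_le_mul_singularWeight (one_sub_abs_cos_pos hx) hp (mul_g_sq_mul_le α x p.1 p.2)
  rw [integrand, Real.norm_of_nonneg (Real.sqrt_nonneg _), ← one_pow 2]
  refine (sqrt_add_sq_le zero_le_one).trans ?_
  rw [abs_abs]
  simp only [Pi.add_apply]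
  linarith

/-! ### Spreading an integral over the square of position and phase -/

/-- The point of the real line with position `p.2 + c` in the cell of length `2π / n`
which contains `p.1`. -/
def cellPoint (n : ℕ) (c : ℝ) (p : ℝ × ℝ) : ℝ :=
  p.2 / n + (2 * Real.pi * (⌊n * p.1 / (2 * Real.pi)⌋ : ℝ) + c) / n

theorem measurable_cellPoint (n : ℕ) (c : ℝ) : Measurable (cellPoint n c) := by
  have h : Measurable fun p : ℝ × ℝ => ((⌊n * p.1 / (2 * Real.pi)⌋ : ℤ) : ℝ) :=
    (measurable_from_top (f := fun k : ℤ => (k : ℝ))).comp (Measurable.floor (by fun_prop))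
  unfold cellPoint
  fun_prop

theorem integral_comp_floor {n : ℕ} (hn : 1 ≤ n) (H : ℤ → ℝ)
    (hH : IntervalIntegrable (fun s : ℝ => H ⌊n * s / (2 * Real.pi)⌋) volume 0 (2 * Real.pi)) :
    ∫ s in (0 : ℝ)..(2 * Real.pi), H ⌊n * s / (2 * Real.pi)⌋
      = ∑ j ∈ Finset.range n, 2 * Real.pi / n * H j := by
  have hn0 : (0 : ℝ) < n := by positivity
  have hpi := Real.pi_pos
  set a : ℕ → ℝ := fun j => 2 * Real.pi / n * j with ha
  have hmono : Monotone a := fun i j hij => by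
    have : (i : ℝ) ≤ j := by exact_mod_cast hij
    simp only [ha]; gcongr
  have h0 : a 0 = 0 := by simp [ha]
  have hN : a n = 2 * Real.pi := by simp only [ha]; field_simp
  have hsum := intervalIntegral.sum_integral_adjacent_intervals (a := a) (n := n) (μ := volume)
    (f := fun s : ℝ => H ⌊n * s / (2 * Real.pi)⌋) (fun k hk => by
      refine hH.mono_set ?_
      rw [Set.uIcc_of_le (hmono k.le_succ), Set.uIcc_of_le (by positivity)]
      refine Set.Icc_subset_Icc ?_ ?_
      · rw [← h0]; exact hmono k.zero_le
      · rw [← hN]; exact hmono hk)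
  rw [h0, hN] at hsum
  rw [← hsum]
  refine Finset.sum_congr rfl fun j _ => ?_
  have hlt : a j ≤ a (j + 1) := hmono j.le_succ
  have : ∫ s in a j..a (j + 1), H ⌊n * s / (2 * Real.pi)⌋ = ∫ s in a j..a (j + 1), H j := by
    rw [intervalIntegral.integral_of_le hlt, intervalIntegral.integral_of_le hlt,
      ← integral_Ico_eq_integral_Ioc, ← integral_Ico_eq_integral_Ioc]
    refine setIntegral_congr_fun measurableSet_Ico fun s hs => ?_
    have : ⌊n * s / (2 * Real.pi)⌋ = (j : ℤ) := by
      rw [Int.floor_eq_iff]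
      have h1 := hs.1
      have h2 := hs.2
      simp only [ha] at h1 h2
      rw [div_mul_eq_mul_div, div_le_iff₀ hn0] at h1
      rw [div_mul_eq_mul_div, lt_div_iff₀ hn0] at h2
      push_cast at h2 ⊢
      constructor
      · rw [le_div_iff₀ (by positivity)]; linarith
      · rw [div_lt_iff₀ (by positivity)]; linarith
    simp only [this]
  rw [this, intervalIntegral.integral_const, smul_eq_mul]
  congr 1
  simp only [ha]
  push_cast
  ring

/-- The integral of a periodic function over a period, spread out over the square. -/
theorem integral_cellPoint {F : ℝ → ℝ} (hF : Measurable F) {M : ℝ} (hM : ∀ t, |F t| ≤ M)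
    (hper : Function.Periodic F (2 * Real.pi)) {n : ℕ} (hn : 1 ≤ n) (c : ℝ) :
    ∫ p in square, F (cellPoint n c p) = 2 * Real.pi * ∫ t in (0 : ℝ)..(2 * Real.pi), F t := by
  have hn0 : (0 : ℝ) < n := by positivity
  have hpi := Real.pi_pos
  have hFi : ∀ a b : ℝ, IntervalIntegrable F volume a b := fun a b =>
    (intervalIntegrable_const (c := M)).mono_fun hF.aestronglyMeasurable
      (ae_of_all _ fun t => (hM t).trans (le_abs_self M))
  have hint : Integrable (fun p => F (cellPoint n c p)) (volume.restrict square) :=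
    (integrable_const M).mono' (hF.comp (measurable_cellPoint n c)).aestronglyMeasurable
      (ae_of_all _ fun p => hM _)
  rw [volume_restrict_square] at hint ⊢
  rw [integral_prod _ hint]
  have hleft := hint.integral_prod_left
  set H : ℤ → ℝ := fun j => ∫ u in (0 : ℝ)..(2 * Real.pi), F (u / n + (2 * Real.pi * j + c) / n) with hH
  have hinner : ∀ s : ℝ, ∫ u in Set.Icc 0 (2 * Real.pi), F (cellPoint n c (s, u))
      = H ⌊n * s / (2 * Real.pi)⌋ := by
    intro s
    rw [integral_Icc_eq_integral_Ioc, hH]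
    simp only
    rw [intervalIntegral.integral_of_le (by positivity)]
    rfl
  simp only [hinner] at hleft ⊢
  have hHi : IntervalIntegrable (fun s : ℝ => H ⌊n * s / (2 * Real.pi)⌋) volume 0 (2 * Real.pi) := by
    rw [intervalIntegrable_iff_integrableOn_Ioc_of_le (by positivity),
      ← integrableOn_Icc_iff_integrableOn_Ioc]
    exact hleft
  rw [integral_Icc_eq_integral_Ioc, ← intervalIntegral.integral_of_le (by positivity),
    integral_comp_floor hn H hHi]
  -- Each inner integral is `n` times the integral of `F` over one cell shifted by `c / n`. The `n`
  -- cells fill a shifted period, and periodicity removes the shift.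
  have hHj : ∀ j : ℕ, H j = n * ∫ t in (2 * Real.pi * j + c) / n..(2 * Real.pi * (j + 1 : ℕ) + c) / n, F t := by
    intro j
    simp only [hH]
    rw [intervalIntegral.integral_comp_div_add F hn0.ne', smul_eq_mul]
    congr 2
    · push_cast; ring
    · push_cast; ring
  have hsum := intervalIntegral.sum_integral_adjacent_intervals (μ := volume) (f := F)
    (a := fun j : ℕ => (2 * Real.pi * j + c) / n) (n := n) (fun k _ => hFi _ _)
  calc ∑ j ∈ Finset.range n, 2 * Real.pi / n * H j
      = 2 * Real.pi * ∑ j ∈ Finset.range n,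
        ∫ t in (2 * Real.pi * j + c) / n..(2 * Real.pi * (j + 1 : ℕ) + c) / n, F t := by
        rw [Finset.mul_sum]
        refine Finset.sum_congr rfl fun j _ => ?_
        rw [hHj]
        field_simp
    _ = 2 * Real.pi * ∫ t in (0 : ℝ)..(2 * Real.pi), F t := by
        rw [hsum]
        congr 1
        have := hper.intervalIntegral_add_eq (c / n) 0
        rw [zero_add] at this
        rw [← this]
        congr 1
        · simp
        · field_simp; ring

/-- The constant `5π` is a crude sum: `2π` for the phase, `2π` for rounding down to the cell, `π`
for the shift `c`. -/
theorem abs_cellPoint_sub_le {n : ℕ} (hn : 1 ≤ n) {c : ℝ} (hc0 : 0 ≤ c) (hc : c ≤ Real.pi) {p : ℝ × ℝ}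
    (hp : p ∈ square) : |cellPoint n c p - p.1| ≤ 5 * Real.pi / n := by
  have hn0 : (0 : ℝ) < n := by positivity
  have hpi := Real.pi_pos
  have h1 := Int.floor_le (n * p.1 / (2 * Real.pi))
  have h2 := Int.lt_floor_add_one (n * p.1 / (2 * Real.pi))
  rw [le_div_iff₀ (by positivity)] at h1
  rw [div_lt_iff₀ (by positivity)] at h2
  have hu := hp.2
  set j : ℝ := (⌊n * p.1 / (2 * Real.pi)⌋ : ℝ) with hj
  have e : cellPoint n c p - p.1 = (p.2 + (2 * Real.pi * j + c) - n * p.1) / n := by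
    rw [cellPoint, ← hj]; field_simp
  rw [e, abs_div, abs_of_pos hn0]
  gcongr
  rw [abs_le]
  constructor <;> nlinarith [hu.1, hu.2]

theorem rotation_periodic (n : ℕ) (α : ℝ) : Function.Periodic (rotation n α) (2 * Real.pi) := by
  intro t
  have h1 : ∀ y : ℝ, Real.sin ((t + 2 * Real.pi + y) / 2) = -Real.sin ((t + y) / 2) := fun y => by
    rw [← Real.sin_add_pi]; congr 1; ring
  have h2 : ∀ y : ℝ, Real.sin (n * ((t + 2 * Real.pi + y) / 2)) = (-1) ^ n * Real.sin (n * ((t + y) / 2)) :=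
    fun y => by rw [← Real.sin_add_nat_mul_pi]; congr 1; ring
  have h3 : ((-1 : ℝ) ^ n) ^ 2 = 1 := by rw [← pow_mul, mul_comm, pow_mul]; norm_num
  rw [rotation, rotation]
  simp only [sub_eq_add_neg _ α, h1, h2, mul_pow, h3]
  congr 1
  · linear_combination (-(1 / (n : ℝ) * Real.sin α * Real.sin (n * ((t + α) / 2))
      * Real.sin (n * ((t + -α) / 2)))) * h3
  · ring

theorem measurable_rotation (n : ℕ) (α : ℝ) : Measurable (rotation n α) := by
  unfold rotation; fun_prop

theorem measurable_speed (n : ℕ) (α : ℝ) : Measurable (speed n α) := by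
  have := measurable_rotation n α
  unfold speed; fun_prop

theorem speed_periodic (n : ℕ) (α : ℝ) : Function.Periodic (speed n α) (2 * Real.pi) := fun t => by
  rw [speed, speed, rotation_periodic n α t]

theorem exists_speed_le {n : ℕ} (hn : 1 ≤ n) {α : ℝ} (h : Real.sin (n * α) ≠ 0) :
    ∃ M, ∀ t, |speed n α t| ≤ M := by
  have hc := one_sub_abs_cos_pos h
  refine ⟨((n : ℝ) + 1) / 2 + n / 2 * (3 / 2 * n / (1 - |Real.cos (n * α)|)), fun t => ?_⟩
  rw [speed, abs_of_nonneg (Real.sqrt_nonneg _)]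
  refine (sqrt_add_sq_le (by positivity)).trans ?_
  rw [abs_mul, abs_of_nonneg (by positivity : (0 : ℝ) ≤ n / 2)]
  gcongr
  rw [le_div_iff₀ hc, mul_comm]
  exact mul_abs_rotation_le hn hc.le le_rfl

/-- The identity is exact for every shift `c`, so `c` may later depend on `n`. -/
theorem toReal_lintegral_numZeros_gaussianPoly {n : ℕ} (hn : 1 ≤ n) {α : ℝ}
    (h : Real.sin (n * α) ≠ 0) (c : ℝ) :
    (∫⁻ U, ((numZeros (gaussianPoly n α U) : ℕ∞) : ℝ≥0∞)
        ∂(Measure.pi fun _ : Fin 4 => gaussianReal 0 1)).toReal / n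
      = 1 / (4 * Real.pi ^ 2) * ∫ p in square,
        Real.sqrt ((((n : ℝ) + 1) / n) ^ 2 + rotation n α (cellPoint n c p) ^ 2) := by
  have hn0 : (0 : ℝ) < n := by positivity
  have hpi := Real.pi_pos
  obtain ⟨M, hM⟩ := exists_speed_le hn h
  have e1 : ∀ t, Real.sqrt ((((n : ℝ) + 1) / n) ^ 2 + rotation n α t ^ 2) = 2 / n * speed n α t := by
    intro t
    rw [speed, ← Real.sqrt_sq (by positivity : (0 : ℝ) ≤ 2 / n), ← Real.sqrt_mul (by positivity)]
    congr 1
    field_simp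
  simp only [e1]
  rw [integral_const_mul, integral_cellPoint (measurable_speed n α) hM (speed_periodic n α) hn c,
    lintegral_numZeros_gaussianPoly hn h, ← integral_eq_lintegral_of_nonneg_ae
      (f := fun t => Real.pi⁻¹ * speed n α t)
      (ae_of_all _ fun t => mul_nonneg (by positivity) (Real.sqrt_nonneg _))
      ((measurable_speed n α).const_mul _).aestronglyMeasurable, integral_const_mul,
    integral_Icc_eq_integral_Ioc, ← intervalIntegral.integral_of_le (by positivity)]
  field_simp
  ring

/-! ### The limit along a residue class -/

theorem abs_sin_add_int_mul_pi (y : ℝ) (k : ℤ) : |Real.sin (y + k * Real.pi)| = |Real.sin y| := by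
  rw [Real.sin_add_int_mul_pi, abs_mul, abs_zpow, abs_neg, abs_one, one_zpow, one_mul]

theorem abs_cos_add_int_mul_pi (y : ℝ) (k : ℤ) : |Real.cos (y + k * Real.pi)| = |Real.cos y| := by
  rw [Real.cos_add_int_mul_pi, abs_mul, abs_zpow, abs_neg, abs_one, one_zpow, one_mul]

section

variable {n : ℕ} {α x : ℝ} {k : ℤ}

/-- The shift `(k % 2) π` corrects the parity of `k`: since `k + k % 2` is even, half of `n t + n α`
is `(u + x) / 2` up to a multiple of `π`. The fast phase is thus exact, not merely asymptotic. -/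
theorem abs_sin_cellPoint_add (hn : 1 ≤ n) (hk : n * α = x + k * Real.pi) (p : ℝ × ℝ) :
    |Real.sin (n * ((cellPoint n ((k % 2 : ℤ) * Real.pi) p + α) / 2))|
      = |Real.sin ((p.2 + x) / 2)| := by
  have hn0 : (0 : ℝ) < n := by positivity
  have h2 : (k : ℝ) = 2 * (k / 2 : ℤ) + (k % 2 : ℤ) := by
    exact_mod_cast (Int.mul_ediv_add_emod k 2).symm
  rw [← abs_sin_add_int_mul_pi ((p.2 + x) / 2) (⌊n * p.1 / (2 * Real.pi)⌋ + k / 2 + k % 2)]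
  congr 2
  have e : n * ((cellPoint n ((k % 2 : ℤ) * Real.pi) p + α) / 2)
      = (n * cellPoint n ((k % 2 : ℤ) * Real.pi) p + n * α) / 2 := by ring
  have e' : n * cellPoint n ((k % 2 : ℤ) * Real.pi) p
      = p.2 + (2 * Real.pi * (⌊n * p.1 / (2 * Real.pi)⌋ : ℝ) + (k % 2 : ℤ) * Real.pi) := by
    rw [cellPoint]; field_simp
  rw [e, e', hk]
  push_cast
  linear_combination (Real.pi / 2) * h2

theorem abs_sin_cellPoint_sub (hn : 1 ≤ n) (hk : n * α = x + k * Real.pi) (p : ℝ × ℝ) :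
    |Real.sin (n * ((cellPoint n ((k % 2 : ℤ) * Real.pi) p - α) / 2))|
      = |Real.sin ((p.2 - x) / 2)| := by
  have hn0 : (0 : ℝ) < n := by positivity
  have h2 : (k : ℝ) = 2 * (k / 2 : ℤ) + (k % 2 : ℤ) := by
    exact_mod_cast (Int.mul_ediv_add_emod k 2).symm
  rw [← abs_sin_add_int_mul_pi ((p.2 - x) / 2) (⌊n * p.1 / (2 * Real.pi)⌋ - k / 2)]
  congr 2
  have e : n * ((cellPoint n ((k % 2 : ℤ) * Real.pi) p - α) / 2)
      = (n * cellPoint n ((k % 2 : ℤ) * Real.pi) p - n * α) / 2 := by ring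
  have e' : n * cellPoint n ((k % 2 : ℤ) * Real.pi) p
      = p.2 + (2 * Real.pi * (⌊n * p.1 / (2 * Real.pi)⌋ : ℝ) + (k % 2 : ℤ) * Real.pi) := by
    rw [cellPoint]; field_simp
  rw [e, e', hk]
  push_cast
  linear_combination (-Real.pi / 2) * h2

/-- Squaring removes the sign `(-1) ^ k` of `sin (n α)` relative to `sin x`. The remainder `r` is
the term of the numerator carrying `1 / n`. -/
theorem exists_rotation_cellPoint_sq (hn : 1 ≤ n) (hk : n * α = x + k * Real.pi) (p : ℝ × ℝ) :
    ∃ r : ℝ, |r| ≤ 1 / n ∧ rotation n α (cellPoint n ((k % 2 : ℤ) * Real.pi) p) ^ 2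
      = ((Real.sin x * Real.sin ((cellPoint n ((k % 2 : ℤ) * Real.pi) p - α) / 2)
          * Real.sin ((cellPoint n ((k % 2 : ℤ) * Real.pi) p + α) / 2) - r)
        / (Real.sin ((p.2 - x) / 2) ^ 2
            * Real.sin ((cellPoint n ((k % 2 : ℤ) * Real.pi) p + α) / 2) ^ 2
          + Real.sin ((p.2 + x) / 2) ^ 2
            * Real.sin ((cellPoint n ((k % 2 : ℤ) * Real.pi) p - α) / 2) ^ 2)) ^ 2 := by
  have hA := abs_sin_cellPoint_add hn hk p
  have hS := abs_sin_cellPoint_sub hn hk p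
  set τ := cellPoint n ((k % 2 : ℤ) * Real.pi) p with hτ
  set σ : ℝ := (-1) ^ k with hσ
  have hσ2 : σ ^ 2 = 1 := by rw [← sq_abs, hσ, abs_zpow, abs_neg, abs_one, one_zpow, one_pow]
  have hσ1 : |σ| = 1 := by rw [hσ, abs_zpow, abs_neg, abs_one, one_zpow]
  refine ⟨σ * (1 / n * Real.sin α * Real.sin (n * ((τ + α) / 2)) * Real.sin (n * ((τ - α) / 2))), ?_, ?_⟩
  · rw [abs_mul, hσ1, one_mul, abs_mul, abs_mul, abs_mul,
      abs_of_nonneg (by positivity : (0 : ℝ) ≤ 1 / n)]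
    have h1 := Real.abs_sin_le_one α
    have h2 := Real.abs_sin_le_one (n * ((τ + α) / 2))
    have h3 := Real.abs_sin_le_one (n * ((τ - α) / 2))
    calc 1 / (n : ℝ) * |Real.sin α| * |Real.sin (n * ((τ + α) / 2))| * |Real.sin (n * ((τ - α) / 2))|
        ≤ 1 / (n : ℝ) * 1 * 1 * 1 := by gcongr
      _ = 1 / n := by ring
  · rw [← sq_abs (Real.sin ((p.2 + x) / 2)), ← sq_abs (Real.sin ((p.2 - x) / 2)), ← hA, ← hS, sq_abs,
      sq_abs, rotation, hk, Real.sin_add_int_mul_pi, ← hσ, div_pow, div_pow]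
    congr 1
    · linear_combination (Real.sin x ^ 2 * Real.sin ((τ + α) / 2) ^ 2 * Real.sin ((τ - α) / 2) ^ 2
        - (1 / n * Real.sin α * Real.sin (n * ((τ + α) / 2)) * Real.sin (n * ((τ - α) / 2))) ^ 2) * hσ2
    · ring

theorem mul_rotation_cellPoint_sq_mul_le (hn : 1 ≤ n) (hk : n * α = x + k * Real.pi) {p : ℝ × ℝ}
    (hp : p ∈ square) :
    (1 - |Real.cos x|) * rotation n α (cellPoint n ((k % 2 : ℤ) * Real.pi) p) ^ 2 *
      (|Real.cos x - Real.cos p.2| * |Real.cos α - Real.cos p.1|)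
      ≤ 3 * (6 + 3 / 2 * (5 * Real.pi)) := by
  have hpi := Real.pi_pos
  have hε : (0 : ℝ) ≤ (k % 2 : ℤ) ∧ ((k % 2 : ℤ) : ℝ) ≤ 1 := by
    have h1 : 0 ≤ k % 2 := by omega
    have h2 : k % 2 ≤ 1 := by omega
    exact ⟨by exact_mod_cast h1, by exact_mod_cast h2⟩
  have hA := abs_sin_cellPoint_add hn hk p
  have hS := abs_sin_cellPoint_sub hn hk p
  have hd := abs_cellPoint_sub_le (c := (k % 2 : ℤ) * Real.pi) hn (by nlinarith [hε.1]) (by nlinarith [hε.2]) hp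
  set τ := cellPoint n ((k % 2 : ℤ) * Real.pi) p with hτ
  have e1 : |Real.cos x - Real.cos p.2| = |Real.cos (n * α) - Real.cos (n * τ)| := by
    rw [abs_cos_sub_cos_eq, abs_cos_sub_cos_eq, ← hA, ← hS]
    congr 4 <;> ring_nf
  have hc : 1 - |Real.cos x| ≤ 1 - |Real.cos (n * α)| := by
    rw [hk, abs_cos_add_int_mul_pi]
  rw [e1]
  exact mul_rotation_sq_mul_le hn (by linarith [Real.abs_cos_le_one x]) hc hd

end

/-- Dominated convergence: the cell point tends to `p.1`, the remainder to `0`, and the denominator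
to a nonzero limit for almost every `p`. The filter `l` is later `atTop` restricted to a residue
class. -/
theorem tendsto_integral_rotation_cellPoint {α x : ℝ} (hα : Real.sin α ≠ 0) (hx : Real.sin x ≠ 0)
    {l : Filter ℕ} [l.IsCountablyGenerated] (hl : l ≤ atTop) {k : ℕ → ℤ}
    (hk : ∀ᶠ n in l, n * α = x + k n * Real.pi) :
    Tendsto (fun n : ℕ => ∫ p in square, Real.sqrt ((((n : ℝ) + 1) / n) ^ 2
        + rotation n α (cellPoint n ((k n % 2 : ℤ) * Real.pi) p) ^ 2)) l
      (𝓝 (∫ p in square, integrand α x p)) := by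
  have hpi := Real.pi_pos
  have hinv : Tendsto (fun n : ℕ => 1 / (n : ℝ)) l (𝓝 0) :=
    tendsto_one_div_atTop_nhds_zero_nat.mono_left hl
  have hn1 : ∀ᶠ n in l, 1 ≤ n := hl (eventually_ge_atTop 1)
  have hmem : ∀ᵐ p ∂((volume : Measure (ℝ × ℝ)).restrict square), p ∈ square :=
    ae_restrict_mem (measurableSet_Icc.prod measurableSet_Icc)
  set C : ℝ := Real.sqrt (3 * (6 + 3 / 2 * (5 * Real.pi)) / (1 - |Real.cos x|)) with hC
  refine tendsto_integral_filter_of_dominated_convergence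
    (fun p => 2 + C * singularWeight α x p) ?_ ?_ ?_ ?_
  · refine Eventually.of_forall fun n => Measurable.aestronglyMeasurable ?_
    have := (measurable_rotation n α).comp (measurable_cellPoint n ((k n % 2 : ℤ) * Real.pi))
    simp only [Function.comp_def] at this
    fun_prop
  · filter_upwards [hk, hn1] with n hkn hn
    have hn0 : (0 : ℝ) < n := by positivity
    filter_upwards [ae_square_sin_ne_zero α x, hmem] with p hp hps
    rw [Real.norm_of_nonneg (Real.sqrt_nonneg _)]
    refine (sqrt_add_sq_le (by positivity)).trans (add_le_add ?_ ?_)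
    · rw [div_le_iff₀ hn0]
      have : (1 : ℝ) ≤ n := by exact_mod_cast hn
      linarith
    · exact abs_le_mul_singularWeight (one_sub_abs_cos_pos hx) hp
        (mul_rotation_cellPoint_sq_mul_le hn hkn hps)
  · exact (integrable_const 2).add ((integrableOn_singularWeight hα hx).const_mul C)
  · filter_upwards [ae_square_sin_ne_zero α x, hmem] with p hp hps
    have hτ : Tendsto (fun n : ℕ => cellPoint n ((k n % 2 : ℤ) * Real.pi) p) l (𝓝 p.1) := by
      rw [tendsto_iff_norm_sub_tendsto_zero]
      have h0 : Tendsto (fun n : ℕ => 5 * Real.pi / (n : ℝ)) l (𝓝 0) := by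
        have := hinv.const_mul (5 * Real.pi)
        simpa [div_eq_mul_inv] using this
      refine squeeze_zero' (Eventually.of_forall fun n => norm_nonneg _) ?_ h0
      filter_upwards [hn1] with n hn
      have h1 : (0 : ℝ) ≤ (k n % 2 : ℤ) := by
        have : 0 ≤ k n % 2 := by omega
        exact_mod_cast this
      have h2 : ((k n % 2 : ℤ) : ℝ) ≤ 1 := by
        have : k n % 2 ≤ 1 := by omega
        exact_mod_cast this
      exact abs_cellPoint_sub_le hn (by nlinarith) (by nlinarith) hps
    -- The remainder is made a sequence over all `n`, with the dummy value `0` off the residue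
    -- class, which `l` ignores.
    have hr : ∀ n : ℕ, ∃ r : ℝ, (1 ≤ n ∧ n * α = x + k n * Real.pi) → (|r| ≤ 1 / n ∧
        rotation n α (cellPoint n ((k n % 2 : ℤ) * Real.pi) p) ^ 2
      = ((Real.sin x * Real.sin ((cellPoint n ((k n % 2 : ℤ) * Real.pi) p - α) / 2)
          * Real.sin ((cellPoint n ((k n % 2 : ℤ) * Real.pi) p + α) / 2) - r)
        / (Real.sin ((p.2 - x) / 2) ^ 2
            * Real.sin ((cellPoint n ((k n % 2 : ℤ) * Real.pi) p + α) / 2) ^ 2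
          + Real.sin ((p.2 + x) / 2) ^ 2
            * Real.sin ((cellPoint n ((k n % 2 : ℤ) * Real.pi) p - α) / 2) ^ 2)) ^ 2) := by
      intro n
      by_cases h : 1 ≤ n ∧ n * α = x + k n * Real.pi
      · obtain ⟨r, hr⟩ := exists_rotation_cellPoint_sq h.1 h.2 p
        exact ⟨r, fun _ => hr⟩
      · exact ⟨0, fun h' => absurd h' h⟩
    choose r hr using hr
    have hr0 : Tendsto r l (𝓝 0) := by
      rw [tendsto_zero_iff_norm_tendsto_zero]
      refine squeeze_zero' (Eventually.of_forall fun n => norm_nonneg _) ?_ hinv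
      filter_upwards [hn1, hk] with n h1 h2
      exact (hr n ⟨h1, h2⟩).1
    have hsin : ∀ y : ℝ, Tendsto (fun n : ℕ => Real.sin ((cellPoint n ((k n % 2 : ℤ) * Real.pi) p + y) / 2)) l
        (𝓝 (Real.sin ((p.1 + y) / 2))) := fun y =>
      (Real.continuous_sin.tendsto _).comp ((hτ.add_const y).div_const 2)
    have hplus := hsin α
    have hminus := hsin (-α)
    simp only [← sub_eq_add_neg] at hminus
    have hD : Real.sin ((p.2 - x) / 2) ^ 2 * Real.sin ((p.1 + α) / 2) ^ 2
        + Real.sin ((p.2 + x) / 2) ^ 2 * Real.sin ((p.1 - α) / 2) ^ 2 ≠ 0 := by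
      have h1 := hp.1.1
      have h2 := hp.2.2
      have : 0 < Real.sin ((p.2 - x) / 2) ^ 2 * Real.sin ((p.1 + α) / 2) ^ 2 := by positivity
      positivity
    have hlim := (((((hminus.const_mul (Real.sin x)).mul hplus).sub hr0).div
      (((hplus.pow 2).const_mul (Real.sin ((p.2 - x) / 2) ^ 2)).add
        ((hminus.pow 2).const_mul (Real.sin ((p.2 + x) / 2) ^ 2))) hD).pow 2)
    have hone : Tendsto (fun n : ℕ => (((n : ℝ) + 1) / n) ^ 2) l (𝓝 1) := by
      have h1 : Tendsto (fun n : ℕ => (1 + 1 / (n : ℝ)) ^ 2) l (𝓝 ((1 + 0) ^ 2)) :=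
        (hinv.const_add 1).pow 2
      rw [add_zero, one_pow] at h1
      refine h1.congr' ?_
      filter_upwards [hn1] with n hn
      have hn0 : (0 : ℝ) < n := by positivity
      field_simp
    have hfin := (hone.add hlim).sqrt
    rw [sub_zero] at hfin
    have e : Real.sqrt (1 + (Real.sin x * Real.sin ((p.1 - α) / 2) * Real.sin ((p.1 + α) / 2)
        / (Real.sin ((p.2 - x) / 2) ^ 2 * Real.sin ((p.1 + α) / 2) ^ 2
        + Real.sin ((p.2 + x) / 2) ^ 2 * Real.sin ((p.1 - α) / 2) ^ 2)) ^ 2) = integrand α x p := by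
      rw [integrand, sq_abs, g]
    rw [e] at hfin
    refine hfin.congr' ?_
    filter_upwards [hn1, hk] with n h1 h2
    rw [(hr n ⟨h1, h2⟩).2, Pi.div_apply]

theorem sin_modPi_eq_zero_iff (y : ℝ) : Real.sin (modPi y) = 0 ↔ modPi y = 0 := by
  have h := toIcoMod_mem_Ico Real.pi_pos 0 y
  rw [zero_add] at h
  refine ⟨fun h0 => ?_, fun h0 => by rw [h0, Real.sin_zero]⟩
  by_contra hne
  exact (Real.sin_pos_of_pos_of_lt_pi (lt_of_le_of_ne h.1 (Ne.symm hne)) h.2).ne' h0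

theorem eq_modPi_add (y : ℝ) : y = modPi y + toIcoDiv Real.pi_pos 0 y * Real.pi := by
  have := toIcoMod_add_toIcoDiv_zsmul Real.pi_pos 0 y
  rw [zsmul_eq_mul] at this
  exact this.symm

/-- The second claim follows from the first through `|sin (n α)| ≤ n |sin α|`. -/
theorem sin_ne_zero_of_mem_residues {α x : ℝ} (hx : x ∈ residues α \ {0}) :
    Real.sin x ≠ 0 ∧ Real.sin α ≠ 0 := by
  obtain ⟨⟨n, hn, rfl⟩, h0⟩ := hx
  have h1 : Real.sin (modPi (n * α)) ≠ 0 := fun h => h0 ((sin_modPi_eq_zero_iff _).1 h)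
  refine ⟨h1, fun h => h1 ?_⟩
  have h2 : |Real.sin (n * α)| ≤ 0 := by
    have := abs_sin_natCast_mul_le n α
    rwa [h, abs_zero, mul_zero] at this
  rw [eq_modPi_add (n * α), abs_sin_add_int_mul_pi] at h2
  exact abs_nonpos_iff.1 h2

section

variable {Ω : Type*} [MeasurableSpace Ω] {P : Measure Ω} [IsProbabilityMeasure P]

theorem tendsto_expectedZeros_div {α x : ℝ} {a b : ℕ+ → Ω → ℝ} (hab : IsCosineCorrelatedPair P α a b)
    (hx : x ∈ residues α \ {0}) :
    Tendsto (fun n : ℕ => (expectedZeros P a b n).toReal / n)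
      (atTop ⊓ 𝓟 {n : ℕ | modPi (n * α) = x}) (𝓝 (ell α x)) := by
  obtain ⟨hsx, hsα⟩ := sin_ne_zero_of_mem_residues hx
  have hmem : ∀ᶠ n : ℕ in atTop ⊓ 𝓟 {n : ℕ | modPi (n * α) = x}, modPi (n * α) = x :=
    mem_inf_of_right (mem_principal_self _)
  have hk : ∀ᶠ n : ℕ in atTop ⊓ 𝓟 {n : ℕ | modPi (n * α) = x},
      n * α = x + toIcoDiv Real.pi_pos 0 (n * α) * Real.pi := by
    filter_upwards [hmem] with n hn
    have := eq_modPi_add (n * α)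
    rwa [hn] at this
  have h := (tendsto_integral_rotation_cellPoint hsα hsx inf_le_left hk).const_mul
    (1 / (4 * Real.pi ^ 2))
  refine h.congr' ?_
  filter_upwards [hk, mem_inf_of_left (eventually_ge_atTop 1)] with n hkn hn
  have hs : Real.sin (n * α) ≠ 0 := by
    rw [hkn, ← abs_ne_zero, abs_sin_add_int_mul_pi, abs_ne_zero]
    exact hsx
  rw [expectedZeros_eq_lintegral hsα hab hn]
  exact (toReal_lintegral_numZeros_gaussianPoly hn hs _).symm

theorem tendsto_indicator_expectedZeros {α x : ℝ} {a b : ℕ+ → Ω → ℝ}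
    (hab : IsCosineCorrelatedPair P α a b) (hx : x ∈ residues α \ {0}) :
    Tendsto ({n : ℕ | modPi (n * α) = x}.indicator fun n : ℕ =>
          |(expectedZeros P a b n).toReal / n - ell α x|) atTop (𝓝 0) := by
  have h := tendsto_iff_norm_sub_tendsto_zero.1 (tendsto_expectedZeros_div hab hx)
  rw [Metric.tendsto_nhds] at h ⊢
  intro ε hε
  filter_upwards [eventually_inf_principal.1 (h ε hε)] with n hn
  by_cases hm : n ∈ {n : ℕ | modPi (n * α) = x}
  · rw [Set.indicator_of_mem hm]
    exact hn hm
  · rw [Set.indicator_of_notMem hm, dist_self]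
    exact hε

end

/-! ### The Poisson kernel and the bound `ℓ < 2` -/

theorem g_denom_pos {α x s : ℝ} (hx : Real.sin x ≠ 0) (hp : Real.sin ((s + α) / 2) ≠ 0)
    (hm : Real.sin ((s - α) / 2) ≠ 0) (u : ℝ) :
    0 < Real.sin ((u - x) / 2) ^ 2 * Real.sin ((s + α) / 2) ^ 2 +
      Real.sin ((u + x) / 2) ^ 2 * Real.sin ((s - α) / 2) ^ 2 := by
  by_cases h : Real.sin ((u - x) / 2) = 0
  · have h' : Real.sin ((u + x) / 2) ≠ 0 := by
      intro h'
      apply hx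
      rw [show x = (u + x) / 2 - (u - x) / 2 by ring, Real.sin_sub, h, h']
      ring
    positivity
  · positivity

theorem abs_g_eq_div {α x s : ℝ} (hx : Real.sin x ≠ 0) (hp : Real.sin ((s + α) / 2) ≠ 0)
    (hm : Real.sin ((s - α) / 2) ≠ 0) (u : ℝ) :
    |g α x s u| = |Real.sin x * Real.sin ((s - α) / 2) * Real.sin ((s + α) / 2)| /
      (Real.sin ((u - x) / 2) ^ 2 * Real.sin ((s + α) / 2) ^ 2 +
        Real.sin ((u + x) / 2) ^ 2 * Real.sin ((s - α) / 2) ^ 2) := by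
  rw [g, abs_div, abs_of_pos (g_denom_pos hx hp hm u)]

theorem continuous_abs_g {α x s : ℝ} (hx : Real.sin x ≠ 0) (hp : Real.sin ((s + α) / 2) ≠ 0)
    (hm : Real.sin ((s - α) / 2) ≠ 0) : Continuous fun u => |g α x s u| := by
  simp only [abs_g_eq_div hx hp hm]
  exact continuous_const.div (by fun_prop) fun u => (g_denom_pos hx hp hm u).ne'

theorem g_periodic (α x s : ℝ) : Function.Periodic (fun u => |g α x s u|) (2 * Real.pi) := by
  intro u
  have h : ∀ y : ℝ, Real.sin ((u + 2 * Real.pi + y) / 2) = -Real.sin ((u + y) / 2) := fun y => by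
    rw [← Real.sin_add_pi]; congr 1; ring
  simp only [g, sub_eq_add_neg _ x, h, neg_sq]

/-- The integral of the Poisson kernel over a period. -/
theorem integral_abs_g {α x s : ℝ} (hx : Real.sin x ≠ 0) (hp : Real.sin ((s + α) / 2) ≠ 0)
    (hm : Real.sin ((s - α) / 2) ≠ 0) :
    ∫ u in Set.Icc 0 (2 * Real.pi), |g α x s u| = 2 * Real.pi := by
  have hpi := Real.pi_pos
  have hcont := continuous_abs_g hx hp hm
  rw [integral_Icc_eq_integral_Ioc, ← intervalIntegral.integral_of_le (by positivity)]
  have hsh := (g_periodic α x s).intervalIntegral_add_eq 0 (-Real.pi)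
  rw [zero_add, show -Real.pi + 2 * Real.pi = Real.pi by ring] at hsh
  rw [hsh]
  set Δ := |Real.sin x * Real.sin ((s - α) / 2) * Real.sin ((s + α) / 2)| with hΔ
  have hΔ0 : 0 < Δ := abs_pos.2 (mul_ne_zero (mul_ne_zero hx hm) hp)
  set p := Real.sin ((s + α) / 2) with hpdef
  set m := Real.sin ((s - α) / 2) with hmdef
  have hsx : Real.sin x = 2 * Real.sin (x / 2) * Real.cos (x / 2) := by
    rw [← Real.sin_two_mul]; congr 1; ring
  have hcy : Real.cos (x / 2) ≠ 0 := by
    intro h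
    apply hx
    rw [hsx, h, mul_zero]
  -- Divided by `cos² (u / 2)`, the denominator of `g` is a quadratic in `tan (u / 2)` with leading
  -- coefficient `A` and linear coefficient `-2 B`. Completing the square leaves `Δ²`, whence the
  -- arctangent primitive, which gains `2π` over `(-π, π)`.
  set A := (p ^ 2 + m ^ 2) * Real.cos (x / 2) ^ 2 with hA
  set B := (p ^ 2 - m ^ 2) * Real.sin (x / 2) * Real.cos (x / 2) with hB
  have hA0 : 0 < A := by positivity
  have hderiv : ∀ u ∈ Set.Ioo (-Real.pi) Real.pi,
      HasDerivAt (fun u => 2 * Real.arctan ((A * Real.tan (u / 2) - B) / Δ)) |g α x s u| u := by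
    intro u hu
    have hc : 0 < Real.cos (u / 2) := Real.cos_pos_of_mem_Ioo ⟨by linarith [hu.1], by linarith [hu.2]⟩
    have h1 : HasDerivAt (fun u : ℝ => Real.tan (u / 2)) (1 / Real.cos (u / 2) ^ 2 * (1 / 2)) u :=
      HasDerivAt.comp u (h := fun u : ℝ => u / 2) (Real.hasDerivAt_tan hc.ne')
        ((hasDerivAt_id u).div_const 2)
    have h2 := ((((h1.const_mul A).sub_const B).div_const Δ).arctan).const_mul 2
    refine h2.congr_deriv (Eq.symm ?_)
    rw [abs_g_eq_div hx hp hm, ← hΔ]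
    have hD := g_denom_pos hx hp hm u
    have hkey : A * (Real.sin ((u - x) / 2) ^ 2 * p ^ 2 + Real.sin ((u + x) / 2) ^ 2 * m ^ 2)
        = Δ ^ 2 * Real.cos (u / 2) ^ 2 + (A * Real.sin (u / 2) - B * Real.cos (u / 2)) ^ 2 := by
      rw [hΔ, sq_abs, hsx, sub_div, add_div, Real.sin_sub, Real.sin_add, hA, hB]
      ring
    have hpos : 0 < Δ ^ 2 * Real.cos (u / 2) ^ 2
        + (A * Real.sin (u / 2) - B * Real.cos (u / 2)) ^ 2 := by positivity
    have hval : Δ / (Real.sin ((u - x) / 2) ^ 2 * p ^ 2 + Real.sin ((u + x) / 2) ^ 2 * m ^ 2)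
        = A * Δ / (Δ ^ 2 * Real.cos (u / 2) ^ 2
          + (A * Real.sin (u / 2) - B * Real.cos (u / 2)) ^ 2) := by
      rw [← hkey, mul_div_mul_left _ _ hA0.ne']
    rw [hval, Real.tan_eq_sin_div_cos]
    have hne : 1 + ((A * (Real.sin (u / 2) / Real.cos (u / 2)) - B) / Δ) ^ 2
        = (Δ ^ 2 * Real.cos (u / 2) ^ 2 + (A * Real.sin (u / 2) - B * Real.cos (u / 2)) ^ 2)
          / (Δ ^ 2 * Real.cos (u / 2) ^ 2) := by
      field_simp
    rw [hne]
    field_simp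
  have hhalf : Tendsto (fun u : ℝ => u / 2) (𝓝[<] Real.pi) (𝓝[<] (Real.pi / 2)) := by
    refine tendsto_nhdsWithin_iff.2 ⟨(tendsto_id.div_const 2).mono_left nhdsWithin_le_nhds, ?_⟩
    filter_upwards [self_mem_nhdsWithin] with u hu
    have : u < Real.pi := hu
    change u / 2 < Real.pi / 2
    linarith
  have hhalf' : Tendsto (fun u : ℝ => u / 2) (𝓝[>] (-Real.pi)) (𝓝[>] (-(Real.pi / 2))) := by
    refine tendsto_nhdsWithin_iff.2 ⟨?_, ?_⟩
    · rw [show -(Real.pi / 2) = -Real.pi / 2 by ring]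
      exact (tendsto_id.div_const 2).mono_left nhdsWithin_le_nhds
    · filter_upwards [self_mem_nhdsWithin] with u hu
      have : -Real.pi < u := hu
      change -(Real.pi / 2) < u / 2
      linarith
  have hb : Tendsto (fun u => 2 * Real.arctan ((A * Real.tan (u / 2) - B) / Δ)) (𝓝[<] Real.pi)
      (𝓝 (2 * (Real.pi / 2))) := by
    have h1 := (Real.tendsto_tan_pi_div_two.comp hhalf).const_mul_atTop hA0
    have h2 := (tendsto_atTop_add_const_right _ (-B) h1).atTop_div_const hΔ0
    exact ((Real.tendsto_arctan_atTop.mono_right nhdsWithin_le_nhds).comp h2).const_mul 2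
  have ha : Tendsto (fun u => 2 * Real.arctan ((A * Real.tan (u / 2) - B) / Δ)) (𝓝[>] (-Real.pi))
      (𝓝 (2 * (-(Real.pi / 2)))) := by
    have h1 := (Real.tendsto_tan_neg_pi_div_two.comp hhalf').const_mul_atBot hA0
    have h2 := (tendsto_atBot_add_const_right _ (-B) h1).atBot_div_const hΔ0
    exact ((Real.tendsto_arctan_atBot.mono_right nhdsWithin_le_nhds).comp h2).const_mul 2
  rw [intervalIntegral.integral_eq_sub_of_hasDerivAt_of_tendsto (by linarith) hderiv
    (hcont.intervalIntegrable _ _) ha hb]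
  ring

/-- Pointwise `√(1 + g²) < 1 + |g|` wherever `g ≠ 0`, hence almost everywhere, and both `1` and
`|g|` have mean `1` over the square. -/
theorem ell_lt_two {α x : ℝ} (hα : Real.sin α ≠ 0) (hx : Real.sin x ≠ 0) : ell α x < 2 := by
  have hpi := Real.pi_pos
  have hint := integrableOn_integrand hα hx
  have hmeas : Measurable fun p : ℝ × ℝ => |g α x p.1 p.2| := by unfold g; fun_prop
  have hg : Integrable (fun p : ℝ × ℝ => |g α x p.1 p.2|) (volume.restrict square) := by
    refine hint.mono' hmeas.aestronglyMeasurable (ae_of_all _ fun p => ?_)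
    rw [Real.norm_of_nonneg (abs_nonneg _), integrand]
    refine Real.le_sqrt_of_sq_le ?_
    linarith
  have hgint : ∫ p in square, |g α x p.1 p.2| = 4 * Real.pi ^ 2 := by
    rw [volume_restrict_square] at hg ⊢
    rw [integral_prod _ hg]
    have : ∀ᵐ s : ℝ ∂(volume.restrict (Set.Icc 0 (2 * Real.pi))),
        ∫ u in Set.Icc 0 (2 * Real.pi), |g α x s u| = 2 * Real.pi := by
      refine ae_restrict_of_ae ?_
      filter_upwards [ae_sin_half_ne_zero α, ae_sin_half_ne_zero (-α)] with s h1 h2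
      exact integral_abs_g hx h1 (by simpa [sub_eq_add_neg] using h2)
    rw [integral_congr_ae this, setIntegral_const, Real.volume_real_Icc_of_le (by positivity),
      smul_eq_mul]
    ring
  have hone : ∫ _p in square, (1 : ℝ) = 4 * Real.pi ^ 2 := by
    rw [volume_restrict_square, integral_const, ← Set.univ_prod_univ, measureReal_prod_prod,
      measureReal_restrict_apply_univ, Real.volume_real_Icc_of_le (by positivity), smul_eq_mul]
    ring
  have hdiff : Integrable (fun p => (1 + |g α x p.1 p.2|) - integrand α x p) (volume.restrict square) :=
    ((integrable_const 1).add hg).sub hint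
  have hnonneg : ∀ p : ℝ × ℝ, 0 ≤ (1 + |g α x p.1 p.2|) - integrand α x p := by
    intro p
    have := sqrt_add_sq_le (b := |g α x p.1 p.2|) zero_le_one
    rw [one_pow, abs_abs] at this
    rw [integrand]
    linarith
  have hval : ∫ p in square, ((1 + |g α x p.1 p.2|) - integrand α x p)
      = 8 * Real.pi ^ 2 - ∫ p in square, integrand α x p := by
    have h1 : Integrable (fun p : ℝ × ℝ => 1 + |g α x p.1 p.2|) (volume.restrict square) :=
      (integrable_const 1).add hg
    rw [integral_sub h1 hint, integral_add (integrable_const 1) hg, hone, hgint]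
    ring
  have hpos : 0 < ∫ p in square, ((1 + |g α x p.1 p.2|) - integrand α x p) := by
    refine lt_of_le_of_ne (integral_nonneg hnonneg) fun h => ?_
    have h0 := (integral_eq_zero_iff_of_nonneg hnonneg hdiff).1 h.symm
    have hfalse : ∀ᵐ p : ℝ × ℝ ∂(volume.restrict square), False := by
      filter_upwards [h0, ae_square_sin_ne_zero α x] with p h1 hp
      have hgpos : 0 < |g α x p.1 p.2| := by
        rw [abs_g_eq_div hx hp.1.1 hp.1.2]
        exact div_pos (abs_pos.2 (mul_ne_zero (mul_ne_zero hx hp.1.2) hp.1.1))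
          (g_denom_pos hx hp.1.1 hp.1.2 _)
      have h2 : (1 + |g α x p.1 p.2|) = Real.sqrt (1 + |g α x p.1 p.2| ^ 2) := by
        have : (1 + |g α x p.1 p.2|) - integrand α x p = 0 := h1
        rw [integrand] at this
        linarith
      have h3 : (1 + |g α x p.1 p.2|) ^ 2 = 1 + |g α x p.1 p.2| ^ 2 := by
        conv_lhs => rw [h2]
        exact Real.sq_sqrt (by positivity)
      nlinarith
    rw [ae_iff] at hfalse
    simp only [not_false_eq_true] at hfalse
    have h4 : ∫ _p in square, (1 : ℝ) = 0 := by
      have : (volume : Measure (ℝ × ℝ)).restrict square = 0 := Measure.measure_univ_eq_zero.1 hfalse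
      rw [this, integral_zero_measure]
    rw [hone] at h4
    have : 0 < 4 * Real.pi ^ 2 := by positivity
    linarith
  rw [hval] at hpos
  rw [ell, div_mul_eq_mul_div, one_mul, div_lt_iff₀ (by positivity)]
  linarith

/-! ### Divergence of the normalized expectation -/

section

variable {Ω : Type*} [MeasurableSpace Ω] {P : Measure Ω} [IsProbabilityMeasure P]

/-- Two subsequences are incompatible: a nonzero residue class forces a limit `ℓ < 2`, while the
class `n α ∈ 2π ℤ` forces a limit at least `2`. -/
theorem not_tendsto_expectedZeros_div {α : ℝ} {a b : ℕ+ → Ω → ℝ} (hab : IsCosineCorrelatedPair P α a b)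
    (hα : ∃ q : ℚ, α = Real.pi * (q : ℝ)) (hne : (residues α \ {0}).Nonempty) :
    ¬ ∃ L : ℝ, Tendsto (fun n : ℕ => (expectedZeros P a b n).toReal / n) atTop (𝓝 L) := by
  rintro ⟨L, hL⟩
  obtain ⟨x, hx⟩ := hne
  obtain ⟨hsx, hsα⟩ := sin_ne_zero_of_mem_residues hx
  obtain ⟨q, hq⟩ := hα
  have hden : (0 : ℝ) < q.den := by exact_mod_cast q.den_pos
  have hqα : (q.den : ℝ) * α = q.num * Real.pi := by
    have : (q : ℝ) = q.num / q.den := by exact_mod_cast (Rat.num_div_den q).symm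
    rw [hq, this]
    field_simp
  -- along the `n` with `n α ≡ x`, the limit is smaller than `2`
  have hlt : L < 2 := by
    obtain ⟨n₀, hn₀, hx₀⟩ := hx.1
    have hfreq : ∃ᶠ n : ℕ in atTop, modPi (n * α) = x := by
      rw [frequently_atTop]
      intro N
      -- Adding a multiple of `q.den` to the index changes `n α` by a multiple of `π`, so the class
      -- recurs.
      refine ⟨n₀ + N * q.den, ?_, ?_⟩
      · have := Nat.le_mul_of_pos_right N q.den_pos
        omega
      · rw [← hx₀, modPi, modPi]
        have e : ((n₀ + N * q.den : ℕ) : ℝ) * α = n₀ * α + ((N : ℤ) * q.num) • Real.pi := by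
          rw [zsmul_eq_mul]
          push_cast
          linear_combination (N : ℝ) * hqα
        rw [e, toIcoMod_add_zsmul]
    have : NeBot (atTop ⊓ 𝓟 {n : ℕ | modPi (n * α) = x}) :=
      frequently_mem_iff_neBot.1 hfreq
    rw [tendsto_nhds_unique (hL.mono_left inf_le_left) (tendsto_expectedZeros_div hab hx)]
    exact ell_lt_two hsα hsx
  -- along the `n` with `n α ≡ 0` modulo `2π`, the ratio is at least `2 - 1 / n`
  have hge : 2 ≤ L := by
    -- The factor `2` makes `n α` a multiple of `2π` rather than of `π`, as the deterministic zeros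
    -- require; `l + 1` keeps `n ≥ 2`, so that `n - 2` is not truncated.
    have hsub : Tendsto (fun l : ℕ => 2 * q.den * (l + 1)) atTop atTop := by
      refine tendsto_atTop_mono (fun l => ?_) tendsto_id
      have := q.den_pos
      simp only [id]
      nlinarith
    have h1 := hL.comp hsub
    have h2 : Tendsto (fun l : ℕ => (2 : ℝ) - 1 / ((2 * q.den * (l + 1) : ℕ) : ℝ)) atTop (𝓝 (2 - 0)) :=
      ((tendsto_one_div_atTop_nhds_zero_nat (𝕜 := ℝ)).comp hsub).const_sub 2
    rw [sub_zero] at h2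
    refine le_of_tendsto_of_tendsto' h2 h1 fun l => ?_
    have hn2 : 2 ≤ 2 * q.den * (l + 1) := by
      have := q.den_pos
      nlinarith
    simp only [Function.comp_apply]
    set n : ℕ := 2 * q.den * (l + 1) with hn
    have hk : n * α = 2 * Real.pi * ((q.num * (l + 1) : ℤ) : ℝ) := by
      rw [hn]
      push_cast
      linear_combination (2 * ((l : ℝ) + 1)) * hqα
    have hn1 : 1 ≤ n := by omega
    have hn0 : (0 : ℝ) < n := by positivity
    have hle := le_lintegral_numZeros_of_mul_eq hn1 hk
    rw [← expectedZeros_eq_lintegral hsα hab hn1] at hle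
    have hle' := ENNReal.toReal_mono (expectedZeros_ne_top hab hn1) hle
    rw [ENNReal.toReal_natCast] at hle'
    push_cast [Nat.cast_sub hn2] at hle'
    rw [le_div_iff₀ hn0, sub_mul, div_mul_cancel₀ _ hn0.ne']
    linarith
  linarith

end

end RandomTrig

end

theorem corollary1 {Ω : Type*} [MeasurableSpace Ω] (P : Measure Ω) [IsProbabilityMeasure P]
    (α : ℝ) (hα_nonneg : 0 ≤ α) (hα : ∃ q : ℚ, α = Real.pi * (q : ℝ))
    (a b : ℕ+ → Ω → ℝ) (hab : RandomTrig.IsCosineCorrelatedPair P α a b) :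
    -- the expectations are well defined and finite
    (∀ n : ℕ, 1 ≤ n →
      AEMeasurable (fun ω =>
        ((RandomTrig.numZeros (RandomTrig.trigPoly a b n ω) : ℕ∞) : ℝ≥0∞)) P ∧
      RandomTrig.expectedZeros P a b n ≠ ∞) ∧
    -- for each nonzero value `x` of `n α mod π`, the integral defining `ℓ^α(x)` converges,
    -- and `E[N(f_n)] / n` tends to `ℓ^α(x)` along the `n` with `n α ≡ x mod π`
    (∀ x ∈ RandomTrig.residues α \ {0},
      IntegrableOn (RandomTrig.integrand α x) RandomTrig.square ∧
      Tendsto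
        ({n : ℕ | RandomTrig.modPi (n * α) = x}.indicator fun n : ℕ =>
          |(RandomTrig.expectedZeros P a b n).toReal / n - RandomTrig.ell α x|)
        atTop (𝓝 0)) ∧
    -- if `n α mod π` takes a nonzero value, then `E[N(f_n)] / n` does not converge
    ((RandomTrig.residues α \ {0}).Nonempty →
      ¬ ∃ L : ℝ, Tendsto
        (fun n : ℕ => (RandomTrig.expectedZeros P a b n).toReal / n) atTop (𝓝 L)) := by
  refine ⟨fun n hn => ⟨RandomTrig.aemeasurable_numZeros_trigPoly
      (fun k => (hab.gaussian_left.hasGaussianLaw_eval k).aemeasurable)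
      (fun k => (hab.gaussian_right.hasGaussianLaw_eval k).aemeasurable) n,
    RandomTrig.expectedZeros_ne_top hab hn⟩, fun x hx => ⟨?_, ?_⟩,
    RandomTrig.not_tendsto_expectedZeros_div hab hα⟩
  · obtain ⟨h1, h2⟩ := RandomTrig.sin_ne_zero_of_mem_residues hx
    exact RandomTrig.integrableOn_integrand h2 h1
  · exact RandomTrig.tendsto_indicator_expectedZeros hab hx
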